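/- Let $N\ge 1$ and let $\Omega\subset\mathbb R^N$ be a bounded open set. **Nonlinearities.** Let $a\in C([0,\infty))$ with $a(0)=0$ and $a(s)>0$ for $s>0$. Let $h\in C((0,\infty))\cap L^1_{loc}([0,\infty))$ with $h>0$. Put $H(v)=\int_0^v h(r)\,dr$ for $v\ge 0$, $F(v)=h(v)a(v)$ for $v>0$ and $F(0)=0$; assume that $F$ is locally Lipschitz and nondecreasing on $[0,\infty)$. Assume that there are constants $p_1,q_1,c_3,\gamma_1,c_5>0$ and $\beta_1>\beta_2>q_1/2$ such that, for $s>0$, $$[H^{p_1}F]'(s)\ \ge\ c_3\,H(s)^{q_1},\qquad [H^{\gamma_1+1}]'(s)\ \le\ c_5\big(H(s)^{\beta_1}+H(s)^{\beta_2}\big).$$ Derivatives of functions involving $F$ (which is only locally Lipschitz) are required to satisfy their inequalities for almost every $s>0$. **Exponents.** Let $\delta_1=\frac{p_1+1}{\gamma_1+1}$ and assume $1\le\delta_1<2$. Let $\delta_2=1$ if $\delta_1\le\frac{N}{N-1}$ (where $\frac{N}{N-1}=\infty$ for $N=1$), and $\delta_2=\frac{\delta_1N}{N+\delta_1}$ otherwise.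 Let $$p_2=\Big(\beta_1-\frac{q_1}{2}\Big)\frac{2\delta_2}{2-\delta_2},\qquad p_3=\Big(\beta_2-\frac{q_1}{2}\Big)\frac{2\delta_2}{2-\delta_2}.$$ Let $p'\ge 0$ be such that $p'+1\ge p_2$ and $[F H^{p'}]'(s)\ge 0$ for almost every $s>0$. **Solution.** Let $u\ge 0$ be a strong (possibly unbounded) solution of $$[H(u)]_t-F(u)\Delta u\le 0\ \text{ in }\Omega\times(t_0,\infty),\qquad u(\cdot,t_0)=u_0\ \text{ in }\Omega,\qquad u=0\ \text{ on }\partial\Omega\times(t_0,\infty),$$ in the following sense. There is $g=[H(u)]_t\in L^2(\Omega\times(t_0,\infty))$ such that for every $t\ge t_0$, $H(u(x,t))=H(u_0(x))+\int_{t_0}^t g(x,\tau)\,d\tau$ for a.e. $x\in\Omega$. For a.e. $t>t_0$, $u(\cdot,t)\in W^{1,2}_{loc}(\Omega)$ has a weak Laplacian $\Delta u(\cdot,t)\in L^1_{loc}(\Omega)$. Moreover $F(u)\Delta u\in L^2(\Omega\times(t_0,\infty))$, and the inequality holds a.e. in $\Omega\times(t_0,\infty)$. The boundary condition means that $(u(\cdot,t)-\varepsilon)^+\in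 W^{1,2}_0(\Omega)$ for all $\varepsilon>0$ and a.e. $t>t_0$. Assume $H(u_0)\in L^{p_1+1}(\Omega)\cap L^{p'+1}(\Omega)$. Define, for $t\ge t_0$, $$Y(t)=\int_\Omega H(u(x,t))^{p_1+1}dx,\quad Z_1(t)=\int_\Omega H(u(x,t))^{p_2}dx,\quad Z_2(t)=\int_\Omega H(u(x,t))^{p_3}dx,\qquad Y_0=Y(t_0).$$ **Conclusion.** $Z_1$ and $Z_2$ are finite and bounded on $(t_0,\infty)$. The function $Y$ is finite on $[t_0,\infty)$ and absolutely continuous on $[t_0,T]$ for every $T\ge t_0$, and there is a constant $C_1>0$ such that $$Y'(t)+C_1\,[Y(t)]^{2/\delta_1}\le 0\qquad\text{for a.e. } t>t_0 .$$ If $Y_0=0$, then $Y(t)=0$ for all $t\ge t_0$. If $Y_0>0$, then, with the same $C_1$, $$Y(t)\le\Big[C_1\,\frac{2-\delta_1}{\delta_1}\,(t-t_0)+Y_0^{-\frac{2-\delta_1}{\delta_1}}\Big]^{-\frac{\delta_1}{2-\delta_1}}\qquad\text{for all } t\ge t_0 .$$ In all cases $\lim_{t\to\infty}Y(t)=0$.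 -/

import Mathlib

open MeasureTheory Set Filter Topology TopologicalSpace

noncomputable section

namespace DegenerateEinstein

/-! ### Sobolev notions on an open set `Ω ⊆ ℝᴺ` -/

section Sobolev

variable {N : ℕ} (Ω : Opens (EuclideanSpace ℝ (Fin N)))

/-- `V` is the weak gradient of `v` in `Ω`. -/
def HasWeakGradient (v : EuclideanSpace ℝ (Fin N) → ℝ)
    (V : EuclideanSpace ℝ (Fin N) → EuclideanSpace ℝ (Fin N)) : Prop :=
  LocallyIntegrableOn v (Ω : Set (EuclideanSpace ℝ (Fin N))) ∧
  LocallyIntegrableOn V (Ω : Set (EuclideanSpace ℝ (Fin N))) ∧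
  ∀ (φ : TestFunction Ω ℝ ⊤) (e : EuclideanSpace ℝ (Fin N)),
    ∫ x in (Ω : Set (EuclideanSpace ℝ (Fin N))), v x * fderiv ℝ φ x e =
      - ∫ x in (Ω : Set (EuclideanSpace ℝ (Fin N))), inner ℝ (V x) e * φ x

/-- `f` is the weak divergence of the vector field `V` in `Ω`; if `V` is the weak gradient of `v`,
then `f` is the weak Laplacian of `v`. -/
def HasWeakDivergence (V : EuclideanSpace ℝ (Fin N) → EuclideanSpace ℝ (Fin N))
    (f : EuclideanSpace ℝ (Fin N) → ℝ) : Prop :=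
  LocallyIntegrableOn V (Ω : Set (EuclideanSpace ℝ (Fin N))) ∧
  LocallyIntegrableOn f (Ω : Set (EuclideanSpace ℝ (Fin N))) ∧
  ∀ φ : TestFunction Ω ℝ ⊤,
    ∫ x in (Ω : Set (EuclideanSpace ℝ (Fin N))), fderiv ℝ φ x (V x) =
      - ∫ x in (Ω : Set (EuclideanSpace ℝ (Fin N))), f x * φ x

/-- `v ∈ W^{1,2}_loc(Ω)` with weak gradient `V`. -/
def IsW12Loc (v : EuclideanSpace ℝ (Fin N) → ℝ)
    (V : EuclideanSpace ℝ (Fin N) → EuclideanSpace ℝ (Fin N)) : Prop :=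
  HasWeakGradient Ω v V ∧
  ∀ K : Set (EuclideanSpace ℝ (Fin N)), IsCompact K → K ⊆ Ω →
    MemLp v 2 (volume.restrict K) ∧ MemLp V 2 (volume.restrict K)

/-- `v ∈ W^{1,2}_0(Ω)`: the closure of the test functions in `W^{1,2}(Ω)`. -/
def MemW12Zero (v : EuclideanSpace ℝ (Fin N) → ℝ) : Prop :=
  ∃ V : EuclideanSpace ℝ (Fin N) → EuclideanSpace ℝ (Fin N),
    HasWeakGradient Ω v V ∧
    MemLp v 2 (volume.restrict (Ω : Set (EuclideanSpace ℝ (Fin N)))) ∧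
    MemLp V 2 (volume.restrict (Ω : Set (EuclideanSpace ℝ (Fin N)))) ∧
    ∃ φ : ℕ → TestFunction Ω ℝ ⊤,
      Tendsto (fun n => eLpNorm (fun x => φ n x - v x) 2
        (volume.restrict (Ω : Set (EuclideanSpace ℝ (Fin N))))) atTop (𝓝 0) ∧
      Tendsto (fun n => eLpNorm (fun x => gradient (φ n) x - V x) 2
        (volume.restrict (Ω : Set (EuclideanSpace ℝ (Fin N))))) atTop (𝓝 0)

end Sobolev

/-! ### The nonlinearities -/

/-- `H(v) = ∫₀ᵛ h(r) dr`. -/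
def H (h : ℝ → ℝ) (v : ℝ) : ℝ := ∫ r in (0 : ℝ)..v, h r

/-- `F(v) = h(v) a(v)`; since `a(0) = 0` below, `F(0) = 0` whatever the value `h 0` is. -/
def F (h a : ℝ → ℝ) (v : ℝ) : ℝ := h v * a v

/-- Standing assumptions on the diffusion coefficient `a` and the weight `h`. -/
structure Admissible (h a : ℝ → ℝ) : Prop where
  a_cont : ContinuousOn a (Ici 0)
  a_zero : a 0 = 0
  a_pos : ∀ s > 0, 0 < a s
  h_cont : ContinuousOn h (Ioi 0)
  h_pos : ∀ s > 0, 0 < h s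
  h_loc : LocallyIntegrableOn h (Ici 0)
  F_lip : LocallyLipschitzOn (Ici 0) (F h a)
  F_mono : MonotoneOn (F h a) (Ici 0)

/-- `[F H^p]' ≥ 0`. As `F` is only locally Lipschitz, the derivative is taken almost everywhere
(where it exists by Rademacher's theorem). -/
def DerivNonneg (h a : ℝ → ℝ) (p : ℝ) : Prop :=
  ∀ᵐ s ∂(volume.restrict (Ioi (0 : ℝ))), 0 ≤ deriv (fun r => F h a r * H h r ^ p) s

/-- `[H^{p₁} F]' ≥ c₃ H^{q₁}`, the derivative being taken almost everywhere. -/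
def DerivLower (h a : ℝ → ℝ) (p₁ q₁ c₃ : ℝ) : Prop :=
  ∀ᵐ s ∂(volume.restrict (Ioi (0 : ℝ))),
    c₃ * H h s ^ q₁ ≤ deriv (fun r => H h r ^ p₁ * F h a r) s

/-- `[H^{γ₁+1}]' ≤ c₅ (H^{β₁} + H^{β₂})`. -/
def DerivUpper (h : ℝ → ℝ) (γ₁ β₁ β₂ c₅ : ℝ) : Prop :=
  ∀ s > 0, deriv (fun r => H h r ^ (γ₁ + 1)) s ≤ c₅ * (H h s ^ β₁ + H h s ^ β₂)

/-! ### Solutions of the initial boundary value problem -/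

/-- `u ≥ 0` is a (possibly unbounded) strong solution of
`[H(u)]_t - F(u) Δu ≤ 0` in `Ω × (t₀, ∞)`, `u(·, t₀) = u₀` in `Ω`, `u = 0` on `∂Ω × (t₀, ∞)`:
the functions `Ht = [H(u)]_t` and `F(u) Lap`, `Lap = Δu`, belong to `L²(Ω × (t₀, ∞))`, and the
inequality holds almost everywhere.

* `[H(u)]_t` is the `L²` time derivative, in integrated form; this fixes `u(·, t)` as an element
  of `L¹_loc` for every `t ≥ t₀`, continuously in time.
* For a.e. `t`, `u(·, t)` is in `W^{1,2}_loc(Ω)` with weak Laplacian `Lap t ∈ L¹_loc(Ω)`.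
* `u = 0` on `∂Ω` means `(u(·, t) - ε)⁺ ∈ W^{1,2}_0(Ω)` for all `ε > 0`. This holds if
  `u(·, t) ∈ W^{1,2}_0(Ω)`, and also if `u(·, t)` is continuous on the closure of a bounded `Ω` and
  vanishes on `∂Ω`. -/
def IsSolution {N : ℕ} (Ω : Opens (EuclideanSpace ℝ (Fin N))) (h a : ℝ → ℝ) (t₀ : ℝ)
    (u₀ : EuclideanSpace ℝ (Fin N) → ℝ) (u : ℝ → EuclideanSpace ℝ (Fin N) → ℝ) : Prop :=
  (∀ t ≥ t₀, ∀ᵐ x ∂(volume.restrict (Ω : Set (EuclideanSpace ℝ (Fin N)))), 0 ≤ u t x) ∧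
  (∀ᵐ x ∂(volume.restrict (Ω : Set (EuclideanSpace ℝ (Fin N)))), u t₀ x = u₀ x) ∧
  (∀ᵐ t ∂(volume.restrict (Ioi t₀)), ∀ ε > 0, MemW12Zero Ω (fun x => max (u t x - ε) 0)) ∧
  ∃ Ht Lap : ℝ → EuclideanSpace ℝ (Fin N) → ℝ,
    MemLp (fun z : ℝ × EuclideanSpace ℝ (Fin N) => Ht z.1 z.2) 2
      ((volume.restrict (Ioi t₀)).prod
        (volume.restrict (Ω : Set (EuclideanSpace ℝ (Fin N))))) ∧
    (∀ t ≥ t₀, ∀ᵐ x ∂(volume.restrict (Ω : Set (EuclideanSpace ℝ (Fin N)))),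
      H h (u t x) = H h (u t₀ x) + ∫ τ in t₀..t, Ht τ x) ∧
    (∀ᵐ t ∂(volume.restrict (Ioi t₀)),
      ∃ V : EuclideanSpace ℝ (Fin N) → EuclideanSpace ℝ (Fin N),
        IsW12Loc Ω (u t) V ∧ HasWeakDivergence Ω V (Lap t)) ∧
    MemLp (fun z : ℝ × EuclideanSpace ℝ (Fin N) => F h a (u z.1 z.2) * Lap z.1 z.2) 2
      ((volume.restrict (Ioi t₀)).prod
        (volume.restrict (Ω : Set (EuclideanSpace ℝ (Fin N))))) ∧
    (∀ᵐ z ∂((volume.restrict (Ioi t₀)).prod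
        (volume.restrict (Ω : Set (EuclideanSpace ℝ (Fin N))))),
      Ht z.1 z.2 - F h a (u z.1 z.2) * Lap z.1 z.2 ≤ 0)

/-! ### Exponents and functionals -/

/-- `δ₁ = (p₁ + 1) / (γ₁ + 1)`. -/
def delta1 (p₁ γ₁ : ℝ) : ℝ := (p₁ + 1) / (γ₁ + 1)

open Classical in
/-- `δ₂ = 1` if `δ₁ ≤ N / (N - 1)`, and `δ₂ = δ₁ N / (N + δ₁)` otherwise. The condition is
multiplied out, so that `N / (N - 1) = ∞` for `N = 1`. -/
def delta2 (N : ℕ) (δ₁ : ℝ) : ℝ :=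
  if δ₁ * ((N : ℝ) - 1) ≤ N then 1 else δ₁ * N / (N + δ₁)

/-- The exponent `(β - q₁/2) · 2δ₂ / (2 - δ₂)`. -/
def expZ (β q₁ δ₂ : ℝ) : ℝ := (β - q₁ / 2) * (2 * δ₂ / (2 - δ₂))

/-- `∫_Ω [H(u(x,t))]^r dx`. -/
def intH {N : ℕ} (Ω : Opens (EuclideanSpace ℝ (Fin N))) (h : ℝ → ℝ)
    (u : ℝ → EuclideanSpace ℝ (Fin N) → ℝ) (r t : ℝ) : ℝ :=
  ∫ x in (Ω : Set (EuclideanSpace ℝ (Fin N))), H h (u t x) ^ r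

end DegenerateEinstein

end

open MeasureTheory Set Filter Topology TopologicalSpace

noncomputable section

namespace DegenerateEinstein

/-! Write `w = H(u)`. Multiplying the differential inequality by `w^{p₁}` and integrating by parts
gives, formally, `Y' ≤ -(p₁+1) ∫ [H^{p₁}F]'(u) |∇u|² ≤ -c₃ (p₁+1) D` with the dissipation `D = ∫
H(u)^{q₁} |∇u|²`. Conversely, the Sobolev inequality from `W_0^{1,δ₂}` to `L^{δ₁}`, applied to
`H(u)^{γ₁+1}`, bounds `Y^{1/δ₁}` by the `L^{δ₂}` norm of `[H^{γ₁+1}]'(u) ∇u`. The upper bound on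
that derivative and Hölder's inequality with `1/δ₂ = 1/r + 1/2`, `r = 2δ₂/(2-δ₂)`, turn this into a
multiple of `(Z₁^{1/r} + Z₂^{1/r}) D^{1/2}`. Testing with `w^{p'}` shows that `∫ w^{p'+1}` does not
increase; hence `Z₁` and `Z₂` are bounded and `Y^{2/δ₁} ≤ K D`. Together these give `Y' + C₁
Y^{2/δ₁} ≤ 0`, which is integrated through `Y^{-(2-δ₁)/δ₁}`.

Three obstacles shape the rigorous version. The solution is only in `W^{1,2}_loc`, with boundary
values encoded by `(u-ε)⁺`; so integration by parts is replaced by the one-sided inequality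
`energy_le`, where the boundary contribution is dropped by sign. The function `F` is only locally
Lipschitz; so `energy_le` takes lower bounds on difference quotients (`SlopeGE`) instead of
derivatives, and `Admissible.slopeGE` supplies them. The solution may be unbounded; so the powers
are truncated at height `k`, and `HasTimeDeriv.exists_rate` obtains the rate of change of `Y` as a
monotone limit of truncated rates.

The two halves of the differential inequality are `IsTimeSlice.lintegral_dissipation_le` and
`IsTimeSlice.lintegral_rpow_le`. The latter rests on `eLpNorm_comp_le_of_memW12Zero`, a Sobolev
inequality for `w(v)` with `w'` possibly unbounded near `0` and at infinity. `decay_of_eq_integral`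
solves the differential inequality. -/

open scoped ENNReal NNReal Convolution ContDiff

/-! ### Convergence of mollifications in `L²`. -/

section Mollification

variable {E F : Type*} [NormedAddCommGroup E] [NormedSpace ℝ E] [FiniteDimensional ℝ E]
  [MeasurableSpace E] [BorelSpace E] [NormedAddCommGroup F]
  {μ : Measure E} [μ.IsAddHaarMeasure]

/-- Translations are continuous in `L²`. -/
theorem tendsto_eLpNorm_translate_sub {f : E → F} (hf : MemLp f 2 μ) :
    Tendsto (fun y => eLpNorm (fun x => f (x - y) - f x) 2 μ) (𝓝 0) (𝓝 0) := by
  have : Fact ((2 : ℝ≥0∞) ≠ ⊤) := ⟨by simp⟩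
  -- Translations act continuously on `L²`; acting by `-y` turns `f` into `x ↦ f (x - y)`.
  have hcont : Continuous fun y : E =>
      DomAddAct.mk (-y) +ᵥ hf.toLp f :=
    (DomAddAct.continuous_mk.comp continuous_neg).vadd continuous_const
  have h0 := hcont.tendsto 0
  rw [tendsto_iff_edist_tendsto_0] at h0
  refine h0.congr fun y => ?_
  rw [DomAddAct.mk_vadd_toLp, DomAddAct.mk_vadd_toLp, Lp.edist_toLp_toLp]
  congr 1
  ext x
  simp [sub_eq_neg_add]

variable [NormedSpace ℝ F]

/-- The error is the average of the translation errors `f (x - y) - f x` against the probability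
measure with density the bump. Jensen's inequality moves the square inside the average and Tonelli
exchanges the two integrals. -/
theorem eLpNorm_bump_convolution_sub_le [CompleteSpace F] {f : E → F} (hf : MemLp f 2 μ)
    (φ : ContDiffBump (0 : E)) {ε : ℝ≥0∞}
    (hε : ∀ y ∈ Metric.ball (0 : E) φ.rOut, eLpNorm (fun x => f (x - y) - f x) 2 μ ≤ ε) :
    eLpNorm (fun x => (φ.normed μ ⋆[ContinuousLinearMap.lsmul ℝ ℝ, μ] f) x - f x) 2 μ ≤ ε := by
  set ρ : E → ℝ≥0∞ := fun y => ENNReal.ofReal (φ.normed μ y) with hρ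
  have hρm : Measurable ρ := (φ.continuous_normed.measurable).ennreal_ofReal
  have hρi : ∫⁻ y, ρ y ∂μ = 1 := by
    rw [hρ, ← ofReal_integral_eq_lintegral_ofReal φ.integrable_normed
      (ae_of_all _ φ.nonneg_normed), φ.integral_normed, ENNReal.ofReal_one]
  set ν := μ.withDensity ρ with hν
  have : IsProbabilityMeasure ν := ⟨by rw [hν, withDensity_apply _ MeasurableSet.univ]; simpa using hρi⟩
  have hac : ν ≪ μ := withDensity_absolutelyContinuous _ _
  have hjoint : AEStronglyMeasurable (fun z : E × E => f (z.1 - z.2) - f z.1) (μ.prod μ) :=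
    (hf.1.comp_quasiMeasurePreserving (quasiMeasurePreserving_sub μ μ)).sub hf.1.comp_fst
  have hloc : LocallyIntegrable f μ := hf.locallyIntegrable (by norm_num)
  have hpt : ∀ x, (φ.normed μ ⋆[ContinuousLinearMap.lsmul ℝ ℝ, μ] f) x - f x
      = ∫ y, φ.normed μ y • (f (x - y) - f x) ∂μ := by
    intro x
    have hc : ConvolutionExistsAt (φ.normed μ) f x (ContinuousLinearMap.lsmul ℝ ℝ) μ :=
      φ.hasCompactSupport_normed.convolutionExists_left _ φ.continuous_normed hloc x
    have hc' : Integrable (fun y => φ.normed μ y • f (x - y)) μ := hc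
    simp only [smul_sub]
    rw [integral_sub hc' (φ.integrable_normed.smul_const _), integral_smul_const,
      φ.integral_normed, one_smul]
    rfl
  have key : ∀ᵐ x ∂μ, ‖(φ.normed μ ⋆[ContinuousLinearMap.lsmul ℝ ℝ, μ] f) x - f x‖ₑ ^ (2:ℝ)
      ≤ ∫⁻ y, ρ y * ‖f (x - y) - f x‖ₑ ^ (2:ℝ) ∂μ := by
    filter_upwards [hjoint.prodMk_left] with x hx
    rw [hpt]
    have h1 : ‖∫ y, φ.normed μ y • (f (x - y) - f x) ∂μ‖ₑ ≤ ∫⁻ y, ρ y * ‖f (x - y) - f x‖ₑ ∂μ := by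
      refine (enorm_integral_le_lintegral_enorm _).trans (lintegral_mono fun y => ?_)
      rw [enorm_smul, Real.enorm_of_nonneg (φ.nonneg_normed y)]
    have h2 : ∫⁻ y, ρ y * ‖f (x - y) - f x‖ₑ ∂μ = eLpNorm (fun y => f (x - y) - f x) 1 ν := by
      rw [eLpNorm_one_eq_lintegral_enorm, hν, lintegral_withDensity_eq_lintegral_mul₀ hρm.aemeasurable]
      · rfl
      · exact hx.enorm
    have h3 := eLpNorm_le_eLpNorm_of_exponent_le (μ := ν) (p := 1) (q := 2) (by norm_num)
      (hx.mono_ac hac)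
    have h4 : eLpNorm (fun y => f (x - y) - f x) 2 ν ^ (2:ℝ)
        = ∫⁻ y, ρ y * ‖f (x - y) - f x‖ₑ ^ (2:ℝ) ∂μ := by
      have := eLpNorm_nnreal_pow_eq_lintegral (p := 2) (μ := ν) (f := fun y => f (x - y) - f x)
        (by norm_num)
      norm_num at this
      rw [ENNReal.rpow_ofNat, this, hν,
        lintegral_withDensity_eq_lintegral_mul₀ hρm.aemeasurable]
      · simp
      · exact hx.enorm.pow_const _
    rw [← h4]
    gcongr
    exact h1.trans (h2.le.trans h3)
  have hfin : (eLpNorm (fun x => (φ.normed μ ⋆[ContinuousLinearMap.lsmul ℝ ℝ, μ] f) x - f x) 2 μ)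
      ^ (2:ℝ) ≤ ε ^ (2:ℝ) := by
    have hpow : ∀ g : E → F, eLpNorm g 2 μ ^ (2:ℝ) = ∫⁻ x, ‖g x‖ₑ ^ (2:ℝ) ∂μ := by
      intro g
      have := eLpNorm_nnreal_pow_eq_lintegral (p := 2) (μ := μ) (f := g) (by norm_num)
      norm_num at this
      simpa using this
    rw [hpow]
    calc _ ≤ ∫⁻ x, ∫⁻ y, ρ y * ‖f (x - y) - f x‖ₑ ^ (2:ℝ) ∂μ ∂μ := lintegral_mono_ae key
      _ = ∫⁻ y, ∫⁻ x, ρ y * ‖f (x - y) - f x‖ₑ ^ (2:ℝ) ∂μ ∂μ := by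
        rw [lintegral_lintegral_swap]
        exact ((hρm.comp measurable_snd).aemeasurable).mul (hjoint.enorm.pow_const _)
      _ ≤ ∫⁻ y, ρ y * ε ^ (2:ℝ) ∂μ := by
        refine lintegral_mono fun y => ?_
        rw [lintegral_const_mul' _ _ (by simp [hρ])]
        by_cases hy : y ∈ Metric.ball (0 : E) φ.rOut
        · rw [← hpow]
          gcongr
          exact hε y hy
        · have : φ.normed μ y = 0 := by
            rw [← Function.notMem_support, φ.support_normed_eq]; exact hy
          simp [hρ, this]
      _ = ε ^ (2:ℝ) := by
        rw [lintegral_mul_const _ hρm, hρi, one_mul]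
  exact (ENNReal.rpow_le_rpow_iff (by norm_num)).1 hfin

theorem tendsto_eLpNorm_bump_convolution_sub [CompleteSpace F] {f : E → F} (hf : MemLp f 2 μ)
    {φ : ℕ → ContDiffBump (0 : E)} (hφ : Tendsto (fun k => (φ k).rOut) atTop (𝓝 0)) :
    Tendsto (fun k => eLpNorm
      (fun x => ((φ k).normed μ ⋆[ContinuousLinearMap.lsmul ℝ ℝ, μ] f) x - f x) 2 μ)
      atTop (𝓝 0) := by
  rw [ENNReal.tendsto_nhds_zero]
  intro ε hε
  have := (ENNReal.tendsto_nhds_zero.1 (tendsto_eLpNorm_translate_sub hf)) ε hε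
  obtain ⟨δ, hδ, hball⟩ := Metric.eventually_nhds_iff_ball.1 this
  filter_upwards [hφ.eventually (gt_mem_nhds hδ)] with k hk
  exact eLpNorm_bump_convolution_sub_le hf (φ k) fun y hy =>
    hball y (Metric.ball_subset_ball hk.le hy)

end Mollification

/-- Euclidean space of dimension `N`. -/
abbrev Eucl (N : ℕ) : Type := EuclideanSpace ℝ (Fin N)

/-! ### Smooth approximation of `W^{1,2}_loc` functions on compact sets. -/

section Approximation

variable {N : ℕ} {Ω : Opens (Eucl N)}

theorem inner_gradient {f : Eucl N → ℝ} (x e : Eucl N) :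
    inner ℝ (gradient f x) e = fderiv ℝ f x e := by
  simp [gradient]

theorem norm_gradient {f : Eucl N → ℝ} (x : Eucl N) : ‖gradient f x‖ = ‖fderiv ℝ f x‖ := by
  simp [gradient]

/-- The derivative of the convolution falls on the kernel, and `y ↦ ρ (x - y)` is a test function in
`Ω` because the ball about `x` lies in `K`. The sign from differentiating `x - y` cancels the sign
in the weak gradient. Cutting off by the indicator of `K` makes the convolution meaningful on the
whole space and is invisible at such `x`. -/
theorem HasWeakGradient.gradient_bump_convolution {v : Eucl N → ℝ} {V : Eucl N → Eucl N}
    (hv : HasWeakGradient Ω v V) {K : Set (Eucl N)} (hK : IsCompact K) (hKΩ : K ⊆ Ω)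
    (φ : ContDiffBump (0 : Eucl N)) {x : Eucl N} (hx : Metric.closedBall x φ.rOut ⊆ K) :
    gradient (φ.normed volume ⋆[ContinuousLinearMap.lsmul ℝ ℝ, volume] K.indicator v) x
      = (φ.normed volume ⋆[ContinuousLinearMap.lsmul ℝ ℝ, volume] K.indicator V) x := by
  set ρ := φ.normed (volume : Measure (Eucl N)) with hρ
  have hvK : Integrable (K.indicator v) :=
    (hv.1.integrableOn_compact_subset hKΩ hK).integrable_indicator hK.measurableSet
  have hVK : Integrable (K.indicator V) :=
    (hv.2.1.integrableOn_compact_subset hKΩ hK).integrable_indicator hK.measurableSet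
  have hρs : ContDiff ℝ ∞ ρ := φ.contDiff_normed
  have hzero : ∀ y, y ∉ K → x - y ∉ tsupport ρ := by
    intro y hy hmem
    rw [hρ, φ.tsupport_normed_eq] at hmem
    apply hy (hx _)
    simpa [dist_eq_norm, norm_sub_rev] using hmem
  let η : TestFunction Ω ℝ ⊤ :=
    { toFun := fun y => ρ (x - y)
      contDiff' := hρs.comp (contDiff_const.sub contDiff_id)
      hasCompactSupport' := φ.hasCompactSupport_normed.comp_homeomorph (Homeomorph.subLeft x)
      tsupport_subset' := by
        refine (closure_minimal ?_ hK.isClosed).trans hKΩ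
        intro y hy
        by_contra hyK
        exact hzero y hyK (subset_tsupport _ hy) }
  have hη : ∀ y, η y = ρ (x - y) := fun y => rfl
  have hdη : ∀ y e, fderiv ℝ η y e = -fderiv ℝ ρ (x - y) e := by
    intro y e
    have h1 : HasFDerivAt (fun y : Eucl N => x - y) (-ContinuousLinearMap.id ℝ (Eucl N)) y := by
      simpa using (hasFDerivAt_id y).const_sub x
    have h2 := ((hρs.differentiable (by simp)) (x - y)).hasFDerivAt.comp y h1
    have h3 : fderiv ℝ η y = _ := h2.fderiv
    rw [h3]; simp
  refine ext_inner_right ℝ fun e => ?_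
  rw [inner_gradient, (φ.hasCompactSupport_normed.hasFDerivAt_convolution_left
    (ContinuousLinearMap.lsmul ℝ ℝ) (hρs.of_le (by simp)) hvK.locallyIntegrable x).fderiv,
    convolution_eq_swap, convolution_eq_swap]
  have hc1 : Integrable fun y => (ContinuousLinearMap.precompL (Eucl N)
      (ContinuousLinearMap.lsmul ℝ ℝ)) (fderiv ℝ ρ (x - y)) (K.indicator v y) := by
    have := (φ.hasCompactSupport_normed (μ := volume)).fderiv (𝕜 := ℝ) |>.convolutionExists_left
      (ContinuousLinearMap.precompL (Eucl N) (ContinuousLinearMap.lsmul ℝ ℝ))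
      (hρs.continuous_fderiv (by simp)) hvK.locallyIntegrable x
    exact this.integrable_swap
  have hc2 : Integrable fun y => (ContinuousLinearMap.lsmul ℝ ℝ) (ρ (x - y)) (K.indicator V y) := by
    have := (φ.hasCompactSupport_normed (μ := volume)).convolutionExists_left
      (ContinuousLinearMap.lsmul ℝ ℝ) hρs.continuous hVK.locallyIntegrable x
    exact this.integrable_swap
  rw [← hρ, ContinuousLinearMap.integral_apply hc1 e, real_inner_comm, ← integral_inner hc2]
  have hw := hv.2.2 η e
  simp only [hdη, hη, mul_neg, integral_neg, neg_inj] at hw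
  have hA : ∫ y, (ContinuousLinearMap.precompL (Eucl N)
      (ContinuousLinearMap.lsmul ℝ ℝ)) (fderiv ℝ ρ (x - y)) (K.indicator v y) e
      = ∫ y in (Ω : Set (Eucl N)), v y * fderiv ℝ ρ (x - y) e := by
    rw [← integral_indicator Ω.isOpen.measurableSet]
    congr 1; ext y
    by_cases hy : y ∈ K
    · simp [hy, hKΩ hy, mul_comm]
    · have h0 : fderiv ℝ ρ (x - y) = 0 := by
        by_contra h
        exact hzero y hy (support_fderiv_subset ℝ h)
      by_cases hyΩ : y ∈ (Ω : Set (Eucl N)) <;> simp [hy, hyΩ, h0]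
  have hB : ∫ y, inner ℝ e ((ContinuousLinearMap.lsmul ℝ ℝ) (ρ (x - y)) (K.indicator V y))
      = ∫ y in (Ω : Set (Eucl N)), inner ℝ (V y) e * ρ (x - y) := by
    rw [← integral_indicator Ω.isOpen.measurableSet]
    congr 1; ext y
    by_cases hy : y ∈ K
    · simp [hy, hKΩ hy, inner_smul_right, mul_comm, real_inner_comm]
    · have h0 : ρ (x - y) = 0 := image_eq_zero_of_notMem_tsupport (hzero y hy)
      by_cases hyΩ : y ∈ (Ω : Set (Eucl N)) <;> simp [hy, hyΩ, h0]
  rw [hA, hB, hw]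

/-- The function is cut off to a compact thickening of `K` inside `Ω`, so that at points of `K`
mollification commutes with the weak gradient for all radii up to `δ`. -/
theorem IsW12Loc.exists_smooth_approx {v : Eucl N → ℝ} {V : Eucl N → Eucl N}
    (hv : IsW12Loc Ω v V) {K : Set (Eucl N)} (hK : IsCompact K) (hKΩ : K ⊆ Ω) :
    ∃ U : ℕ → Eucl N → ℝ, (∀ k, ContDiff ℝ ∞ (U k)) ∧
      Tendsto (fun k => eLpNorm (fun x => U k x - v x) 2 (volume.restrict K)) atTop (𝓝 0) ∧
      Tendsto (fun k => eLpNorm (fun x => gradient (U k) x - V x) 2 (volume.restrict K))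
        atTop (𝓝 0) ∧
      ∀ᵐ x ∂(volume.restrict K), Tendsto (fun k => U k x) atTop (𝓝 (v x)) := by
  obtain ⟨δ, hδ, hδΩ⟩ := hK.exists_cthickening_subset_open Ω.isOpen hKΩ
  set K' := Metric.cthickening δ K with hK'
  have hK'c : IsCompact K' := hK.cthickening
  have hKK' : K ⊆ K' := Metric.self_subset_cthickening K
  -- The outer radius is twice the inner one for every `k`: the bounded ratio is what Lebesgue
  -- differentiation needs for the almost everywhere convergence below.
  let φ : ℕ → ContDiffBump (0 : Eucl N) := fun k =>
    ⟨δ / (2 * (k + 1)), δ / (k + 1), by positivity, by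
      rw [div_lt_div_iff₀ (by positivity) (by positivity)]
      have : (0:ℝ) < k + 1 := by positivity
      nlinarith [mul_pos hδ this]⟩
  have hφ : Tendsto (fun k => (φ k).rOut) atTop (𝓝 0) := by
    change Tendsto (fun k : ℕ => δ / ((k : ℝ) + 1)) atTop (𝓝 0)
    simpa [div_eq_mul_inv] using
      (tendsto_one_div_add_atTop_nhds_zero_nat (𝕜 := ℝ)).const_mul δ
  have hle : ∀ k, (φ k).rOut ≤ δ := fun k =>
    div_le_self hδ.le (by linarith [(Nat.cast_nonneg k : (0:ℝ) ≤ k)])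
  obtain ⟨hm, hM⟩ := hv.2 K' hK'c hδΩ
  have hm' := (memLp_indicator_iff_restrict hK'c.measurableSet).2 hm
  have hM' := (memLp_indicator_iff_restrict hK'c.measurableSet).2 hM
  have hloc : LocallyIntegrable (K'.indicator v) := hm'.locallyIntegrable (by norm_num)
  refine ⟨fun k => (φ k).normed volume ⋆[ContinuousLinearMap.lsmul ℝ ℝ, volume] K'.indicator v,
    fun k => (φ k).hasCompactSupport_normed.contDiff_convolution_left _ (φ k).contDiff_normed hloc,
    ?_, ?_, ?_⟩
  · refine tendsto_of_tendsto_of_tendsto_of_le_of_le tendsto_const_nhds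
      (tendsto_eLpNorm_bump_convolution_sub hm' hφ) (fun _ => zero_le) fun k => ?_
    refine (eLpNorm_congr_ae ?_).trans_le (eLpNorm_mono_measure _ Measure.restrict_le_self)
    filter_upwards [ae_restrict_mem hK.measurableSet] with x hx
    rw [indicator_of_mem (hKK' hx)]
  · refine tendsto_of_tendsto_of_tendsto_of_le_of_le tendsto_const_nhds
      (tendsto_eLpNorm_bump_convolution_sub hM' hφ) (fun _ => zero_le) fun k => ?_
    refine (eLpNorm_congr_ae ?_).trans_le (eLpNorm_mono_measure _ Measure.restrict_le_self)
    filter_upwards [ae_restrict_mem hK.measurableSet] with x hx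
    rw [indicator_of_mem (hKK' hx), hv.1.gradient_bump_convolution hK'c hδΩ]
    exact (Metric.closedBall_subset_closedBall (hle k)).trans
      (Metric.closedBall_subset_cthickening hx δ)
  · have := ContDiffBump.ae_convolution_tendsto_right_of_locallyIntegrable (K := 2) hφ
      (Eventually.of_forall fun k => by
        change δ / (k + 1) ≤ 2 * (δ / (2 * (k + 1)))
        apply le_of_eq; field_simp) hloc
    filter_upwards [ae_restrict_mem hK.measurableSet, ae_restrict_of_ae this] with x hx h
    rwa [indicator_of_mem (hKK' hx)] at h

end Approximation

/-! ### Chain rule and tested Laplacian for `W^{1,2}_loc` functions. -/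

section WeakCalculus

theorem tendsto_integral_of_norm_le_mul {α G B : Type*} [MeasurableSpace α] {μ : Measure α}
    [NormedAddCommGroup G] [NormedAddCommGroup B] {f : ℕ → α → ℝ} {g : ℕ → α → G} {b : α → B}
    {C : ℝ} (hf : ∀ k, ∀ᵐ x ∂μ, ‖f k x‖ ≤ C * (‖g k x‖ * ‖b x‖))
    (hg : ∀ k, AEStronglyMeasurable (g k) μ)
    (hg0 : Tendsto (fun k => eLpNorm (g k) 2 μ) atTop (𝓝 0)) (hb : MemLp b 2 μ) :
    Tendsto (fun k => ∫ x, f k x ∂μ) atTop (𝓝 0) := by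
  rw [tendsto_zero_iff_enorm_tendsto_zero]
  have hlim : Tendsto (fun k => ENNReal.ofReal C * (eLpNorm (g k) 2 μ * eLpNorm b 2 μ))
      atTop (𝓝 0) := by
    have := ENNReal.Tendsto.const_mul (ENNReal.Tendsto.mul_const hg0 (Or.inr hb.eLpNorm_ne_top))
      (Or.inr (ENNReal.ofReal_ne_top (r := C)))
    simpa using this
  refine tendsto_of_tendsto_of_tendsto_of_le_of_le tendsto_const_nhds hlim (fun _ => zero_le)
    fun k => ?_
  calc ‖∫ x, f k x ∂μ‖ₑ ≤ ∫⁻ x, ‖f k x‖ₑ ∂μ := enorm_integral_le_lintegral_enorm _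
    _ ≤ ∫⁻ x, ENNReal.ofReal C * (‖g k x‖ₑ * ‖b x‖ₑ) ∂μ := by
      refine lintegral_mono_ae ?_
      filter_upwards [hf k] with x hx
      have h1 : ‖f k x‖ₑ ≤ ENNReal.ofReal (C * (‖g k x‖ * ‖b x‖)) := by
        rw [← ofReal_norm]; exact ENNReal.ofReal_le_ofReal hx
      rwa [ENNReal.ofReal_mul' (by positivity), ENNReal.ofReal_mul (norm_nonneg _), ofReal_norm,
        ofReal_norm] at h1
    _ = ENNReal.ofReal C * ∫⁻ x, ((fun x => ‖g k x‖ₑ) * fun x => ‖b x‖ₑ) x ∂μ := by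
      rw [lintegral_const_mul' _ _ ENNReal.ofReal_ne_top]; rfl
    _ ≤ ENNReal.ofReal C * (eLpNorm (g k) 2 μ * eLpNorm b 2 μ) := by
      gcongr
      rw [eLpNorm_eq_lintegral_rpow_enorm_toReal (by norm_num) (by norm_num),
        eLpNorm_eq_lintegral_rpow_enorm_toReal (by norm_num) (by norm_num), ENNReal.toReal_ofNat]
      exact ENNReal.lintegral_mul_le_Lp_mul_Lq μ Real.HolderConjugate.two_two (hg k).enorm
        hb.1.enorm

/-- A bounded, almost everywhere convergent coefficient times an `L²`-convergent field. Writing `g k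
= g' + (g k - g')`, dominated convergence handles the first summand and Cauchy–Schwarz the second.
-/
theorem tendsto_integral_mul_inner {α G : Type*} [MeasurableSpace α] {μ : Measure α}
    [NormedAddCommGroup G] [InnerProductSpace ℝ G] {c : ℕ → α → ℝ} {c' : α → ℝ}
    {g : ℕ → α → G} {g' b : α → G} {C : ℝ}
    (hc : ∀ k, AEStronglyMeasurable (c k) μ) (hcC : ∀ k, ∀ᵐ x ∂μ, ‖c k x‖ ≤ C)
    (hcc' : ∀ᵐ x ∂μ, Tendsto (fun k => c k x) atTop (𝓝 (c' x)))
    (hg : ∀ k, AEStronglyMeasurable (g k) μ) (hg' : MemLp g' 2 μ)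
    (hgg' : Tendsto (fun k => eLpNorm (fun x => g k x - g' x) 2 μ) atTop (𝓝 0))
    (hb : MemLp b 2 μ) :
    Tendsto (fun k => ∫ x, c k x * inner ℝ (g k x) (b x) ∂μ) atTop
      (𝓝 (∫ x, c' x * inner ℝ (g' x) (b x) ∂μ)) := by
  have hprod : Integrable (fun x => ‖g' x‖ * ‖b x‖) μ := hg'.norm.integrable_mul hb.norm
  have h1 : Tendsto (fun k => ∫ x, c k x * inner ℝ (g' x) (b x) ∂μ) atTop
      (𝓝 (∫ x, c' x * inner ℝ (g' x) (b x) ∂μ)) := by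
    refine tendsto_integral_of_dominated_convergence (fun x => C * (‖g' x‖ * ‖b x‖))
      (fun k => (hc k).mul (hg'.1.inner hb.1)) (hprod.const_mul C) (fun k => ?_) ?_
    · filter_upwards [hcC k] with x hx
      rw [norm_mul]
      exact mul_le_mul hx (norm_inner_le_norm _ _) (norm_nonneg _) ((norm_nonneg _).trans hx)
    · filter_upwards [hcc'] with x hx using hx.mul_const _
  have h2 : Tendsto (fun k => ∫ x, c k x * inner ℝ (g k x - g' x) (b x) ∂μ) atTop (𝓝 0) := by
    refine tendsto_integral_of_norm_le_mul (C := C) (fun k => ?_) (fun k => (hg k).sub hg'.1) hgg' hb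
    filter_upwards [hcC k] with x hx
    rw [norm_mul]
    exact mul_le_mul hx (norm_inner_le_norm _ _) (norm_nonneg _) ((norm_nonneg _).trans hx)
  have hadd := h1.add h2
  rw [add_zero] at hadd
  refine hadd.congr' ?_
  -- The fields `g k` are only assumed measurable, so the integral may be split only once the error
  -- is known to be in `L²`, that is, for large `k`.
  have hfin : ∀ᶠ k in atTop, eLpNorm (fun x => g k x - g' x) 2 μ < ⊤ :=
    hgg'.eventually (gt_mem_nhds ENNReal.zero_lt_top)
  filter_upwards [hfin] with k hk
  have hmem : MemLp (fun x => g k x - g' x) 2 μ := ⟨(hg k).sub hg'.1, hk⟩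
  have hint : ∀ w : α → G, MemLp w 2 μ → Integrable (fun x => c k x * inner ℝ (w x) (b x)) μ := by
    intro w hw
    refine ((hw.norm.integrable_mul hb.norm).const_mul C).mono'
      ((hc k).mul (hw.1.inner hb.1)) ?_
    filter_upwards [hcC k] with x hx
    rw [norm_mul]
    exact mul_le_mul hx (norm_inner_le_norm _ _) (norm_nonneg _) ((norm_nonneg _).trans hx)
  rw [← integral_add (hint _ hg') (hint _ hmem)]
  congr 1; ext x
  rw [inner_sub_left]; ring

variable {N : ℕ} {Ω : Opens (Eucl N)}

theorem setIntegral_eq_of_tsupport {φ : Eucl N → ℝ} (hφ : tsupport φ ⊆ Ω) {f : Eucl N → ℝ}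
    (hf : ∀ x, x ∉ tsupport φ → f x = 0) :
    ∫ x in (Ω : Set (Eucl N)), f x = ∫ x in tsupport φ, f x :=
  setIntegral_eq_of_subset_of_forall_sdiff_eq_zero Ω.isOpen.measurableSet hφ
    fun x hx => hf x hx.2

theorem continuous_gradient {f : Eucl N → ℝ} (hf : ContDiff ℝ ∞ f) : Continuous (gradient f) :=
  (InnerProductSpace.toDual ℝ (Eucl N)).symm.continuous.comp (hf.continuous_fderiv (by simp))

theorem fderiv_eq_zero_of_notMem_tsupport {f : Eucl N → ℝ} {x : Eucl N} (hx : x ∉ tsupport f) :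
    fderiv ℝ f x = 0 := by
  by_contra h
  exact hx (support_fderiv_subset ℝ h)

/-- The identity is classical for the smooth approximants on the support of `φ`. It survives the
limit because `g` is Lipschitz (left side) and `deriv g` is bounded and continuous (right side). -/
theorem IsW12Loc.integral_comp_mul_fderiv {v : Eucl N → ℝ} {V : Eucl N → Eucl N}
    (hv : IsW12Loc Ω v V) {g : ℝ → ℝ} (hg : ContDiff ℝ ∞ g) {C : ℝ}
    (hgC : ∀ s, ‖deriv g s‖ ≤ C) (φ : TestFunction Ω ℝ ⊤) (e : Eucl N) :
    ∫ x in (Ω : Set (Eucl N)), g (v x) * fderiv ℝ φ x e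
      = -∫ x in (Ω : Set (Eucl N)), deriv g (v x) * inner ℝ (V x) e * φ x := by
  set K := tsupport φ with hKdef
  have hK : IsCompact K := φ.hasCompactSupport
  have hKΩ : K ⊆ Ω := φ.tsupport_subset
  have : IsFiniteMeasure (volume.restrict K : Measure (Eucl N)) :=
    isFiniteMeasure_restrict.2 hK.measure_lt_top.ne
  obtain ⟨U, hUs, hU0, hU1, hUae⟩ := hv.exists_smooth_approx hK hKΩ
  obtain ⟨hvK, hVK⟩ := hv.2 K hK hKΩ
  have hLip : LipschitzWith (Real.toNNReal C) g :=
    lipschitzWith_of_nnnorm_deriv_le (hg.differentiable (by simp)) fun s => by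
      rw [← NNReal.coe_le_coe]
      exact (hgC s).trans (Real.le_coe_toNNReal C)
  obtain ⟨D, hD⟩ := φ.hasCompactSupport.exists_bound_of_continuous φ.continuous
  obtain ⟨D', hD'⟩ := (φ.hasCompactSupport.fderiv (𝕜 := ℝ)).exists_bound_of_continuous
    (φ.contDiff.continuous_fderiv (by simp))
  have hdg : Continuous (deriv g) := hg.continuous_deriv (by simp)
  have hconst : MemLp (fun _ : Eucl N => e) 2 (volume.restrict K) := memLp_const e
  have hone : MemLp (fun _ : Eucl N => (1 : ℝ)) 2 (volume.restrict K) := memLp_const 1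
  rw [setIntegral_eq_of_tsupport φ.tsupport_subset fun x hx => by
      rw [fderiv_eq_zero_of_notMem_tsupport hx]; simp,
    setIntegral_eq_of_tsupport φ.tsupport_subset fun x hx => by
      rw [image_eq_zero_of_notMem_tsupport hx, mul_zero]]
  have hgv : MemLp (fun x => g (v x)) 2 (volume.restrict K) := by
    have h1 : MemLp (fun x => g (v x) - g 0) 2 (volume.restrict K) := by
      refine hvK.of_le_mul (c := (Real.toNNReal C : ℝ))
        ((hg.continuous.comp_aestronglyMeasurable hvK.1).sub aestronglyMeasurable_const)
        (ae_of_all _ fun x => ?_)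
      simpa [dist_eq_norm] using hLip.dist_le_mul (v x) 0
    have h2 : MemLp (fun _ : Eucl N => g 0) 2 (volume.restrict K) := memLp_const _
    exact (h1.add h2).ae_eq (ae_of_all _ fun x => by simp)
  -- The scalar product with `1 : ℝ` only serves to bring a product of reals into the form of
  -- `tendsto_integral_mul_inner`.
  have hleft : Tendsto (fun k => ∫ x in K, fderiv ℝ φ x e * inner ℝ (g (U k x)) (1 : ℝ)) atTop
      (𝓝 (∫ x in K, fderiv ℝ φ x e * inner ℝ (g (v x)) (1 : ℝ))) := by
    refine tendsto_integral_mul_inner (C := D' * ‖e‖) (fun k => ?_) (fun k => ae_of_all _ fun x => ?_)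
      (ae_of_all _ fun x => tendsto_const_nhds) (fun k => ?_) hgv ?_ hone
    · exact ((φ.contDiff.continuous_fderiv (by simp)).clm_apply
        continuous_const).aestronglyMeasurable
    · exact ((fderiv ℝ φ x).le_opNorm e).trans (by gcongr; exact hD' x)
    · exact (hg.continuous.comp (hUs k).continuous).aestronglyMeasurable
    · have hlim := ENNReal.Tendsto.const_mul hU0
        (Or.inr (ENNReal.ofReal_ne_top (r := (Real.toNNReal C : ℝ))))
      rw [mul_zero] at hlim
      refine tendsto_of_tendsto_of_tendsto_of_le_of_le tendsto_const_nhds hlim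
        (fun _ => zero_le) fun k => ?_
      refine eLpNorm_le_mul_eLpNorm_of_ae_le_mul (ae_of_all _ fun x => ?_) 2
      simpa [dist_eq_norm] using hLip.dist_le_mul (U k x) (v x)
  have hright : Tendsto (fun k => ∫ x in K, (deriv g (U k x) * φ x) * inner ℝ (gradient (U k) x) e)
      atTop (𝓝 (∫ x in K, (deriv g (v x) * φ x) * inner ℝ (V x) e)) := by
    refine tendsto_integral_mul_inner (C := C * D) (fun k => ?_) (fun k => ae_of_all _ fun x => ?_)
      ?_ (fun k => (continuous_gradient (hUs k)).aestronglyMeasurable) hVK hU1 hconst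
    · exact ((hdg.comp (hUs k).continuous).mul φ.continuous).aestronglyMeasurable
    · rw [norm_mul]
      exact mul_le_mul (hgC _) (hD x) (norm_nonneg _) ((norm_nonneg _).trans (hgC 0))
    · filter_upwards [hUae] with x hx using ((hdg.tendsto _).comp hx).mul_const _
  have heq : ∀ k, ∫ x in K, fderiv ℝ φ x e * inner ℝ (g (U k x)) (1 : ℝ)
      = -∫ x in K, (deriv g (U k x) * φ x) * inner ℝ (gradient (U k) x) e := by
    intro k
    have hgU : ContDiff ℝ ∞ fun x => g (U k x) := hg.comp (hUs k)
    have hd : ∀ x, fderiv ℝ (fun x => g (U k x)) x e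
        = deriv g (U k x) * inner ℝ (gradient (U k) x) e := by
      intro x
      have := (((hg.differentiable (by simp)) (U k x)).hasDerivAt.comp_hasFDerivAt x
        (((hUs k).differentiable (by simp)) x).hasFDerivAt).fderiv
      rw [inner_gradient]
      erw [this]
      simp
    have hs1 : HasCompactSupport fun x => fderiv ℝ φ x e :=
      (φ.hasCompactSupport.fderiv (𝕜 := ℝ)).mono fun x hx => by
        contrapose! hx
        simp only [Function.notMem_support] at hx ⊢
        rw [hx]; simp
    have hc1 : Continuous fun x => fderiv ℝ φ x e :=
      (φ.contDiff.continuous_fderiv (by simp)).clm_apply continuous_const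
    have hc2 : Continuous fun x => fderiv ℝ (fun x => g (U k x)) x e :=
      (hgU.continuous_fderiv (by simp)).clm_apply continuous_const
    have hibp := integral_mul_fderiv_eq_neg_fderiv_mul_of_integrable (μ := (volume : Measure (Eucl N)))
      (f := fun x => g (U k x)) (g := φ) (v := e)
      ((hc2.mul φ.continuous).integrable_of_hasCompactSupport φ.hasCompactSupport.mul_left)
      ((hgU.continuous.mul hc1).integrable_of_hasCompactSupport hs1.mul_left)
      ((hgU.continuous.mul φ.continuous).integrable_of_hasCompactSupport
        φ.hasCompactSupport.mul_left)
      (fun x _ => hgU.differentiable (by simp) x)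
      (fun x _ => φ.contDiff.differentiable (by simp) x)
    have e1 : ∫ x in K, fderiv ℝ φ x e * inner ℝ (g (U k x)) (1 : ℝ)
        = ∫ x, g (U k x) * fderiv ℝ φ x e := by
      rw [setIntegral_eq_integral_of_forall_compl_eq_zero fun x hx => by
        rw [fderiv_eq_zero_of_notMem_tsupport hx]; simp]
      congr 1; ext x; simp [mul_comm]
    have e2 : ∫ x in K, (deriv g (U k x) * φ x) * inner ℝ (gradient (U k) x) e
        = ∫ x, fderiv ℝ (fun x => g (U k x)) x e * φ x := by
      rw [setIntegral_eq_integral_of_forall_compl_eq_zero fun x hx => by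
        rw [image_eq_zero_of_notMem_tsupport hx]; simp]
      congr 1; ext x; rw [hd]; ring
    rw [e1, e2, hibp]
  have := tendsto_nhds_unique hleft ((hright.neg).congr fun k => (heq k).symm)
  calc _ = ∫ x in K, fderiv ℝ φ x e * inner ℝ (g (v x)) (1 : ℝ) := by
        congr 1; ext x; simp [mul_comm]
    _ = _ := this
    _ = _ := by congr 2; ext x; ring

/-- This is the weak Laplacian tested with `η ψ(v)`, which is not smooth. The admissible test
functions `η ψ(U k)` are used instead; since `L` is merely integrable on the support, the right side
passes to the limit by boundedness and almost everywhere convergence of `ψ(U k)`. -/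
theorem HasWeakDivergence.integral_comp_mul {v : Eucl N → ℝ} {V : Eucl N → Eucl N}
    {L : Eucl N → ℝ} (hv : IsW12Loc Ω v V) (hL : HasWeakDivergence Ω V L)
    {ψ : ℝ → ℝ} (hψ : ContDiff ℝ ∞ ψ) {C : ℝ}
    (hψC : ∀ s, ‖ψ s‖ ≤ C) (hψC' : ∀ s, ‖deriv ψ s‖ ≤ C) (η : TestFunction Ω ℝ ⊤) :
    (∫ x in (Ω : Set (Eucl N)), ψ (v x) * inner ℝ (gradient η x) (V x))
      + ∫ x in (Ω : Set (Eucl N)), η x * deriv ψ (v x) * ‖V x‖ ^ 2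
      = -∫ x in (Ω : Set (Eucl N)), η x * ψ (v x) * L x := by
  set K := tsupport η with hKdef
  have hK : IsCompact K := η.hasCompactSupport
  have hKΩ : K ⊆ Ω := η.tsupport_subset
  have : IsFiniteMeasure (volume.restrict K : Measure (Eucl N)) :=
    isFiniteMeasure_restrict.2 hK.measure_lt_top.ne
  obtain ⟨U, hUs, hU0, hU1, hUae⟩ := hv.exists_smooth_approx hK hKΩ
  obtain ⟨hvK, hVK⟩ := hv.2 K hK hKΩ
  obtain ⟨D, hD⟩ := η.hasCompactSupport.exists_bound_of_continuous η.continuous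
  obtain ⟨D', hD'⟩ := (η.hasCompactSupport.fderiv (𝕜 := ℝ)).exists_bound_of_continuous
    (η.contDiff.continuous_fderiv (by simp))
  have hdψ : Continuous (deriv ψ) := hψ.continuous_deriv (by simp)
  have hC0 : 0 ≤ C := (norm_nonneg _).trans (hψC 0)
  have hηg : Continuous (gradient η) := continuous_gradient η.contDiff
  have hgrad0 : ∀ x, x ∉ K → gradient η x = 0 := fun x hx => by
    rw [gradient, fderiv_eq_zero_of_notMem_tsupport hx, map_zero]
  have hLK : IntegrableOn L K := hL.2.1.integrableOn_compact_subset hKΩ hK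
  rw [setIntegral_eq_of_tsupport η.tsupport_subset fun x hx => by
      rw [hgrad0 x hx]; simp,
    setIntegral_eq_of_tsupport η.tsupport_subset fun x hx => by
      rw [image_eq_zero_of_notMem_tsupport hx]; simp,
    setIntegral_eq_of_tsupport η.tsupport_subset fun x hx => by
      rw [image_eq_zero_of_notMem_tsupport hx]; simp]
  have hVi : IntegrableOn V K := hVK.integrable (by norm_num)
  have hA : Tendsto (fun k => ∫ x in K, ψ (U k x) * inner ℝ (gradient η x) (V x)) atTop
      (𝓝 (∫ x in K, ψ (v x) * inner ℝ (gradient η x) (V x))) := by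
    refine tendsto_integral_of_dominated_convergence (fun x => C * (D' * ‖V x‖))
      (fun k => ((hψ.continuous.comp (hUs k).continuous).aestronglyMeasurable).mul
        (hηg.aestronglyMeasurable.inner hVK.1)) ((hVi.norm.const_mul D').const_mul C)
      (fun k => ae_of_all _ fun x => ?_) ?_
    · rw [norm_mul]
      refine mul_le_mul (hψC _) ((norm_inner_le_norm _ _).trans ?_) (norm_nonneg _) hC0
      gcongr
      rw [norm_gradient]; exact hD' x
    · filter_upwards [hUae] with x hx using ((hψ.continuous.tendsto _).comp hx).mul_const _
  have hB : Tendsto (fun k => ∫ x in K, (η x * deriv ψ (U k x)) * inner ℝ (gradient (U k) x) (V x))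
      atTop (𝓝 (∫ x in K, (η x * deriv ψ (v x)) * inner ℝ (V x) (V x))) := by
    refine tendsto_integral_mul_inner (C := D * C) (fun k => ?_) (fun k => ae_of_all _ fun x => ?_)
      ?_ (fun k => (continuous_gradient (hUs k)).aestronglyMeasurable) hVK hU1 hVK
    · exact (η.continuous.mul (hdψ.comp (hUs k).continuous)).aestronglyMeasurable
    · rw [norm_mul]
      exact mul_le_mul (hD x) (hψC' _) (norm_nonneg _) ((norm_nonneg _).trans (hD 0))
    · filter_upwards [hUae] with x hx using ((hdψ.tendsto _).comp hx).const_mul _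
  have hR : Tendsto (fun k => ∫ x in K, η x * ψ (U k x) * L x) atTop
      (𝓝 (∫ x in K, η x * ψ (v x) * L x)) := by
    refine tendsto_integral_of_dominated_convergence (fun x => D * C * ‖L x‖)
      (fun k => ((η.continuous.mul (hψ.continuous.comp
        (hUs k).continuous)).aestronglyMeasurable).mul hLK.1) (hLK.norm.const_mul _)
      (fun k => ae_of_all _ fun x => ?_) ?_
    · rw [norm_mul, norm_mul]
      gcongr
      exacts [(norm_nonneg _).trans (hD 0), hD x, hψC _]
    · filter_upwards [hUae] with x hx using
        (((hψ.continuous.tendsto _).comp hx).const_mul _).mul_const _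
  have heq : ∀ k, (∫ x in K, ψ (U k x) * inner ℝ (gradient η x) (V x))
      + ∫ x in K, (η x * deriv ψ (U k x)) * inner ℝ (gradient (U k) x) (V x)
      = -∫ x in K, η x * ψ (U k x) * L x := by
    intro k
    have hψU : ContDiff ℝ ∞ fun x => ψ (U k x) := hψ.comp (hUs k)
    let ζ : TestFunction Ω ℝ ⊤ :=
      { toFun := fun x => η x * ψ (U k x)
        contDiff' := η.contDiff.mul hψU
        hasCompactSupport' := η.hasCompactSupport.mul_right
        tsupport_subset' := (tsupport_mul_subset_left).trans η.tsupport_subset }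
    have hζ : ∀ x, ζ x = η x * ψ (U k x) := fun x => rfl
    have hd : ∀ x e, fderiv ℝ ζ x e = ψ (U k x) * inner ℝ (gradient η x) e
        + (η x * deriv ψ (U k x)) * inner ℝ (gradient (U k) x) e := by
      intro x e
      have h1 : HasFDerivAt (fun x => ψ (U k x)) _ x :=
        ((hψ.differentiable (by simp)) (U k x)).hasDerivAt.comp_hasFDerivAt x
        (((hUs k).differentiable (by simp)) x).hasFDerivAt
      have h2 := ((η.contDiff.differentiable (by simp) x).hasFDerivAt).mul h1
      have h3 : fderiv ℝ ζ x = _ := h2.fderiv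
      rw [h3, inner_gradient, inner_gradient]
      simp; ring
    have hw := hL.2.2 ζ
    simp only [hd, hζ] at hw
    rw [setIntegral_eq_of_tsupport η.tsupport_subset fun x hx => by
        rw [hgrad0 x hx, image_eq_zero_of_notMem_tsupport hx]; simp,
      setIntegral_eq_of_tsupport η.tsupport_subset fun x hx => by
        rw [image_eq_zero_of_notMem_tsupport hx]; simp] at hw
    rw [← integral_add, hw]
    · congr 2; ext x; ring
    · refine ((hVi.norm.const_mul D').const_mul C).mono'
        (((hψ.continuous.comp (hUs k).continuous).aestronglyMeasurable).mul
        (hηg.aestronglyMeasurable.inner hVK.1)) (ae_of_all _ fun x => ?_)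
      rw [norm_mul]
      refine mul_le_mul (hψC _) ((norm_inner_le_norm _ _).trans ?_) (norm_nonneg _) hC0
      gcongr
      rw [norm_gradient]; exact hD' x
    · have hcont : Continuous fun x => η x • (deriv ψ (U k x) • gradient (U k) x) :=
        η.continuous.smul ((hdψ.comp (hUs k).continuous).smul (continuous_gradient (hUs k)))
      obtain ⟨M, hM⟩ := (η.hasCompactSupport.smul_right (f' := fun x =>
        deriv ψ (U k x) • gradient (U k) x)).exists_bound_of_continuous hcont
      refine (hVi.norm.const_mul M).mono'
        ((η.continuous.mul (hdψ.comp (hUs k).continuous)).aestronglyMeasurable.mul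
          ((continuous_gradient (hUs k)).aestronglyMeasurable.inner hVK.1))
        (ae_of_all _ fun x => ?_)
      rw [← real_inner_smul_left, ← smul_smul]
      refine (norm_inner_le_norm _ _).trans ?_
      gcongr
      exact hM x
  have := tendsto_nhds_unique (hA.add hB) ((hR.neg).congr fun k => (heq k).symm)
  simpa only [real_inner_self_eq_norm_sq] using this

end WeakCalculus

/-! ### The weak gradient of `(v - ε)⁺`. -/

section PositivePart

theorem hasDerivAt_primitive {g : ℝ → ℝ} (hg : Continuous g) (a s : ℝ) :
    HasDerivAt (fun s => ∫ r in a..s, g r) (g s) s :=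
  intervalIntegral.integral_hasDerivAt_right (hg.intervalIntegrable _ _)
    (hg.stronglyMeasurableAtFilter _ _) hg.continuousAt

theorem deriv_primitive {g : ℝ → ℝ} (hg : Continuous g) (a : ℝ) :
    deriv (fun s => ∫ r in a..s, g r) = g :=
  funext fun s => (hasDerivAt_primitive hg a s).deriv

theorem contDiff_primitive {g : ℝ → ℝ} (hg : ContDiff ℝ ∞ g) (a : ℝ) :
    ContDiff ℝ ∞ fun s => ∫ r in a..s, g r := by
  rw [contDiff_infty_iff_deriv, deriv_primitive hg.continuous]
  exact ⟨fun s => (hasDerivAt_primitive hg.continuous a s).differentiableAt, hg⟩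

theorem tendsto_smoothTransition_mul {r : ℝ} :
    Tendsto (fun j : ℕ => Real.smoothTransition (j * r)) atTop (𝓝 (if 0 < r then 1 else 0)) := by
  split_ifs with hr
  · refine tendsto_const_nhds.congr' ?_
    filter_upwards [(tendsto_natCast_atTop_atTop (R := ℝ)).eventually_ge_atTop (1 / r)] with j hj
    rw [Real.smoothTransition.one_of_one_le]
    rwa [div_le_iff₀ hr] at hj
  · refine tendsto_const_nhds.congr fun j => ?_
    rw [Real.smoothTransition.zero_of_nonpos]
    exact mul_nonpos_of_nonneg_of_nonpos (Nat.cast_nonneg j) (not_lt.1 hr)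

theorem norm_smoothTransition_le (r : ℝ) : ‖Real.smoothTransition r‖ ≤ 1 := by
  rw [Real.norm_of_nonneg (Real.smoothTransition.nonneg r)]
  exact Real.smoothTransition.le_one r

variable {N : ℕ} {Ω : Opens (Eucl N)}

/-- The boundary condition provides some weak gradient `W` of `(v - ε)⁺`; this ties it to `V`. The
chain rule is applied to primitives of smoothed Heaviside functions, and uniqueness of weak
gradients concludes. -/
theorem HasWeakGradient.ae_eq_of_posPart {v : Eucl N → ℝ} {V W : Eucl N → Eucl N} {ε : ℝ}
    (hv : IsW12Loc Ω v V) (hW : HasWeakGradient Ω (fun x => max (v x - ε) 0) W) :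
    ∀ᵐ x ∂(volume.restrict (Ω : Set (Eucl N))), W x = if ε < v x then V x else 0 := by
  -- The limit of `σ j` vanishes at `ε` itself, in agreement with the strict inequality `ε < v x`.
  set σ : ℕ → ℝ → ℝ := fun j r => Real.smoothTransition (j * (r - ε)) with hσ
  have hσs : ∀ j, ContDiff ℝ ∞ (σ j) := fun j =>
    Real.smoothTransition.contDiff.comp (contDiff_const.mul (contDiff_id.sub contDiff_const))
  have hσ1 : ∀ j r, ‖σ j r‖ ≤ 1 := fun j r => norm_smoothTransition_le _
  have hσl : ∀ r, Tendsto (fun j => σ j r) atTop (𝓝 (if ε < r then 1 else 0)) := fun r => by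
    simpa using tendsto_smoothTransition_mul (r := r - ε)
  set g : ℕ → ℝ → ℝ := fun j s => ∫ r in ε..s, σ j r with hg
  have hg1 : ∀ j s, ‖g j s‖ ≤ ‖s - ε‖ := fun j s => by
    simpa using intervalIntegral.norm_integral_le_of_norm_le_const (C := 1)
      (f := σ j) (a := ε) (b := s) fun r _ => hσ1 j r
  have hgl : ∀ s, Tendsto (fun j => g j s) atTop (𝓝 (max (s - ε) 0)) := by
    intro s
    have hlim : ∫ r in ε..s, (if ε < r then (1 : ℝ) else 0) = max (s - ε) 0 := by
      rcases le_total s ε with h | h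
      · rw [max_eq_right (by linarith), intervalIntegral.integral_symm,
          intervalIntegral.integral_congr_ae (g := fun _ => (0 : ℝ))]
        · simp
        · refine ae_of_all _ fun r hr => ?_
          rw [uIoc_of_le h] at hr
          simp [hr.2]
      · rw [max_eq_left (by linarith), intervalIntegral.integral_congr_ae (g := fun _ => (1 : ℝ))]
        · simp
        · refine ae_of_all _ fun r hr => ?_
          rw [uIoc_of_le h] at hr
          simp [hr.1]
    rw [← hlim]
    exact intervalIntegral.tendsto_integral_filter_of_dominated_convergence (fun _ => 1)
      (Eventually.of_forall fun j => (hσs j).continuous.aestronglyMeasurable)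
      (Eventually.of_forall fun j => ae_of_all _ fun r _ => hσ1 j r)
      intervalIntegrable_const (ae_of_all _ fun r _ => hσl r)
  have hvm : AEStronglyMeasurable v (volume.restrict (Ω : Set (Eucl N))) :=
    hv.1.1.aestronglyMeasurable
  set V' : Eucl N → Eucl N := fun x => if ε < v x then V x else 0 with hV'
  have hV'm : AEStronglyMeasurable V' (volume.restrict (Ω : Set (Eucl N))) := by
    have hlt : NullMeasurableSet {x | ε < v x} (volume.restrict (Ω : Set (Eucl N))) :=
      nullMeasurableSet_lt aemeasurable_const hvm.aemeasurable
    exact (hv.1.2.1.aestronglyMeasurable).indicator₀ hlt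
  have hV'loc : LocallyIntegrableOn V' (Ω : Set (Eucl N)) := by
    rw [locallyIntegrableOn_iff Ω.isOpen.isLocallyClosed]
    intro K hKΩ hK
    refine Integrable.mono (hv.1.2.1.integrableOn_compact_subset hKΩ hK)
      (hV'm.mono_measure (Measure.restrict_mono hKΩ le_rfl)) (ae_of_all _ fun x => ?_)
    simp only [hV']; split_ifs <;> simp
  have key : ∀ (φ : TestFunction Ω ℝ ⊤) (e : Eucl N),
      ∫ x in (Ω : Set (Eucl N)), inner ℝ (W x) e * φ x
        = ∫ x in (Ω : Set (Eucl N)), inner ℝ (V' x) e * φ x := by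
    intro φ e
    set K := tsupport φ with hKdef
    have hK : IsCompact K := φ.hasCompactSupport
    have hKΩ : K ⊆ Ω := φ.tsupport_subset
    have : IsFiniteMeasure (volume.restrict K : Measure (Eucl N)) :=
      isFiniteMeasure_restrict.2 hK.measure_lt_top.ne
    obtain ⟨D, hD⟩ := φ.hasCompactSupport.exists_bound_of_continuous φ.continuous
    obtain ⟨D', hD'⟩ := (φ.hasCompactSupport.fderiv (𝕜 := ℝ)).exists_bound_of_continuous
      (φ.contDiff.continuous_fderiv (by simp))
    have hvK : IntegrableOn v K := hv.1.1.integrableOn_compact_subset hKΩ hK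
    have hVK : IntegrableOn V K := hv.1.2.1.integrableOn_compact_subset hKΩ hK
    have hVKi : Integrable (fun x => ‖V x‖ * ‖e‖ * D) (volume.restrict K) :=
      (hVK.norm.mul_const ‖e‖).mul_const D
    have h1 : Tendsto (fun j => ∫ x in K, g j (v x) * fderiv ℝ φ x e) atTop
        (𝓝 (∫ x in K, max (v x - ε) 0 * fderiv ℝ φ x e)) := by
      refine tendsto_integral_of_dominated_convergence (fun x => ‖v x - ε‖ * (D' * ‖e‖))
        (fun j => ?_) ((hvK.sub (integrable_const ε)).norm.mul_const _)
        (fun j => ae_of_all _ fun x => ?_) (ae_of_all _ fun x => (hgl (v x)).mul_const _)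
      · exact ((contDiff_primitive (hσs j) ε).continuous.comp_aestronglyMeasurable hvK.1).mul
          ((φ.contDiff.continuous_fderiv (by simp)).clm_apply
            continuous_const).aestronglyMeasurable
      · rw [norm_mul]
        exact mul_le_mul (hg1 j _) (((fderiv ℝ φ x).le_opNorm e).trans (by gcongr; exact hD' x))
          (norm_nonneg _) (norm_nonneg _)
    have h2 : Tendsto (fun j => ∫ x in K, σ j (v x) * inner ℝ (V x) e * φ x) atTop
        (𝓝 (∫ x in K, (if ε < v x then 1 else 0) * inner ℝ (V x) e * φ x)) := by
      refine tendsto_integral_of_dominated_convergence (fun x => ‖V x‖ * ‖e‖ * D)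
        (fun j => ?_) hVKi
        (fun j => ae_of_all _ fun x => ?_)
        (ae_of_all _ fun x => ((hσl (v x)).mul_const _).mul_const _)
      · exact (((hσs j).continuous.comp_aestronglyMeasurable hvK.1).mul
          (hVK.1.inner aestronglyMeasurable_const)).mul φ.continuous.aestronglyMeasurable
      · rw [norm_mul, norm_mul]
        have h3 : ‖σ j (v x)‖ * ‖(inner ℝ (V x) e : ℝ)‖ ≤ ‖V x‖ * ‖e‖ := by
          calc _ ≤ 1 * (‖V x‖ * ‖e‖) := mul_le_mul (hσ1 j _) (norm_inner_le_norm _ _)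
                (norm_nonneg _) zero_le_one
            _ = _ := one_mul _
        exact mul_le_mul h3 (hD x) (norm_nonneg _) (by positivity)
    have heq : ∀ j, ∫ x in K, g j (v x) * fderiv ℝ φ x e
        = -∫ x in K, σ j (v x) * inner ℝ (V x) e * φ x := by
      intro j
      have := hv.integral_comp_mul_fderiv (contDiff_primitive (hσs j) ε) (C := 1)
        (fun s => by rw [deriv_primitive (hσs j).continuous]; exact hσ1 j s) φ e
      rw [deriv_primitive (hσs j).continuous] at this
      rwa [setIntegral_eq_of_tsupport φ.tsupport_subset fun x hx => by
          rw [fderiv_eq_zero_of_notMem_tsupport hx]; simp,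
        setIntegral_eq_of_tsupport φ.tsupport_subset fun x hx => by
          rw [image_eq_zero_of_notMem_tsupport hx]; simp] at this
    have h3 := tendsto_nhds_unique h1 ((h2.neg).congr fun j => (heq j).symm)
    have h4 := hW.2.2 φ e
    rw [setIntegral_eq_of_tsupport φ.tsupport_subset fun x hx => by
        rw [fderiv_eq_zero_of_notMem_tsupport hx]; simp, h3, neg_inj] at h4
    rw [← h4, setIntegral_eq_of_tsupport φ.tsupport_subset fun x hx => by
        rw [image_eq_zero_of_notMem_tsupport hx]; simp]
    congr 1; ext x
    simp only [hV']
    split_ifs <;> simp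
  -- The fundamental lemma of the calculus of variations, applied to the difference of the two
  -- gradients.
  have hz := Ω.isOpen.ae_eq_zero_of_integral_contDiff_smul_eq_zero (μ := volume)
    (f := fun x => W x - V' x) (hW.2.1.sub hV'loc) ?_
  · rw [ae_restrict_iff' Ω.isOpen.measurableSet]
    filter_upwards [hz] with x hx hxΩ using sub_eq_zero.1 (hx hxΩ)
  · intro φ hφ hφc hφΩ
    let η : TestFunction Ω ℝ ⊤ := ⟨φ, hφ, hφc, hφΩ⟩
    have hsupp : ∀ f : Eucl N → Eucl N, ∫ x, φ x • f x
        = ∫ x in (Ω : Set (Eucl N)), φ x • f x := fun f =>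
      (setIntegral_eq_integral_of_forall_compl_eq_zero fun x hx => by
        rw [image_eq_zero_of_notMem_tsupport fun h => hx (hφΩ h), zero_smul]).symm
    have hint : ∀ f : Eucl N → Eucl N, LocallyIntegrableOn f (Ω : Set (Eucl N)) →
        IntegrableOn (fun x => φ x • f x) (Ω : Set (Eucl N)) := fun f hf => by
      have hi : IntegrableOn (fun x => φ x • f x) (tsupport φ) :=
        (hf.integrableOn_compact_subset hφΩ hφc).continuousOn_smul hφ.continuous.continuousOn hφc
      refine ((integrableOn_iff_integrable_of_support_subset fun x hx => ?_).1 hi).integrableOn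
      by_contra h
      exact hx (by simp [image_eq_zero_of_notMem_tsupport h])
    refine ext_inner_right ℝ fun e => ?_
    rw [hsupp, inner_zero_left, real_inner_comm]
    erw [← integral_inner (hint _ (hW.2.1.sub hV'loc))]
    have hW' := (hint W hW.2.1).inner_const (𝕜 := ℝ) e
    have hV'' := (hint V' hV'loc).inner_const (𝕜 := ℝ) e
    have hk := key η e
    have : ∀ x, inner ℝ e (φ x • (W x - V' x))
        = inner ℝ (φ x • W x) e - inner ℝ (φ x • V' x) e := fun x => by
      rw [real_inner_comm, smul_sub, inner_sub_left]
    simp only [Pi.sub_apply, this]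
    rw [integral_sub hW' hV'', sub_eq_zero]
    have hη : ∀ x, η x = φ x := fun x => rfl
    simp only [hη] at hk
    simpa only [real_inner_smul_left, mul_comm] using hk

end PositivePart

/-! ### The energy inequality for smooth nonlinearities vanishing near zero. -/

section Energy

theorem exists_norm_deriv_le {g : ℝ → ℝ} (hg : Continuous (deriv g)) {a b : ℝ}
    (h : ∀ s ∉ Icc a b, deriv g s = 0) : ∃ C, 0 ≤ C ∧ ∀ s, ‖deriv g s‖ ≤ C := by
  obtain ⟨C, hC⟩ := (isCompact_Icc (a := a) (b := b)).exists_bound_of_continuousOn hg.continuousOn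
  refine ⟨max C 0, le_max_right _ _, fun s => ?_⟩
  by_cases hs : s ∈ Icc a b
  · exact (hC s hs).trans (le_max_left _ _)
  · simp [h s hs]

theorem exists_smooth_cutoff {ε : ℝ} (hε : 0 < ε) :
    ∃ (ξ : ℝ → ℝ) (D : ℝ), ContDiff ℝ ∞ ξ ∧ ξ 0 = 0 ∧ (∀ s, ε ≤ s → ξ s = 1) ∧
      (∀ s, 0 ≤ ξ s) ∧ (∀ s, ξ s ≤ 1) ∧ (∀ s, 0 ≤ deriv ξ s) ∧ ∀ s, ‖deriv ξ s‖ ≤ D := by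
  set ξ : ℝ → ℝ := fun s => Real.smoothTransition (s / ε) with hξ
  have hs : ContDiff ℝ ∞ ξ := Real.smoothTransition.contDiff.comp (contDiff_id.div_const ε)
  have hd0 : ∀ s ∉ Icc (0 : ℝ) ε, deriv ξ s = 0 := by
    intro s hs
    by_cases h : s < 0
    · have : ξ =ᶠ[𝓝 s] fun _ => 0 := by
        filter_upwards [gt_mem_nhds h] with r hr
        exact Real.smoothTransition.zero_of_nonpos (div_nonpos_of_nonpos_of_nonneg (le_of_lt hr) hε.le)
      rw [this.deriv_eq]; simp
    · have h' : ε < s := by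
        by_contra hc
        exact hs ⟨not_lt.1 h, not_lt.1 hc⟩
      have : ξ =ᶠ[𝓝 s] fun _ => 1 := by
        filter_upwards [lt_mem_nhds h'] with r hr
        exact Real.smoothTransition.one_of_one_le ((one_le_div hε).2 (le_of_lt hr))
      rw [this.deriv_eq]; simp
  obtain ⟨D, -, hD⟩ := exists_norm_deriv_le (hs.continuous_deriv (by simp)) hd0
  refine ⟨ξ, D, hs, by simp [hξ], fun s h => Real.smoothTransition.one_of_one_le
    ((one_le_div hε).2 h), fun s => Real.smoothTransition.nonneg _,
    fun s => Real.smoothTransition.le_one _, fun s => ?_, hD⟩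
  exact Monotone.deriv_nonneg fun a b hab => Real.smoothTransition.monotone (by gcongr)

variable {N : ℕ} {Ω : Opens (Eucl N)}

/-- Formally this is integration by parts of `ψ(v) Δv`. Cutoffs must be compactly supported in `Ω`,
and they are built from the boundary condition: `η m = ξ(φ m)` with test functions `φ m` tending to
`(v - ε)⁺`. They tend to `1` on `{v ≥ 2ε}`, where `ψ(v)` lives. The term containing `∇η m` is
nonnegative up to a vanishing error, so it can be dropped, and Fatou's lemma gives the bound. -/
theorem energy_le_of_contDiff {v : Eucl N → ℝ} {V : Eucl N → Eucl N} {L : Eucl N → ℝ}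
    (hv : IsW12Loc Ω v V) (hL : HasWeakDivergence Ω V L) {ε : ℝ} (hε : 0 < ε)
    (h0 : MemW12Zero Ω (fun x => max (v x - ε) 0)) {ψ : ℝ → ℝ} (hψ : ContDiff ℝ ∞ ψ)
    (hψ0 : ∀ s ≤ 2 * ε, ψ s = 0) (hψnn : ∀ s, 0 ≤ ψ s) (hψ' : ∀ s, 0 ≤ deriv ψ s) {C : ℝ}
    (hψC : ∀ s, ‖ψ s‖ ≤ C) (hψC' : ∀ s, ‖deriv ψ s‖ ≤ C)
    (hint : IntegrableOn (fun x => ψ (v x) * L x) (Ω : Set (Eucl N))) :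
    ∫ x in (Ω : Set (Eucl N)), ψ (v x) * L x ≤ 0 ∧
    ∫⁻ x in (Ω : Set (Eucl N)), ENNReal.ofReal (deriv ψ (v x) * ‖V x‖ ^ 2)
      ≤ ENNReal.ofReal (-∫ x in (Ω : Set (Eucl N)), ψ (v x) * L x) := by
  obtain ⟨W, hW, hSm, hWm, φ, hφ0, hφ1⟩ := h0
  set S : Eucl N → ℝ := fun x => max (v x - ε) 0 with hS
  set μ := (volume.restrict (Ω : Set (Eucl N)) : Measure (Eucl N)) with hμ
  obtain ⟨ns, hns, hae⟩ := (tendstoInMeasure_of_tendsto_eLpNorm (p := 2) (by norm_num)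
    (fun n => (φ n).continuous.aestronglyMeasurable) hSm.1 hφ0).exists_seq_tendsto_ae
  have hWV := HasWeakGradient.ae_eq_of_posPart hv hW
  obtain ⟨ξ, D, hξs, hξ0, hξ1, hξnn, hξle, hξ', hξD⟩ := exists_smooth_cutoff hε
  have hC0 : 0 ≤ C := (norm_nonneg _).trans (hψC 0)
  have hD0 : 0 ≤ D := (norm_nonneg _).trans (hξD 0)
  have hdψ : Continuous (deriv ψ) := hψ.continuous_deriv (by simp)
  have hdξ : Continuous (deriv ξ) := hξs.continuous_deriv (by simp)
  have hvm : AEStronglyMeasurable v μ := hv.1.1.aestronglyMeasurable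
  have hVm : AEStronglyMeasurable V μ := hv.1.2.1.aestronglyMeasurable
  have hdψ0 : ∀ s < 2 * ε, deriv ψ s = 0 := by
    intro s hs
    have : ψ =ᶠ[𝓝 s] fun _ => 0 := by
      filter_upwards [gt_mem_nhds hs] with r hr using hψ0 r (le_of_lt hr)
    rw [this.deriv_eq]; simp
  let η : ℕ → TestFunction Ω ℝ ⊤ := fun m =>
    { toFun := fun x => ξ (φ (ns m) x)
      contDiff' := hξs.comp (φ (ns m)).contDiff
      hasCompactSupport' := (φ (ns m)).hasCompactSupport.comp_left hξ0
      tsupport_subset' := (closure_mono (Function.support_comp_subset hξ0 _)).trans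
        (φ (ns m)).tsupport_subset }
  have hη : ∀ m x, η m x = ξ (φ (ns m) x) := fun m x => rfl
  have hηg : ∀ m x, gradient (η m) x = deriv ξ (φ (ns m) x) • gradient (φ (ns m)) x := by
    intro m x
    have h1 : fderiv ℝ (η m) x = _ :=
      (((hξs.differentiable (by simp)) (φ (ns m) x)).hasDerivAt.comp_hasFDerivAt x
      (((φ (ns m)).contDiff.differentiable (by simp)) x).hasFDerivAt).fderiv
    rw [gradient, h1, map_smul]; rfl
  have hηl : ∀ᵐ x ∂μ, Tendsto (fun m => η m x) atTop (𝓝 (ξ (S x))) := by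
    filter_upwards [hae] with x hx using (hξs.continuous.tendsto _).comp hx
  have hξS : ∀ x, 2 * ε ≤ v x → ξ (S x) = 1 := fun x hx =>
    hξ1 _ (le_max_of_le_left (by linarith))
  -- the error term
  set r : ℕ → ℝ := fun m => ∫ x, ψ (v x) * deriv ξ (φ (ns m) x) *
    inner ℝ (gradient (φ (ns m)) x - W x) (W x) ∂μ with hr
  have hgm : ∀ m, AEStronglyMeasurable (fun x => gradient (φ (ns m)) x - W x) μ := fun m =>
    (continuous_gradient (φ (ns m)).contDiff).aestronglyMeasurable.sub hWm.1
  have hrbd : ∀ m x, ‖ψ (v x) * deriv ξ (φ (ns m) x) *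
      inner ℝ (gradient (φ (ns m)) x - W x) (W x)‖
      ≤ C * D * (‖gradient (φ (ns m)) x - W x‖ * ‖W x‖) := by
    intro m x
    rw [norm_mul, norm_mul]
    exact mul_le_mul (mul_le_mul (hψC _) (hξD _) (norm_nonneg _) hC0) (norm_inner_le_norm _ _)
      (norm_nonneg _) (by positivity)
  have hr0 : Tendsto r atTop (𝓝 0) :=
    tendsto_integral_of_norm_le_mul (C := C * D) (fun m => ae_of_all _ (hrbd m)) hgm
      (hφ1.comp hns.tendsto_atTop) hWm
  have hgradφ : ∀ m, MemLp (gradient (φ (ns m))) 2 μ := by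
    intro m
    have hc := continuous_gradient (φ (ns m)).contDiff
    refine (hc.memLp_of_hasCompactSupport (μ := volume) ?_).mono_measure Measure.restrict_le_self
    exact ((φ (ns m)).hasCompactSupport.fderiv (𝕜 := ℝ)).comp_left (map_zero _)
  have hri : ∀ m, Integrable (fun x => ψ (v x) * deriv ξ (φ (ns m) x) *
      inner ℝ (gradient (φ (ns m)) x - W x) (W x)) μ := by
    intro m
    refine ((((hgradφ m).sub hWm).norm.integrable_mul hWm.norm).const_mul (C * D)).mono'
      (((hψ.continuous.comp_aestronglyMeasurable hvm).mul
        (hdξ.comp (φ (ns m)).continuous).aestronglyMeasurable).mul ((hgm m).inner hWm.1))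
      (ae_of_all _ (hrbd m))
  -- Where `ψ(v) ≠ 0` one has `v > 2ε > ε`, so there the local gradient `V` equals `W`, which is
  -- square integrable over all of `Ω`.
  have hψVW : ∀ᵐ x ∂μ, ψ (v x) • V x = ψ (v x) • W x := by
    filter_upwards [hWV] with x hx
    rw [hx]
    split_ifs with h
    · rfl
    · rw [hψ0 _ (by linarith), zero_smul, zero_smul]
  -- With `∇φ m = (∇φ m - W) + W`, the cross term is `r m` plus `∫ ψ(v) ξ'(φ m) |W|²`, and the
  -- latter is nonnegative as `ψ` and `ξ'` are.
  have hcross : ∀ m, r m ≤ ∫ x, ψ (v x) * inner ℝ (gradient (η m) x) (V x) ∂μ := by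
    intro m
    have hfull : ∀ᵐ x ∂μ, ψ (v x) * inner ℝ (gradient (η m) x) (V x)
        = ψ (v x) * deriv ξ (φ (ns m) x) * inner ℝ (gradient (φ (ns m)) x) (W x) := by
      filter_upwards [hψVW] with x hx
      rw [← real_inner_smul_right, hx, hηg, real_inner_smul_left, real_inner_smul_right]
      ring
    rw [integral_congr_ae hfull]
    refine integral_mono (hri m) ?_ fun x => ?_
    · refine (((hgradφ m).norm.integrable_mul hWm.norm).const_mul (C * D)).mono'
        (((hψ.continuous.comp_aestronglyMeasurable hvm).mul
          (hdξ.comp (φ (ns m)).continuous).aestronglyMeasurable).mul ((hgradφ m).1.inner hWm.1))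
        (ae_of_all _ fun x => ?_)
      rw [norm_mul, norm_mul]
      exact mul_le_mul (mul_le_mul (hψC _) (hξD _) (norm_nonneg _) hC0) (norm_inner_le_norm _ _)
        (norm_nonneg _) (by positivity)
    · have hnn : 0 ≤ ψ (v x) * deriv ξ (φ (ns m) x) := mul_nonneg (hψnn _) (hξ' _)
      refine mul_le_mul_of_nonneg_left ?_ hnn
      rw [inner_sub_left]
      have := real_inner_self_nonneg (x := W x)
      linarith
  have hmain : ∀ m, ∫ x, η m x * deriv ψ (v x) * ‖V x‖ ^ 2 ∂μ
      ≤ -(∫ x, η m x * ψ (v x) * L x ∂μ) - r m := by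
    intro m
    have := hL.integral_comp_mul hv hψ hψC hψC' (η m)
    have h2 := hcross m
    linarith
  have hlim : Tendsto (fun m => -(∫ x, η m x * ψ (v x) * L x ∂μ) - r m) atTop
      (𝓝 (-∫ x, ψ (v x) * L x ∂μ)) := by
    have h1 : Tendsto (fun m => ∫ x, η m x * ψ (v x) * L x ∂μ) atTop
        (𝓝 (∫ x, ψ (v x) * L x ∂μ)) := by
      refine tendsto_integral_of_dominated_convergence (fun x => ‖ψ (v x) * L x‖) (fun m => ?_)
        hint.norm (fun m => ae_of_all _ fun x => ?_) ?_
      · simp only [mul_assoc]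
        exact (η m).continuous.aestronglyMeasurable.mul hint.1
      · rw [mul_assoc, norm_mul]
        refine mul_le_of_le_one_left (norm_nonneg _) ?_
        rw [hη, Real.norm_of_nonneg (hξnn _)]
        exact hξle _
      · filter_upwards [hηl] with x hx
        rcases le_total (v x) (2 * ε) with h | h
        · simp [hψ0 _ h]
        · have := (hx.mul_const (ψ (v x))).mul_const (L x)
          rwa [hξS x h, one_mul] at this
    simpa using h1.neg.sub hr0
  have hint2 : ∀ m, Integrable (fun x => η m x * deriv ψ (v x) * ‖V x‖ ^ 2) μ := by
    intro m
    have hVK := (hv.2 _ (η m).hasCompactSupport (η m).tsupport_subset).2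
    have hKi : IntegrableOn (fun x => η m x * deriv ψ (v x) * ‖V x‖ ^ 2) (tsupport (η m)) := by
      refine (hVK.norm.integrable_sq.const_mul C).mono'
        (((η m).continuous.aestronglyMeasurable.mul (hdψ.comp_aestronglyMeasurable
          (hvm.mono_measure (Measure.restrict_mono (η m).tsupport_subset le_rfl)))).mul
          (hVK.1.norm.pow 2)) (ae_of_all _ fun x => ?_)
      rw [norm_mul, norm_mul, norm_pow, norm_norm]
      gcongr
      calc _ ≤ 1 * C := by
            gcongr
            · rw [hη, Real.norm_of_nonneg (hξnn _)]; exact hξle _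
            · exact hψC' _
        _ = C := one_mul C
    refine ((integrableOn_iff_integrable_of_support_subset fun x hx => ?_).1 hKi).integrableOn
    by_contra h
    exact hx (by simp [image_eq_zero_of_notMem_tsupport h])
  have hηnn : ∀ m x, 0 ≤ η m x * deriv ψ (v x) * ‖V x‖ ^ 2 := fun m x =>
    mul_nonneg (mul_nonneg (hξnn _) (hψ' _)) (by positivity)
  refine ⟨?_, ?_⟩
  · have := ge_of_tendsto' hlim fun m => (integral_nonneg (hηnn m)).trans (hmain m)
    linarith
  calc ∫⁻ x, ENNReal.ofReal (deriv ψ (v x) * ‖V x‖ ^ 2) ∂μ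
      ≤ ∫⁻ x, liminf (fun m => ENNReal.ofReal (η m x * deriv ψ (v x) * ‖V x‖ ^ 2)) atTop ∂μ := by
        refine lintegral_mono_ae ?_
        filter_upwards [hηl] with x hx
        refine le_of_eq (Tendsto.liminf_eq ?_).symm
        refine (ENNReal.continuous_ofReal.tendsto _).comp ?_
        rcases lt_or_ge (v x) (2 * ε) with h | h
        · simp [hdψ0 _ h]
        · have := (hx.mul_const (deriv ψ (v x))).mul_const (‖V x‖ ^ 2)
          rwa [hξS x h, one_mul] at this
    _ ≤ liminf (fun m => ∫⁻ x, ENNReal.ofReal (η m x * deriv ψ (v x) * ‖V x‖ ^ 2) ∂μ) atTop :=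
        lintegral_liminf_le' fun m => (hint2 m).1.aemeasurable.ennreal_ofReal
    _ ≤ liminf (fun m => ENNReal.ofReal (-(∫ x, η m x * ψ (v x) * L x ∂μ) - r m)) atTop := by
        refine liminf_le_liminf (Eventually.of_forall fun m => ?_)
        rw [← ofReal_integral_eq_lintegral_ofReal (hint2 m)]
        · exact ENNReal.ofReal_le_ofReal (hmain m)
        · exact ae_of_all _ (hηnn m)
    _ = ENNReal.ofReal (-∫ x, ψ (v x) * L x ∂μ) :=
        ((ENNReal.continuous_ofReal.tendsto _).comp hlim).liminf_eq

end Energy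

/-! ### The energy inequality for continuous nondecreasing nonlinearities. -/

section MonotoneEnergy

/-- Near `s`, the difference quotients of `ψ` are at least `c`. -/
def SlopeGE (ψ : ℝ → ℝ) (s c : ℝ) : Prop :=
  ∃ η > 0, ∀ r r', s - η < r → r ≤ r' → r' < s + η → c * (r' - r) ≤ ψ r' - ψ r

/-- Clamp the argument of `ψ` to `[a, M]`, subtract `ψ a`, and mollify with a kernel looking only to
the left. Monotonicity then keeps the result below `ψ`; it vanishes up to `a` and is constant beyond
`M + 2a`, so it is bounded with bounded derivative. Lower bounds on difference quotients survive
averaging. -/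
theorem exists_smooth_minorant {ψ : ℝ → ℝ} (hψm : Monotone ψ) (hψc : Continuous ψ)
    (hψ0 : ∀ s ≤ 0, ψ s = 0) {a M : ℝ} (ha : 0 < a) (haM : a < M) :
    ∃ g : ℝ → ℝ, ContDiff ℝ ∞ g ∧ (∀ s ≤ a, g s = 0) ∧ (∀ s, 0 ≤ g s) ∧ (∀ s, g s ≤ ψ s) ∧
      (∀ s, 0 ≤ deriv g s) ∧ (∃ C, (∀ s, ‖g s‖ ≤ C) ∧ ∀ s, ‖deriv g s‖ ≤ C) ∧
      (∀ s, 3 * a ≤ s → s ≤ M → ψ (s - 2 * a) - ψ a ≤ g s) ∧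
      ∀ s η c, 2 * a < η → a ≤ s - η → s + η ≤ M →
        (∀ r r', s - η < r → r ≤ r' → r' < s + η → c * (r' - r) ≤ ψ r' - ψ r) →
        c ≤ deriv g s := by
  -- Centre and outer radius are both `a`, so the kernel lives on `(0, 2a)`: this is the
  -- one-sidedness.
  let ρ : ContDiffBump a := ⟨a / 2, a, by linarith, by linarith⟩
  set k : ℝ → ℝ := ρ.normed volume with hk
  have hknn : ∀ y, 0 ≤ k y := ρ.nonneg_normed
  have hk1 : ∫ y, k y = 1 := ρ.integral_normed
  have hkc : Continuous k := ρ.continuous_normed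
  have hkcs : HasCompactSupport k := ρ.hasCompactSupport_normed
  have hksupp : ∀ y, k y ≠ 0 → 0 < y ∧ y < 2 * a := by
    intro y hy
    have : y ∈ Metric.ball a a := by
      have := ρ.support_normed_eq (μ := volume)
      rw [← this]; exact hy
    rw [Real.ball_eq_Ioo] at this
    exact ⟨by linarith [this.1], by linarith [this.2]⟩
  set τ : ℝ → ℝ := fun s => ψ (min (max s a) M) - ψ a with hτ
  have hτm : Monotone τ := fun s t hst => by
    simp only [hτ]
    gcongr
    exact hψm (by gcongr)
  have hτc : Continuous τ := by fun_prop
  have hψnn : ∀ s, 0 ≤ ψ s := fun s => by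
    rcases le_total s 0 with h | h
    · rw [hψ0 s h]
    · rw [← hψ0 0 le_rfl]; exact hψm h
  have hτ0 : ∀ s ≤ a, τ s = 0 := fun s hs => by simp [hτ, max_eq_right hs, min_eq_left haM.le]
  have hτnn : ∀ s, 0 ≤ τ s := fun s => by
    rcases le_total s a with h | h
    · rw [hτ0 s h]
    · rw [← hτ0 a le_rfl]; exact hτm h
  have hτle : ∀ s, τ s ≤ ψ s := fun s => by
    rcases le_total s a with h | h
    · rw [hτ0 s h]; exact hψnn s
    · have : ψ (min (max s a) M) ≤ ψ s := hψm (by rw [max_eq_left h]; exact min_le_left _ _)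
      have := hψnn a
      simp only [hτ]; linarith
  have hτmid : ∀ s, a ≤ s → s ≤ M → τ s = ψ s - ψ a := fun s h1 h2 => by
    simp [hτ, max_eq_left h1, min_eq_left h2]
  have hτM : ∀ s, M ≤ s → τ s = ψ M - ψ a := fun s h => by
    simp [hτ, max_eq_left (haM.le.trans h), min_eq_right h]
  set g : ℝ → ℝ := fun s => ∫ y, k y * τ (s - y) with hg
  have hgs : ContDiff ℝ ∞ g :=
    hkcs.contDiff_convolution_left (ContinuousLinearMap.lsmul ℝ ℝ) ρ.contDiff_normed
      (hτc.locallyIntegrable (μ := volume))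
  have hint : ∀ s, Integrable fun y => k y * τ (s - y) := fun s =>
    (hkc.mul (hτc.comp (continuous_const.sub continuous_id))).integrable_of_hasCompactSupport
      hkcs.mul_right
  have hki : Integrable k := ρ.integrable_normed
  have hconst : ∀ A : ℝ, ∫ y, k y * A = A := fun A => by rw [integral_mul_const, hk1, one_mul]
  have hupper : ∀ s A, (∀ y, 0 < y → y < 2 * a → τ (s - y) ≤ A) → g s ≤ A := by
    intro s A h
    rw [← hconst A]
    refine integral_mono (hint s) (hki.mul_const A) fun y => ?_
    by_cases hy : k y = 0
    · simp [hy]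
    · exact mul_le_mul_of_nonneg_left (h y (hksupp y hy).1 (hksupp y hy).2) (hknn y)
  have hlower : ∀ s A, (∀ y, 0 < y → y < 2 * a → A ≤ τ (s - y)) → A ≤ g s := by
    intro s A h
    rw [← hconst A]
    refine integral_mono (hki.mul_const A) (hint s) fun y => ?_
    by_cases hy : k y = 0
    · simp [hy]
    · exact mul_le_mul_of_nonneg_left (h y (hksupp y hy).1 (hksupp y hy).2) (hknn y)
  have hgm : Monotone g := fun s t hst =>
    integral_mono (hint s) (hint t) fun y =>
      mul_le_mul_of_nonneg_left (hτm (by linarith)) (hknn y)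
  have hg_nn : ∀ s, 0 ≤ g s := fun s => hlower s 0 fun y _ _ => hτnn _
  have hg0 : ∀ s ≤ a, g s = 0 := fun s hs =>
    le_antisymm (hupper s 0 fun y hy _ => (hτ0 _ (by linarith)).le) (hg_nn s)
  have hgM : ∀ s, M + 2 * a ≤ s → g s = ψ M - ψ a := fun s hs =>
    le_antisymm (hupper s _ fun y _ hy => (hτM _ (by linarith)).le)
      (hlower s _ fun y _ hy => (hτM _ (by linarith)).ge)
  have hgτ : ∀ s, g s ≤ τ s := fun s => hupper s _ fun y hy _ => hτm (by linarith)
  have hd0 : ∀ s ∉ Icc a (M + 2 * a), deriv g s = 0 := by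
    intro s hs
    by_cases h : s < a
    · have : g =ᶠ[𝓝 s] fun _ => 0 := by
        filter_upwards [gt_mem_nhds h] with r hr using hg0 r (le_of_lt hr)
      rw [this.deriv_eq]; simp
    · have h' : M + 2 * a < s := by
        by_contra hc
        exact hs ⟨not_lt.1 h, not_lt.1 hc⟩
      have : g =ᶠ[𝓝 s] fun _ => ψ M - ψ a := by
        filter_upwards [lt_mem_nhds h'] with r hr using hgM r (le_of_lt hr)
      rw [this.deriv_eq]; simp
  obtain ⟨C, -, hC⟩ := exists_norm_deriv_le (hgs.continuous_deriv (by simp)) hd0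
  refine ⟨g, hgs, hg0, hg_nn, fun s => (hgτ s).trans (hτle s), fun s => hgm.deriv_nonneg,
    ⟨max C (ψ M), fun s => ?_, fun s => (hC s).trans (le_max_left _ _)⟩, ?_, ?_⟩
  · rw [Real.norm_of_nonneg (hg_nn s)]
    refine (hgτ s).trans (le_trans ?_ (le_max_right _ _))
    have h1 : ψ (min (max s a) M) ≤ ψ M := hψm (min_le_right _ _)
    have h2 := hψnn a
    simp only [hτ]; linarith
  · intro s h1 h2
    refine hlower s _ fun y hy hy' => ?_
    rw [← hτmid (s - 2 * a) (by linarith) (by linarith)]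
    exact hτm (by linarith)
  · intro s η c hη hs1 hs2 hsl
    have hd := ((hgs.differentiable (by simp)) s).hasDerivAt.tendsto_slope_zero_right
    refine ge_of_tendsto hd ?_
    have hpos : ∀ᶠ t in 𝓝[>] (0 : ℝ), t < η :=
      nhdsWithin_le_nhds (gt_mem_nhds (by linarith))
    filter_upwards [hpos, self_mem_nhdsWithin] with t ht ht0
    -- The right difference quotient of `g` at `s` is the kernel average of those of `τ` at `s - y`.
    -- The window `η > 2a` keeps all these points where `hsl` applies.
    rw [mem_Ioi] at ht0
    rw [smul_eq_mul, inv_mul_eq_div, le_div_iff₀ ht0]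
    rw [← hconst (c * t), hg]
    simp only
    rw [← integral_sub (hint _) (hint _)]
    refine integral_mono (hki.mul_const _) ((hint _).sub (hint _)) fun y => ?_
    by_cases hy : k y = 0
    · simp [hy]
    · obtain ⟨hy1, hy2⟩ := hksupp y hy
      have h1 := hsl (s - y) (s + t - y) (by linarith) (by linarith) (by linarith)
      have h2 : τ (s + t - y) - τ (s - y) = ψ (s + t - y) - ψ (s - y) := by
        rw [hτmid _ (by linarith) (by linarith), hτmid _ (by linarith) (by linarith)]; ring
      have h3 : c * t ≤ τ (s + t - y) - τ (s - y) := by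
        rw [h2]; refine le_trans (le_of_eq ?_) h1; ring
      calc k y * (c * t) ≤ k y * (τ (s + t - y) - τ (s - y)) :=
            mul_le_mul_of_nonneg_left h3 (hknn y)
        _ = _ := by ring

theorem exists_smooth_minorants {ψ : ℝ → ℝ} (hψm : Monotone ψ) (hψc : Continuous ψ)
    (hψ0 : ∀ s ≤ 0, ψ s = 0) :
    ∃ g : ℕ → ℝ → ℝ, (∀ n, ContDiff ℝ ∞ (g n)) ∧ (∀ n, ∃ ε > 0, ∀ s ≤ 2 * ε, g n s = 0) ∧
      (∀ n s, 0 ≤ g n s) ∧ (∀ n s, g n s ≤ ψ s) ∧ (∀ n s, 0 ≤ deriv (g n) s) ∧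
      (∀ n, ∃ C, (∀ s, ‖g n s‖ ≤ C) ∧ ∀ s, ‖deriv (g n) s‖ ≤ C) ∧
      (∀ s, Tendsto (fun n => g n s) atTop (𝓝 (ψ s))) ∧
      ∀ s c, 0 < s → SlopeGE ψ s c → ∀ᶠ n in atTop, c ≤ deriv (g n) s := by
  set a : ℕ → ℝ := fun n => 1 / ((n : ℝ) + 2) with ha
  have ha0 : ∀ n, 0 < a n := fun n => by positivity
  have haM : ∀ n : ℕ, a n < (n : ℝ) + 2 := fun n => by
    have h1 : (2 : ℝ) ≤ (n : ℝ) + 2 := by linarith [(Nat.cast_nonneg n : (0 : ℝ) ≤ n)]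
    rw [ha]; simp only
    rw [div_lt_iff₀ (by positivity)]; nlinarith
  have hal : Tendsto a atTop (𝓝 0) := by
    have h1 : Tendsto (fun n : ℕ => ((n : ℝ) + 2)) atTop atTop :=
      tendsto_atTop_add_const_right _ _ tendsto_natCast_atTop_atTop
    simpa [ha, Pi.inv_def] using h1.inv_tendsto_atTop
  have hMl : Tendsto (fun n : ℕ => ((n : ℝ) + 2)) atTop atTop :=
    tendsto_atTop_add_const_right _ _ tendsto_natCast_atTop_atTop
  choose g hgs hg0 hgnn hgle hg' hgC hgl hgsl using fun n =>
    exists_smooth_minorant hψm hψc hψ0 (ha0 n) (haM n)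
  refine ⟨g, hgs, fun n => ⟨a n / 2, by have := ha0 n; positivity, fun s hs => hg0 n s (by linarith)⟩,
    hgnn, hgle, hg', hgC, fun s => ?_, fun s c hs hsl => ?_⟩
  · rcases le_or_gt s 0 with hs | hs
    · rw [hψ0 s hs]
      refine tendsto_const_nhds.congr fun n => (hg0 n s (hs.trans (ha0 n).le)).symm
    · have hlow : Tendsto (fun n => ψ (s - 2 * a n) - ψ (a n)) atTop (𝓝 (ψ s)) := by
        have h1 : Tendsto (fun n => s - 2 * a n) atTop (𝓝 s) := by
          simpa using (hal.const_mul 2).const_sub s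
        have := ((hψc.tendsto _).comp h1).sub ((hψc.tendsto _).comp hal)
        simpa [hψ0 0 le_rfl] using this
      refine tendsto_of_tendsto_of_tendsto_of_le_of_le' hlow tendsto_const_nhds ?_
        (Eventually.of_forall fun n => hgle n s)
      filter_upwards [hal.eventually (gt_mem_nhds (show (0 : ℝ) < s / 3 by linarith)),
        hMl.eventually_ge_atTop s] with n h1 h2
      exact hgl n s (by linarith) h2
  · obtain ⟨η, hη, h⟩ := hsl
    -- Capping the window at `s / 2` leaves `s - η' ≥ s / 2`, which exceeds `a n` for large `n`.
    set η' := min η (s / 2) with hη'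
    have hη'0 : 0 < η' := lt_min hη (by linarith)
    have h1 : η' ≤ η := min_le_left _ _
    have h2 : η' ≤ s / 2 := min_le_right _ _
    filter_upwards [hal.eventually (gt_mem_nhds (show (0 : ℝ) < η' / 2 by linarith)),
      hMl.eventually_ge_atTop (s + η')] with n h3 h4
    exact hgsl n s η' c (by linarith) (by linarith) h4 fun r r' hr hrr hr' =>
      h r r' (by linarith) hrr (by linarith)

variable {N : ℕ} {Ω : Opens (Eucl N)}

/-- The smooth minorants satisfy the inequality, and `|ψ(v) L|` dominates their right sides. On the
left, Fatou's lemma needs only a lower bound for the derivatives at every positive value of `v`.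
Pointwise slope bounds therefore replace `ψ'`, which need not exist everywhere. -/
theorem energy_le {v : Eucl N → ℝ} {V : Eucl N → Eucl N} {L : Eucl N → ℝ}
    (hv : IsW12Loc Ω v V) (hL : HasWeakDivergence Ω V L)
    (h0 : ∀ ε > 0, MemW12Zero Ω (fun x => max (v x - ε) 0)) {ψ b : ℝ → ℝ} (hψm : Monotone ψ)
    (hψc : Continuous ψ) (hψ0 : ∀ s ≤ 0, ψ s = 0)
    (hint : IntegrableOn (fun x => ψ (v x) * L x) (Ω : Set (Eucl N)))
    (hb : ∀ s > 0, ∀ c < b s, SlopeGE ψ s c) :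
    ∫ x in (Ω : Set (Eucl N)), ψ (v x) * L x ≤ 0 ∧
    ∫⁻ x in (Ω : Set (Eucl N)), (if 0 < v x then ENNReal.ofReal (b (v x) * ‖V x‖ ^ 2) else 0)
      ≤ ENNReal.ofReal (-∫ x in (Ω : Set (Eucl N)), ψ (v x) * L x) := by
  obtain ⟨g, hgs, hg0, hgnn, hgle, hg', hgC, hgl, hgsl⟩ := exists_smooth_minorants hψm hψc hψ0
  set μ := (volume.restrict (Ω : Set (Eucl N)) : Measure (Eucl N)) with hμ
  have hvm : AEStronglyMeasurable v μ := hv.1.1.aestronglyMeasurable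
  have hVm : AEStronglyMeasurable V μ := hv.1.2.1.aestronglyMeasurable
  have hLm : AEStronglyMeasurable L μ := hL.2.1.aestronglyMeasurable
  have hdom : ∀ n x, ‖g n (v x) * L x‖ ≤ ‖ψ (v x) * L x‖ := fun n x => by
    rw [norm_mul, norm_mul]
    gcongr
    rw [Real.norm_of_nonneg (hgnn _ _), Real.norm_of_nonneg ((hgnn n _).trans (hgle n _))]
    exact hgle _ _
  have hgm : ∀ n, AEStronglyMeasurable (fun x => g n (v x) * L x) μ := fun n =>
    ((hgs n).continuous.comp_aestronglyMeasurable hvm).mul hLm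
  have hgi : ∀ n, Integrable (fun x => g n (v x) * L x) μ := fun n =>
    hint.norm.mono' (hgm n) (ae_of_all _ (hdom n))
  have hlim : Tendsto (fun n => ∫ x, g n (v x) * L x ∂μ) atTop (𝓝 (∫ x, ψ (v x) * L x ∂μ)) :=
    tendsto_integral_of_dominated_convergence _ hgm hint.norm (fun n => ae_of_all _ (hdom n))
      (ae_of_all _ fun x => (hgl _).mul_const _)
  have henergy : ∀ n, ∫ x, g n (v x) * L x ∂μ ≤ 0 ∧
      ∫⁻ x, ENNReal.ofReal (deriv (g n) (v x) * ‖V x‖ ^ 2) ∂μ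
        ≤ ENNReal.ofReal (-∫ x, g n (v x) * L x ∂μ) := by
    intro n
    obtain ⟨ε, hε, hε0⟩ := hg0 n
    obtain ⟨C, hC, hC'⟩ := hgC n
    exact energy_le_of_contDiff hv hL hε (h0 ε hε) (hgs n) hε0 (hgnn n) (hg' n) hC hC' (hgi n)
  refine ⟨le_of_tendsto' hlim fun n => (henergy n).1, ?_⟩
  calc _ ≤ ∫⁻ x, liminf (fun n => ENNReal.ofReal (deriv (g n) (v x) * ‖V x‖ ^ 2)) atTop ∂μ := by
        refine lintegral_mono fun x => ?_
        split_ifs with hx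
        · have hle : ∀ c < b (v x), ENNReal.ofReal (c * ‖V x‖ ^ 2)
              ≤ liminf (fun n => ENNReal.ofReal (deriv (g n) (v x) * ‖V x‖ ^ 2)) atTop := by
            intro c hc
            refine le_liminf_of_le (by isBoundedDefault) ?_
            filter_upwards [hgsl _ c hx (hb _ hx c hc)] with n hn
            exact ENNReal.ofReal_le_ofReal (by gcongr)
          -- Slope bounds are given only for `c < b (v x)`; letting `c` increase to `b (v x)` closes
          -- the gap.
          have ht : Tendsto (fun c => ENNReal.ofReal (c * ‖V x‖ ^ 2)) (𝓝[<] (b (v x)))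
              (𝓝 (ENNReal.ofReal (b (v x) * ‖V x‖ ^ 2))) := by
            refine Tendsto.mono_left ?_ nhdsWithin_le_nhds
            exact (ENNReal.continuous_ofReal.tendsto _).comp
              ((continuous_mul_const _).tendsto _)
          refine le_of_tendsto ht ?_
          filter_upwards [self_mem_nhdsWithin] with c hc using hle c hc
        · exact zero_le
    _ ≤ liminf (fun n => ∫⁻ x, ENNReal.ofReal (deriv (g n) (v x) * ‖V x‖ ^ 2) ∂μ) atTop := by
        refine lintegral_liminf_le' fun n => ?_
        exact ((((hgs n).continuous_deriv (by simp)).comp_aestronglyMeasurable hvm).mul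
          (hVm.norm.pow 2)).aemeasurable.ennreal_ofReal
    _ ≤ liminf (fun n => ENNReal.ofReal (-∫ x, g n (v x) * L x ∂μ)) atTop := by
        exact liminf_le_liminf (Eventually.of_forall fun n => (henergy n).2)
    _ = _ := ((ENNReal.continuous_ofReal.tendsto _).comp hlim.neg).liminf_eq

end MonotoneEnergy

/-! ### Sobolev inequalities, up to functions of `v` with zero boundary values. -/

section SobolevInequality

/-- On the line the fundamental theorem of calculus bounds the supremum of `f` by the `L¹` norm of
its derivative, and on a bounded set the supremum controls every `L^q` norm. The rest is the
identification of `Eucl 1` with `ℝ`. -/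
theorem eLpNorm_le_eLpNorm_fderiv_of_dim_one {s : Set (Eucl 1)} (hs : Bornology.IsBounded s)
    (q : ℝ≥0∞) : ∃ C : ℝ≥0∞, C ≠ ⊤ ∧ ∀ f : Eucl 1 → ℝ, ContDiff ℝ 1 f → HasCompactSupport f →
      Function.support f ⊆ s → eLpNorm f q volume ≤ C * eLpNorm (fderiv ℝ f) 1 volume := by
  refine ⟨volume.restrict s univ ^ q.toReal⁻¹, ?_, fun f hf hfc hfs => ?_⟩
  · refine ENNReal.rpow_ne_top_of_nonneg (by positivity) ?_
    simpa using hs.measure_lt_top.ne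
  let p : Eucl 1 → ℝ := fun x => x 0
  have hp : MeasurePreserving p volume volume :=
    (volume_preserving_funUnique (Fin 1) ℝ).comp
      (EuclideanSpace.volume_preserving_symm_measurableEquiv_toLp (Fin 1))
  let i : ℝ →L[ℝ] Eucl 1 := ContinuousLinearMap.toSpanSingleton ℝ (EuclideanSpace.single 0 1)
  have hi : ∀ t, i t = EuclideanSpace.single 0 t := fun t => by
    ext j; fin_cases j; simp [i]
  have hip : ∀ x, i (p x) = x := fun x => by
    rw [hi]; ext j; fin_cases j; simp [p]
  have hni : ∀ t, ‖i t‖ = ‖t‖ := fun t => by rw [hi]; simp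
  have hiso : Isometry i := AddMonoidHomClass.isometry_of_norm i hni
  have hc1 : ContDiff ℝ 1 (f ∘ i) := hf.comp i.contDiff
  have hcc : HasCompactSupport (f ∘ i) := hfc.comp_isClosedEmbedding hiso.isClosedEmbedding
  have hcont : Continuous (fderiv ℝ f) := hf.continuous_fderiv (by simp)
  have hd : ∀ t, ‖deriv (f ∘ i) t‖ₑ ≤ ‖fderiv ℝ f (i t)‖ₑ := by
    intro t
    have h1 := ((hf.differentiable (by simp)) (i t)).hasFDerivAt.comp_hasDerivAt t i.hasDerivAt
    rw [h1.deriv]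
    refine enorm_le_iff_norm_le.2 (((fderiv ℝ f (i t)).le_opNorm _).trans ?_)
    rw [hni]; simp
  have hint : ∫⁻ t : ℝ, ‖fderiv ℝ f (i t)‖ₑ = eLpNorm (fderiv ℝ f) 1 volume := by
    rw [eLpNorm_one_eq_lintegral_enorm,
      ← hp.lintegral_comp (f := fun t => ‖fderiv ℝ f (i t)‖ₑ) (hcont.comp i.continuous).enorm.measurable]
    simp only [hip]
  have hsup : ∀ x, ‖f x‖ₑ ≤ eLpNorm (fderiv ℝ f) 1 volume := by
    intro x
    have h1 := hcc.enorm_le_lintegral_Ici_deriv hc1 (p x)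
    rw [Function.comp_apply, hip] at h1
    refine h1.trans ((setLIntegral_le_lintegral _ _).trans ?_)
    rw [← hint]
    exact lintegral_mono hd
  have hfin : eLpNorm (fderiv ℝ f) 1 volume ≠ ⊤ :=
    (hcont.memLp_of_hasCompactSupport (hfc.fderiv (𝕜 := ℝ))).eLpNorm_ne_top
  rw [← eLpNorm_restrict_eq_of_support_subset hfs]
  refine (eLpNorm_le_of_ae_bound (C := (eLpNorm (fderiv ℝ f) 1 volume).toReal)
    (ae_of_all _ fun x => ?_)).trans ?_
  · rw [← toReal_enorm]
    exact ENNReal.toReal_mono hfin (hsup x)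
  · rw [ENNReal.ofReal_toReal hfin]

/-- In the second case of `delta2`, `1 ≤ δ₂` amounts to `N ≤ δ₁ (N - 1)`, which follows from the
negated case condition. -/
theorem delta2_mem {N : ℕ} {δ₁ : ℝ} (h1 : 1 ≤ δ₁) (h2 : δ₁ < 2) :
    1 ≤ delta2 N δ₁ ∧ delta2 N δ₁ < 2 := by
  unfold delta2
  split_ifs with h
  · norm_num
  · push Not at h
    have hN : (0 : ℝ) ≤ N := Nat.cast_nonneg N
    have hpos : 0 < (N : ℝ) + δ₁ := by linarith
    rw [le_div_iff₀ hpos, div_lt_iff₀ hpos]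
    constructor <;> nlinarith

theorem exists_sobolev_const {N : ℕ} (hN : 1 ≤ N) {s : Set (Eucl N)}
    (hs : Bornology.IsBounded s) {δ₁ : ℝ} (h1 : 1 ≤ δ₁) (h2 : δ₁ < 2) :
    ∃ C : ℝ≥0∞, C ≠ ⊤ ∧ ∀ f : Eucl N → ℝ, ContDiff ℝ 1 f → HasCompactSupport f →
      Function.support f ⊆ s → eLpNorm f (ENNReal.ofReal δ₁) volume
        ≤ C * eLpNorm (fderiv ℝ f) (ENNReal.ofReal (delta2 N δ₁)) volume := by
  rcases hN.eq_or_lt with rfl | hN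
  · obtain ⟨C, hC, h⟩ := eLpNorm_le_eLpNorm_fderiv_of_dim_one hs (ENNReal.ofReal δ₁)
    refine ⟨C, hC, fun f hf hfc hfs => ?_⟩
    have : delta2 1 δ₁ = 1 := by simp [delta2]
    rw [this, ENNReal.ofReal_one]
    exact h f hf hfc hfs
  · obtain ⟨hd1, hd2⟩ := delta2_mem (N := N) h1 h2
    refine ⟨eLpNormLESNormFDerivOfLeConst ℝ volume s (delta2 N δ₁).toNNReal δ₁.toNNReal,
      ENNReal.coe_ne_top, fun f hf hfc hfs => ?_⟩
    have hN' : (2 : ℝ) ≤ N := by exact_mod_cast hN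
    refine eLpNorm_le_eLpNorm_fderiv_of_le volume hf hfs ?_ ?_ ?_ hs
    · rwa [Real.one_le_toNNReal]
    · rw [finrank_euclideanSpace_fin, ← NNReal.coe_lt_coe, Real.coe_toNNReal _ (by linarith)]
      push_cast
      linarith
    -- The exponent condition `1/δ₂ - 1/N ≤ 1/δ₁`: for `δ₂ = 1` it is the case condition, and
    -- otherwise `δ₂` is chosen to give equality.
    · rw [finrank_euclideanSpace_fin, NNReal.coe_inv, Real.coe_toNNReal _ (by linarith),
        Real.coe_toNNReal _ (by linarith)]
      have hNpos : (0 : ℝ) < N := by linarith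
      have hδpos : 0 < δ₁ := by linarith
      unfold delta2
      split_ifs with h
      · have : 1 - (N : ℝ)⁻¹ = (N - 1) / N := by field_simp
        rw [inv_one, this, div_le_iff₀ hNpos, inv_mul_eq_div, le_div_iff₀ hδpos]
        linarith
      · apply le_of_eq
        field_simp
        ring

variable {N : ℕ} {Ω : Opens (Eucl N)}

/-- The inequality holds for the primitive of `θ` composed with the test functions tending to `S`.
Their gradients `θ(φ) ∇φ` converge to `θ(S) W` in `L^{q₂}`, since `θ` is bounded and `q₂ ≤ 2` on a
set of finite measure; Fatou's lemma treats the left side. -/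
theorem eLpNorm_primitive_comp_le {q₁ q₂ : ℝ≥0∞} (hq₂ : 1 ≤ q₂) (hq₂' : q₂ ≤ 2)
    (hΩ : Bornology.IsBounded (Ω : Set (Eucl N))) {C : ℝ≥0∞} (hC : C ≠ ⊤)
    (hsob : ∀ f : Eucl N → ℝ, ContDiff ℝ 1 f → HasCompactSupport f →
      Function.support f ⊆ Ω → eLpNorm f q₁ volume ≤ C * eLpNorm (fderiv ℝ f) q₂ volume)
    {S : Eucl N → ℝ} {W : Eucl N → Eucl N} {φ : ℕ → TestFunction Ω ℝ ⊤}
    (hS : AEStronglyMeasurable S (volume.restrict (Ω : Set (Eucl N))))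
    (hW : MemLp W 2 (volume.restrict (Ω : Set (Eucl N))))
    (hφ0 : Tendsto (fun n => eLpNorm (fun x => φ n x - S x) 2
        (volume.restrict (Ω : Set (Eucl N)))) atTop (𝓝 0))
    (hφ1 : Tendsto (fun n => eLpNorm (fun x => gradient (φ n) x - W x) 2
        (volume.restrict (Ω : Set (Eucl N)))) atTop (𝓝 0))
    {θ : ℝ → ℝ} (hθ : Continuous θ) {D : ℝ} (hD : ∀ s, ‖θ s‖ ≤ D) :
    eLpNorm (fun x => ∫ r in (0 : ℝ)..S x, θ r) q₁ (volume.restrict (Ω : Set (Eucl N)))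
      ≤ C * eLpNorm (fun x => θ (S x) • W x) q₂ (volume.restrict (Ω : Set (Eucl N))) := by
  set μ := (volume.restrict (Ω : Set (Eucl N)) : Measure (Eucl N)) with hμ
  have : IsFiniteMeasure μ := isFiniteMeasure_restrict.2 hΩ.measure_lt_top.ne
  have hD0 : 0 ≤ D := (norm_nonneg _).trans (hD 0)
  obtain ⟨ns, hns, hae⟩ := (tendstoInMeasure_of_tendsto_eLpNorm (p := 2) (by norm_num)
    (fun n => (φ n).continuous.aestronglyMeasurable) hS hφ0).exists_seq_tendsto_ae
  set Θ : ℝ → ℝ := fun s => ∫ r in (0 : ℝ)..s, θ r with hΘ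
  have hΘd : ∀ s, HasDerivAt Θ (θ s) s := hasDerivAt_primitive hθ 0
  have hΘs : ContDiff ℝ 1 Θ := by
    rw [contDiff_one_iff_deriv, hΘ, deriv_primitive hθ]
    exact ⟨fun s => (hΘd s).differentiableAt, hθ⟩
  have hΘ0 : Θ 0 = 0 := by simp [hΘ]
  have hgc : ∀ m, Continuous (gradient (φ (ns m))) := fun m =>
    continuous_gradient (φ (ns m)).contDiff
  have hcomp : ∀ m, eLpNorm (fun x => Θ (φ (ns m) x)) q₁ μ
      ≤ C * eLpNorm (fun x => θ (φ (ns m) x) • gradient (φ (ns m)) x) q₂ μ := by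
    intro m
    have hcs : HasCompactSupport fun x => Θ (φ (ns m) x) :=
      (φ (ns m)).hasCompactSupport.comp_left hΘ0
    have hsupp : Function.support (fun x => Θ (φ (ns m) x)) ⊆ Ω :=
      (Function.support_comp_subset hΘ0 _).trans
        ((subset_tsupport _).trans (φ (ns m)).tsupport_subset)
    have h1 := hsob (fun x => Θ (φ (ns m) x))
      (hΘs.comp ((φ (ns m)).contDiff.of_le (by simp))) hcs hsupp
    have hds : Function.support (fderiv ℝ fun x => Θ (φ (ns m) x)) ⊆ Ω :=
      (support_fderiv_subset ℝ).trans ((closure_mono (Function.support_comp_subset hΘ0 _)).trans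
        (φ (ns m)).tsupport_subset)
    have h3 : eLpNorm (fderiv ℝ fun x => Θ (φ (ns m) x)) q₂ μ
        = eLpNorm (fderiv ℝ fun x => Θ (φ (ns m) x)) q₂ volume := by
      rw [← eLpNorm_norm, ← eLpNorm_norm (fderiv ℝ fun x => Θ (φ (ns m) x)),
        eLpNorm_restrict_eq_of_support_subset]
      exact fun x hx => hds (norm_ne_zero_iff.1 hx)
    rw [← h3] at h1
    refine (eLpNorm_mono_measure _ Measure.restrict_le_self).trans (h1.trans ?_)
    refine mul_le_mul_right (eLpNorm_mono_ae (ae_of_all _ fun x => ?_)) C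
    have h2 : fderiv ℝ (fun x => Θ (φ (ns m) x)) x = _ :=
      ((hΘd (φ (ns m) x)).comp_hasFDerivAt x
      (((φ (ns m)).contDiff.differentiable (by simp)) x).hasFDerivAt).fderiv
    rw [h2, norm_smul, norm_smul, norm_gradient]
  have herr : Tendsto (fun m => eLpNorm
      (fun x => θ (φ (ns m) x) • (gradient (φ (ns m)) x - W x)) q₂ μ) atTop (𝓝 0) := by
    have hK : ENNReal.ofReal D * μ univ ^ (1 / q₂.toReal - 1 / (2 : ℝ≥0∞).toReal) ≠ ⊤ := by
      refine ENNReal.mul_ne_top ENNReal.ofReal_ne_top (ENNReal.rpow_ne_top_of_nonneg ?_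
        (measure_ne_top _ _))
      rw [sub_nonneg]
      have hq2top : q₂ ≠ ⊤ := ne_top_of_le_ne_top (by norm_num) hq₂'
      refine one_div_le_one_div_of_le ?_ (ENNReal.toReal_mono (by norm_num) hq₂')
      exact ENNReal.toReal_pos (by positivity) hq2top
    have hlim := ENNReal.Tendsto.const_mul (hφ1.comp hns.tendsto_atTop) (Or.inr hK)
    rw [mul_zero] at hlim
    refine tendsto_of_tendsto_of_tendsto_of_le_of_le tendsto_const_nhds hlim
      (fun _ => zero_le) fun m => ?_
    have h1 : eLpNorm (fun x => θ (φ (ns m) x) • (gradient (φ (ns m)) x - W x)) q₂ μ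
        ≤ ENNReal.ofReal D * eLpNorm (fun x => gradient (φ (ns m)) x - W x) q₂ μ := by
      refine eLpNorm_le_mul_eLpNorm_of_ae_le_mul (ae_of_all _ fun x => ?_) q₂
      rw [norm_smul]
      gcongr
      exact hD _
    refine h1.trans ?_
    rw [mul_assoc]
    gcongr
    rw [mul_comm]
    exact eLpNorm_le_eLpNorm_mul_rpow_measure_univ hq₂' ((hgc m).aestronglyMeasurable.sub hW.1)
  have hmainlim : Tendsto (fun m => eLpNorm (fun x => θ (φ (ns m) x) • W x) q₂ μ) atTop
      (𝓝 (eLpNorm (fun x => θ (S x) • W x) q₂ μ)) := by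
    have hq0 : q₂ ≠ 0 := by positivity
    have hqt : q₂ ≠ ⊤ := ne_top_of_le_ne_top (by norm_num) hq₂'
    have hqpos : 0 < q₂.toReal := ENNReal.toReal_pos hq0 hqt
    simp only [eLpNorm_eq_lintegral_rpow_enorm_toReal hq0 hqt]
    refine (ENNReal.continuous_rpow_const.tendsto _).comp ?_
    refine tendsto_lintegral_of_dominated_convergence'
      (fun x => ‖D • W x‖ₑ ^ q₂.toReal) (fun m => ?_) (fun m => ae_of_all _ fun x => ?_) ?_ ?_
    · exact ((hθ.comp (φ (ns m)).continuous).aestronglyMeasurable.smul hW.1).enorm.pow_const _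
    · refine ENNReal.rpow_le_rpow (enorm_le_iff_norm_le.2 ?_) hqpos.le
      rw [norm_smul, norm_smul, Real.norm_of_nonneg hD0]
      gcongr
      exact hD _
    · have hWq : MemLp (fun x => D • W x) q₂ μ := (hW.mono_exponent hq₂').const_smul D
      exact (lintegral_rpow_enorm_lt_top_of_eLpNorm_lt_top hq0 hqt hWq.2).ne
    · filter_upwards [hae] with x hx
      refine (ENNReal.continuous_rpow_const.tendsto _).comp ?_
      exact ((((hθ.tendsto _).comp hx).smul_const (W x))).enorm
  have hsum : Tendsto (fun m => C * (eLpNorm (fun x =>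
      θ (φ (ns m) x) • (gradient (φ (ns m)) x - W x)) q₂ μ
      + eLpNorm (fun x => θ (φ (ns m) x) • W x) q₂ μ)) atTop
      (𝓝 (C * eLpNorm (fun x => θ (S x) • W x) q₂ μ)) := by
    have := ENNReal.Tendsto.const_mul (herr.add hmainlim) (Or.inr hC)
    rwa [zero_add] at this
  calc eLpNorm (fun x => Θ (S x)) q₁ μ
      ≤ liminf (fun m => eLpNorm (fun x => Θ (φ (ns m) x)) q₁ μ) atTop := by
        refine Lp.eLpNorm_lim_le_liminf_eLpNorm (fun m =>
          (hΘs.continuous.comp (φ (ns m)).continuous).aestronglyMeasurable) _ ?_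
        filter_upwards [hae] with x hx using (hΘs.continuous.tendsto _).comp hx
    _ ≤ liminf (fun m => C * (eLpNorm (fun x =>
          θ (φ (ns m) x) • (gradient (φ (ns m)) x - W x)) q₂ μ
          + eLpNorm (fun x => θ (φ (ns m) x) • W x) q₂ μ)) atTop := by
        refine liminf_le_liminf (Eventually.of_forall fun m => (hcomp m).trans ?_)
        gcongr
        refine le_trans (le_of_eq ?_) (eLpNorm_add_le ?_ ?_ hq₂)
        · congr 1; ext1 x; simp [smul_sub]
        · exact (hθ.comp (φ (ns m)).continuous).aestronglyMeasurable.smul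
            ((hgc m).aestronglyMeasurable.sub hW.1)
        · exact (hθ.comp (φ (ns m)).continuous).aestronglyMeasurable.smul hW.1
    _ = _ := hsum.liminf_eq

/-- The intended `w` is `H^{γ₁+1}`, whose derivative may blow up at `0` and at infinity. It is
replaced by bounded continuous `θ n ≤ w'` with support in `[a n, n + 3]`, equal to `w'` on `[2 a n,
n + 2]`. The previous lemma applies to `(v - a n)⁺` with `θ n` shifted by `a n`, and the right side
is bounded uniformly in `n`. -/
theorem eLpNorm_comp_le_of_memW12Zero {q₁ q₂ : ℝ≥0∞} (hq₂ : 1 ≤ q₂) (hq₂' : q₂ ≤ 2)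
    (hΩ : Bornology.IsBounded (Ω : Set (Eucl N))) {C : ℝ≥0∞} (hC : C ≠ ⊤)
    (hsob : ∀ f : Eucl N → ℝ, ContDiff ℝ 1 f → HasCompactSupport f →
      Function.support f ⊆ Ω → eLpNorm f q₁ volume ≤ C * eLpNorm (fderiv ℝ f) q₂ volume)
    {v : Eucl N → ℝ} {V : Eucl N → Eucl N} (hv : IsW12Loc Ω v V)
    (hv0 : ∀ᵐ x ∂(volume.restrict (Ω : Set (Eucl N))), 0 ≤ v x)
    (h0 : ∀ ε > 0, MemW12Zero Ω (fun x => max (v x - ε) 0)) {w w' : ℝ → ℝ}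
    (hw : ∀ s > 0, HasDerivAt w (w' s) s) (hw'c : ContinuousOn w' (Ioi 0))
    (hw' : ∀ s > 0, 0 ≤ w' s) (hw0 : w 0 = 0) (hwl : Tendsto w (𝓝[>] 0) (𝓝 0)) :
    eLpNorm (fun x => w (v x)) q₁ (volume.restrict (Ω : Set (Eucl N)))
      ≤ C * eLpNorm (fun x => if 0 < v x then w' (v x) • V x else 0) q₂
          (volume.restrict (Ω : Set (Eucl N))) := by
  set μ := (volume.restrict (Ω : Set (Eucl N)) : Measure (Eucl N)) with hμ
  have hvm : AEStronglyMeasurable v μ := hv.1.1.aestronglyMeasurable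
  set a : ℕ → ℝ := fun n => 1 / ((n : ℝ) + 2) with ha
  have ha0 : ∀ n, 0 < a n := fun n => by positivity
  have hMl : Tendsto (fun n : ℕ => ((n : ℝ) + 2)) atTop atTop :=
    tendsto_atTop_add_const_right _ _ tendsto_natCast_atTop_atTop
  have hal : Tendsto a atTop (𝓝 0) := by
    simpa [ha, Pi.inv_def] using hMl.inv_tendsto_atTop
  set χ : ℕ → ℝ → ℝ := fun n s => max 0 (min 1 (min ((s - a n) / a n) ((n : ℝ) + 3 - s))) with hχ
  have hχ0 : ∀ n s, 0 ≤ χ n s := fun n s => le_max_left _ _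
  have hχ1 : ∀ n s, χ n s ≤ 1 := fun n s => max_le zero_le_one (min_le_left _ _)
  have hχa : ∀ n s, s ≤ a n → χ n s = 0 := fun n s hs =>
    max_eq_left ((min_le_right _ _).trans ((min_le_left _ _).trans
      (div_nonpos_of_nonpos_of_nonneg (by linarith) (ha0 n).le)))
  have hχM : ∀ (n : ℕ) (s : ℝ), (n : ℝ) + 3 ≤ s → χ n s = 0 := fun n s hs =>
    max_eq_left ((min_le_right _ _).trans ((min_le_right _ _).trans (by linarith)))
  have hχmid : ∀ (n : ℕ) (s : ℝ), 2 * a n ≤ s → s ≤ (n : ℝ) + 2 → χ n s = 1 := fun n s h1 h2 => by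
    have : 1 ≤ (s - a n) / a n := by rw [le_div_iff₀ (ha0 n)]; linarith
    have h3 : min 1 (min ((s - a n) / a n) ((n : ℝ) + 3 - s)) = 1 :=
      min_eq_left (le_min this (by linarith))
    simp only [hχ]
    rw [h3]; exact max_eq_right zero_le_one
  -- Clamping evaluates `w'` only at positive arguments, where it is continuous; the factor `χ n`
  -- vanishes wherever clamping changes the argument.
  set cl : ℕ → ℝ → ℝ := fun n s => max (a n) (min s ((n : ℝ) + 3)) with hcl
  have haM : ∀ n : ℕ, a n ≤ (n : ℝ) + 3 := fun n => by
    have h1 : (2 : ℝ) ≤ (n : ℝ) + 2 := by linarith [(Nat.cast_nonneg n : (0 : ℝ) ≤ n)]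
    have h2 : a n ≤ 1 := by
      rw [ha]; simp only
      rw [div_le_one (by positivity)]; linarith
    linarith
  have hclmem : ∀ n s, cl n s ∈ Icc (a n) ((n : ℝ) + 3) := fun n s =>
    ⟨le_max_left _ _, max_le (haM n) (min_le_right _ _)⟩
  set θ : ℕ → ℝ → ℝ := fun n s => χ n s * w' (cl n s) with hθdef
  have hclc : ∀ n, Continuous (cl n) := fun n => by fun_prop
  have hθc : ∀ n, Continuous (θ n) := fun n => by
    refine Continuous.mul (by fun_prop) (hw'c.comp_continuous (hclc n) fun s => ?_)
    exact (ha0 n).trans_le (hclmem n s).1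
  have hθnn : ∀ n s, 0 ≤ θ n s := fun n s =>
    mul_nonneg (hχ0 n s) (hw' _ ((ha0 n).trans_le (hclmem n s).1))
  have hθle : ∀ n s, 0 < s → θ n s ≤ w' s := fun n s hs => by
    rcases le_total s (a n) with h | h
    · simp only [hθdef]; rw [hχa n s h, zero_mul]; exact hw' s hs
    rcases le_total ((n : ℝ) + 3) s with h' | h'
    · simp only [hθdef]; rw [hχM n s h', zero_mul]; exact hw' s hs
    · have : cl n s = s := by simp only [hcl]; rw [min_eq_left h', max_eq_right h]
      simp only [hθdef]
      rw [this]
      exact mul_le_of_le_one_left (hw' s hs) (hχ1 n s)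
  have hθeq : ∀ (n : ℕ) (s : ℝ), 2 * a n ≤ s → s ≤ (n : ℝ) + 2 → θ n s = w' s := fun n s h1 h2 => by
    have : cl n s = s := by
      simp only [hcl]; rw [min_eq_left (by linarith), max_eq_right (by linarith [ha0 n])]
    simp only [hθdef]
    rw [this, hχmid n s h1 h2, one_mul]
  have hθa : ∀ n s, s ≤ a n → θ n s = 0 := fun n s h => by
    simp only [hθdef]; rw [hχa n s h, zero_mul]
  set Θ : ℕ → Eucl N → ℝ := fun n x => ∫ r in (0 : ℝ)..max (v x - a n) 0, θ n (r + a n) with hΘ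
  have hbound : ∀ n, eLpNorm (Θ n) q₁ μ
      ≤ C * eLpNorm (fun x => if 0 < v x then w' (v x) • V x else 0) q₂ μ := by
    intro n
    obtain ⟨W, hW, hSm, hWm, φ, hφ0, hφ1⟩ := h0 (a n) (ha0 n)
    have hWV := HasWeakGradient.ae_eq_of_posPart hv hW
    obtain ⟨D, hD⟩ := (isCompact_Icc (a := a n) (b := (n : ℝ) + 3)).exists_bound_of_continuousOn
      (hw'c.mono fun s hs => (ha0 n).trans_le hs.1)
    have hθD : ∀ s, ‖θ n (s + a n)‖ ≤ D := fun s => by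
      simp only [hθdef]
      rw [norm_mul, Real.norm_of_nonneg (hχ0 _ _)]
      calc _ ≤ 1 * D := mul_le_mul (hχ1 _ _) (hD _ (hclmem _ _)) (norm_nonneg _) zero_le_one
        _ = D := one_mul D
    refine (eLpNorm_primitive_comp_le hq₂ hq₂' hΩ hC hsob hSm.1 hWm hφ0 hφ1
      ((hθc n).comp (continuous_add_const (a n))) hθD).trans ?_
    gcongr
    refine eLpNorm_mono_ae ?_
    filter_upwards [hWV] with x hx
    rw [hx]
    by_cases h : a n < v x
    · have hpos : 0 < v x := (ha0 n).trans h
      simp only [Function.comp_apply]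
      rw [if_pos h, if_pos hpos, max_eq_left (by linarith), sub_add_cancel, norm_smul, norm_smul,
        Real.norm_of_nonneg (hθnn _ _), Real.norm_of_nonneg (hw' _ hpos)]
      gcongr
      exact hθle _ _ hpos
    · rw [if_neg h, smul_zero, norm_zero]; exact norm_nonneg _
  have hww : ∀ s t, 0 < s → s ≤ t → ∫ r in s..t, w' r = w t - w s := fun s t hs hst => by
    have hsub : uIcc s t ⊆ Ioi 0 := by
      rw [uIcc_of_le hst]; exact fun r hr => hs.trans_le hr.1
    exact intervalIntegral.integral_eq_sub_of_hasDerivAt (fun r hr => hw r (hsub hr))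
      (hw'c.mono hsub).intervalIntegrable
  have hlim : ∀ᵐ x ∂μ, Tendsto (fun n => Θ n x) atTop (𝓝 (w (v x))) := by
    filter_upwards [hv0] with x hx
    rcases hx.eq_or_lt with h | h
    · rw [← h, hw0]
      refine tendsto_const_nhds.congr fun n => ?_
      simp only [hΘ]
      rw [← h, max_eq_right (by linarith [ha0 n]), intervalIntegral.integral_same]
    -- For large `n` the value `Θ n x` lies between `w (v x) - w (2 a n)` and `w (v x) - w (a n)`;
    -- both tend to `w (v x)` since `w` tends to `0` at `0`.
    · have hwa : ∀ c : ℝ, 0 < c → Tendsto (fun n => w (v x) - w (c * a n)) atTop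
          (𝓝 (w (v x))) := by
        intro c hc
        have h1 : Tendsto (fun n => c * a n) atTop (𝓝[>] 0) := by
          refine tendsto_nhdsWithin_iff.2 ⟨by simpa using hal.const_mul c,
            Eventually.of_forall fun n => mul_pos hc (ha0 n)⟩
        simpa using (hwl.comp h1).const_sub (w (v x))
      refine tendsto_of_tendsto_of_tendsto_of_le_of_le' (hwa 2 two_pos) (hwa 1 one_pos) ?_ ?_
      all_goals
        filter_upwards [hal.eventually (gt_mem_nhds (show (0 : ℝ) < v x / 2 by linarith)),
          hMl.eventually_ge_atTop (v x)] with n h1 h2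
        have ha' := ha0 n
        simp only [hΘ]
        rw [max_eq_left (by linarith), intervalIntegral.integral_comp_add_right (θ n) (a n),
          zero_add, sub_add_cancel]
      · rw [← hww _ _ (by linarith) (by linarith : 2 * a n ≤ v x),
          ← intervalIntegral.integral_add_adjacent_intervals
            ((hθc n).intervalIntegrable (a n) (2 * a n)) ((hθc n).intervalIntegrable (2 * a n) (v x))]
        have e1 : ∫ r in (2 * a n)..v x, w' r = ∫ r in (2 * a n)..v x, θ n r := by
          refine intervalIntegral.integral_congr fun r hr => ?_
          rw [uIcc_of_le (by linarith)] at hr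
          exact (hθeq n r hr.1 (hr.2.trans h2)).symm
        have e2 : 0 ≤ ∫ r in a n..2 * a n, θ n r :=
          intervalIntegral.integral_nonneg (by linarith) fun r _ => hθnn n r
        linarith
      · rw [one_mul, ← hww _ _ ha' (by linarith : a n ≤ v x)]
        refine intervalIntegral.integral_mono_on (by linarith) ((hθc n).intervalIntegrable _ _) ?_
          fun r hr => hθle n r (ha'.trans_le hr.1)
        refine (hw'c.mono ?_).intervalIntegrable
        rw [uIcc_of_le (by linarith)]
        exact fun r hr => ha'.trans_le hr.1
  have hΘm : ∀ n, AEStronglyMeasurable (Θ n) μ := fun n => by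
    have hc : Continuous fun s => ∫ r in (0 : ℝ)..s, θ n (r + a n) :=
      intervalIntegral.continuous_primitive
        (fun a' b' => ((hθc n).comp (continuous_add_const (a n))).intervalIntegrable a' b') 0
    exact (hc.comp (by fun_prop : Continuous fun s : ℝ => max (s - a n) 0)).comp_aestronglyMeasurable
      hvm
  refine (Lp.eLpNorm_lim_le_liminf_eLpNorm hΘm _ hlim).trans ?_
  refine (liminf_le_liminf (Eventually.of_forall hbound)).trans ?_
  simp

end SobolevInequality

/-! ### Integrated chain rule in time. -/

section TimeEvolution

theorem absolutelyContinuousOnInterval_of_dist_le {X : Type*} [PseudoMetricSpace X] {f : ℝ → ℝ}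
    {g : ℝ → X} {a b K : ℝ}
    (hf : AbsolutelyContinuousOnInterval f a b)
    (h : ∀ s ∈ uIcc a b, ∀ t ∈ uIcc a b, dist (g s) (g t) ≤ K * dist (f s) (f t)) :
    AbsolutelyContinuousOnInterval g a b := by
  unfold AbsolutelyContinuousOnInterval at hf ⊢
  have hlim := hf.const_mul K
  rw [mul_zero] at hlim
  refine squeeze_zero' (Eventually.of_forall fun E => Finset.sum_nonneg fun _ _ => dist_nonneg) ?_
    hlim
  have hmem : ∀ᶠ E in AbsolutelyContinuousOnInterval.totalLengthFilter ⊓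
      𝓟 (AbsolutelyContinuousOnInterval.disjWithin a b),
      E ∈ AbsolutelyContinuousOnInterval.disjWithin a b :=
    mem_inf_of_right (mem_principal_self _)
  filter_upwards [hmem] with E hE
  rw [Finset.mul_sum]
  exact Finset.sum_le_sum fun i hi => h _ (hE.1 i hi).1 _ (hE.1 i hi).2

/-- A Lipschitz function of an absolutely continuous one is absolutely continuous, and Lebesgue
differentiation identifies its derivative almost everywhere. -/
theorem integral_comp_primitive {θ : ℝ → ℝ} (hθ : Continuous θ) {K : ℝ} (hK : ∀ s, ‖θ s‖ ≤ K)
    {G : ℝ → ℝ} {c t₀ T : ℝ} (hG : IntervalIntegrable G volume t₀ T) :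
    (∫ r in (0 : ℝ)..c + ∫ τ in t₀..T, G τ, θ r)
      = (∫ r in (0 : ℝ)..c, θ r) + ∫ τ in t₀..T, θ (c + ∫ r in t₀..τ, G r) * G τ := by
  set Θ : ℝ → ℝ := fun s => ∫ r in (0 : ℝ)..s, θ r with hΘ
  have hΘd : ∀ s, HasDerivAt Θ (θ s) s := hasDerivAt_primitive hθ 0
  have hLip : LipschitzWith (Real.toNNReal K) Θ :=
    lipschitzWith_of_nnnorm_deriv_le (fun s => (hΘd s).differentiableAt) fun s => by
      rw [← NNReal.coe_le_coe, (hΘd s).deriv]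
      exact (hK s).trans (Real.le_coe_toNNReal K)
  have hac : AbsolutelyContinuousOnInterval (fun τ => Θ (c + ∫ r in t₀..τ, G r)) t₀ T := by
    refine absolutelyContinuousOnInterval_of_dist_le
      (hG.absolutelyContinuousOnInterval_intervalIntegral (c := t₀) left_mem_uIcc)
      (K := (Real.toNNReal K : ℝ)) fun s _ t _ => ?_
    simpa using hLip.dist_le_mul (c + ∫ r in t₀..s, G r) (c + ∫ r in t₀..t, G r)
  have hftc := hac.integral_deriv_eq_sub
  rw [intervalIntegral.integral_same, add_zero] at hftc
  have hd : ∫ τ in t₀..T, deriv (fun τ => Θ (c + ∫ r in t₀..τ, G r)) τ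
      = ∫ τ in t₀..T, θ (c + ∫ r in t₀..τ, G r) * G τ := by
    refine intervalIntegral.integral_congr_ae ?_
    filter_upwards [hG.ae_hasDerivAt_integral] with τ h hτ
    have h1 := (h (uIoc_subset_uIcc hτ) t₀ left_mem_uIcc).const_add c
    exact ((hΘd _).comp τ h1).deriv
  rw [hd] at hftc
  change Θ _ = Θ c + _
  linarith

variable {α : Type*} [MeasurableSpace α] {μ : Measure α} [IsFiniteMeasure μ]

/-- `w` has the `L²` time derivative `g` on `(t₀, ∞)`, in integrated form. -/
structure HasTimeDeriv (μ : Measure α) (t₀ : ℝ) (w g : ℝ → α → ℝ) : Prop where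
  memLp : MemLp (fun z : ℝ × α => g z.1 z.2) 2 ((volume.restrict (Ioi t₀)).prod μ)
  eq : ∀ t ≥ t₀, ∀ᵐ x ∂μ, w t x = w t₀ x + ∫ τ in t₀..t, g τ x

/-- For almost every `x` this is `integral_comp_primitive` in time; Fubini then integrates over `x`.
-/
theorem HasTimeDeriv.integral_primitive {w g : ℝ → α → ℝ} {t₀ : ℝ}
    (hw : HasTimeDeriv μ t₀ w g) (hw0 : Integrable (w t₀) μ) {θ : ℝ → ℝ} (hθ : Continuous θ)
    {K : ℝ} (hK : ∀ s, ‖θ s‖ ≤ K) {T : ℝ} (hT : t₀ ≤ T) :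
    IntervalIntegrable (fun τ => ∫ x, θ (w τ x) * g τ x ∂μ) volume t₀ T ∧
    Integrable (fun x => ∫ r in (0 : ℝ)..w T x, θ r) μ ∧
    ∫ x, (∫ r in (0 : ℝ)..w T x, θ r) ∂μ = (∫ x, (∫ r in (0 : ℝ)..w t₀ x, θ r) ∂μ)
      + ∫ τ in t₀..T, ∫ x, θ (w τ x) * g τ x ∂μ := by
  set ν := (volume.restrict (Ioc t₀ T) : Measure ℝ) with hν
  have hνle : ν ≤ volume.restrict (Ioi t₀) := Measure.restrict_mono Ioc_subset_Ioi_self le_rfl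
  have hprodle : ν.prod μ ≤ (volume.restrict (Ioi t₀)).prod μ := Measure.prod_mono hνle le_rfl
  have hg2 : MemLp (fun z : ℝ × α => g z.1 z.2) 2 (ν.prod μ) := hw.memLp.mono_measure hprodle
  have hgi : Integrable (fun z : ℝ × α => g z.1 z.2) (ν.prod μ) := hg2.integrable (by norm_num)
  set gm : ℝ × α → ℝ := hgi.1.mk _ with hgm
  have hgms : StronglyMeasurable gm := hgi.1.stronglyMeasurable_mk
  have hgmeq : (fun z : ℝ × α => g z.1 z.2) =ᵐ[ν.prod μ] gm := hgi.1.ae_eq_mk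
  have hgmi : Integrable gm (ν.prod μ) := hgi.congr hgmeq
  set w0 : α → ℝ := hw0.1.mk _ with hw0m
  have hw0s : StronglyMeasurable w0 := hw0.1.stronglyMeasurable_mk
  have hw0eq : w t₀ =ᵐ[μ] w0 := hw0.1.ae_eq_mk
  have hτx : ∀ᵐ τ ∂ν, ∀ᵐ x ∂μ, g τ x = gm (τ, x) := Measure.ae_ae_of_ae_prod hgmeq
  have hxτ : ∀ᵐ x ∂μ, ∀ᵐ τ ∂ν, g τ x = gm (τ, x) := by
    have h1 : ∀ᵐ z ∂(μ.prod ν), g z.swap.1 z.swap.2 = gm z.swap :=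
      Measure.measurePreserving_swap.quasiMeasurePreserving.ae hgmeq
    exact Measure.ae_ae_of_ae_prod h1
  have hxi : ∀ᵐ x ∂μ, IntegrableOn (fun τ => gm (τ, x)) (Ioc t₀ T) := hgmi.prod_left_ae
  -- Each `w τ` is known only up to a null set depending on `τ`, so `w` need not be jointly
  -- measurable. `W` is a jointly measurable version rebuilt from the initial value and the
  -- derivative.
  set W : ℝ × α → ℝ := fun z => w0 z.2
    + ∫ r, (Ioc t₀ z.1).indicator (fun r => gm (r, z.2)) r ∂ν with hW
  have hWs : StronglyMeasurable W := by
    refine (hw0s.comp_measurable measurable_snd).add ?_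
    have hset : MeasurableSet {q : (ℝ × α) × ℝ | q.2 ∈ Ioc t₀ q.1.1} :=
      (measurableSet_lt measurable_const measurable_snd).inter
        (measurableSet_le measurable_snd (measurable_fst.comp measurable_fst))
    have hf : StronglyMeasurable fun q : (ℝ × α) × ℝ => gm (q.2, q.1.2) :=
      hgms.comp_measurable (measurable_snd.prodMk (measurable_snd.comp measurable_fst))
    exact StronglyMeasurable.integral_prod_right' (hf.indicator hset)
  have hWeq : ∀ τ ∈ Icc t₀ T, ∀ x, W (τ, x) = w0 x + ∫ r in t₀..τ, gm (r, x) := by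
    intro τ hτ x
    simp only [hW]
    rw [integral_indicator measurableSet_Ioc, hν, Measure.restrict_restrict measurableSet_Ioc,
      inter_eq_left.2 (Ioc_subset_Ioc_right hτ.2), intervalIntegral.integral_of_le hτ.1]
  have hwW : ∀ τ ∈ Icc t₀ T, ∀ᵐ x ∂μ, w τ x = W (τ, x) := by
    intro τ hτ
    filter_upwards [hw.eq τ hτ.1, hw0eq, hxτ] with x h1 h2 h3
    rw [h1, h2, hWeq τ hτ, intervalIntegral.integral_of_le hτ.1,
      intervalIntegral.integral_of_le hτ.1]
    congr 1
    exact integral_congr_ae (ae_restrict_of_ae_restrict_of_subset (Ioc_subset_Ioc_right hτ.2) h3)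
  have hid : ∀ᵐ x ∂μ, (∫ r in (0 : ℝ)..W (T, x), θ r) = (∫ r in (0 : ℝ)..w0 x, θ r)
      + ∫ τ, θ (W (τ, x)) * gm (τ, x) ∂ν := by
    filter_upwards [hxi] with x hx
    have h1 := integral_comp_primitive hθ hK (c := w0 x)
      ((intervalIntegrable_iff_integrableOn_Ioc_of_le hT).2 hx)
    rw [hWeq T (right_mem_Icc.2 hT), h1, intervalIntegral.integral_of_le hT]
    congr 1
    refine setIntegral_congr_fun measurableSet_Ioc fun τ hτ => ?_
    rw [hWeq τ ⟨hτ.1.le, hτ.2⟩]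
  have hprod : Integrable (fun z : ℝ × α => θ (W z) * gm z) (ν.prod μ) := by
    refine (hgmi.norm.const_mul K).mono'
      ((hθ.comp_stronglyMeasurable hWs).aestronglyMeasurable.mul hgmi.1) (ae_of_all _ fun z => ?_)
    rw [norm_mul]
    gcongr
    exact hK _
  have hA : ∀ᵐ τ ∂ν, ∫ x, θ (w τ x) * g τ x ∂μ = ∫ x, θ (W (τ, x)) * gm (τ, x) ∂μ := by
    filter_upwards [hτx, ae_restrict_mem measurableSet_Ioc] with τ h1 hτ
    refine integral_congr_ae ?_
    filter_upwards [h1, hwW τ ⟨hτ.1.le, hτ.2⟩] with x h2 h3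
    rw [h2, h3]
  have hΘi : Integrable (fun x => ∫ r in (0 : ℝ)..w0 x, θ r) μ := by
    have hΘc : Continuous fun s => ∫ r in (0 : ℝ)..s, θ r :=
      intervalIntegral.continuous_primitive (fun a b => hθ.intervalIntegrable a b) 0
    refine ((hw0.congr hw0eq).norm.const_mul K).mono'
      (hΘc.comp_stronglyMeasurable hw0s).aestronglyMeasurable (ae_of_all _ fun x => ?_)
    simpa using intervalIntegral.norm_integral_le_of_norm_le_const (f := θ) (a := 0) (b := w0 x)
      (C := K) fun r _ => hK r
  have hx2 : Integrable (fun x => ∫ τ, θ (W (τ, x)) * gm (τ, x) ∂ν) μ := hprod.integral_prod_right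
  have hTeq : ∀ᵐ x ∂μ, (∫ r in (0 : ℝ)..w T x, θ r) = (∫ r in (0 : ℝ)..w0 x, θ r)
      + ∫ τ, θ (W (τ, x)) * gm (τ, x) ∂ν := by
    filter_upwards [hid, hwW T (right_mem_Icc.2 hT)] with x h1 h2
    rw [h2, h1]
  refine ⟨?_, ?_, ?_⟩
  · rw [intervalIntegrable_iff_integrableOn_Ioc_of_le hT]
    exact (hprod.integral_prod_left).congr (hA.mono fun τ h => h.symm)
  · exact (hΘi.add hx2).congr (hTeq.mono fun x h => h.symm)
  · rw [integral_congr_ae hTeq, integral_add hΘi hx2, intervalIntegral.integral_of_le hT,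
      integral_congr_ae hA]
    congr 1
    · refine integral_congr_ae ?_
      filter_upwards [hw0eq] with x hx
      rw [hx]
    · exact (integral_integral_swap (f := fun τ x => θ (W (τ, x)) * gm (τ, x)) hprod).symm

end TimeEvolution

/-! ### Evolution of `∫ w^{p+1}` through truncated powers. -/

section PowerEvolution

/-- The truncated power `min(s⁺, k)^p`. -/
def truncPow (p : ℝ) (k : ℕ) (s : ℝ) : ℝ := min (max s 0) k ^ p

theorem truncPow_nonneg (p : ℝ) (k : ℕ) (s : ℝ) : 0 ≤ truncPow p k s :=
  Real.rpow_nonneg (le_min (le_max_right _ _) (Nat.cast_nonneg k)) p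

theorem continuous_truncPow {p : ℝ} (hp : 0 ≤ p) (k : ℕ) : Continuous (truncPow p k) :=
  (Real.continuous_rpow_const hp).comp (by fun_prop)

theorem norm_truncPow_le {p : ℝ} (hp : 0 ≤ p) (k : ℕ) (s : ℝ) : ‖truncPow p k s‖ ≤ (k : ℝ) ^ p := by
  rw [Real.norm_of_nonneg (truncPow_nonneg p k s)]
  exact Real.rpow_le_rpow (le_min (le_max_right _ _) (Nat.cast_nonneg k)) (min_le_right _ _) hp

theorem truncPow_le_rpow {p : ℝ} (hp : 0 ≤ p) (k : ℕ) {s : ℝ} (hs : 0 ≤ s) :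
    truncPow p k s ≤ s ^ p := by
  refine Real.rpow_le_rpow (le_min (le_max_right _ _) (Nat.cast_nonneg k)) ?_ hp
  rw [max_eq_left hs]; exact min_le_left _ _

theorem truncPow_eq_rpow (p : ℝ) {k : ℕ} {s : ℝ} (hs : 0 ≤ s) (hk : s ≤ k) :
    truncPow p k s = s ^ p := by
  rw [truncPow, max_eq_left hs, min_eq_left hk]

theorem truncPow_mono_right {p : ℝ} (hp : 0 ≤ p) {j k : ℕ} (hjk : j ≤ k) (s : ℝ) :
    truncPow p j s ≤ truncPow p k s := by
  refine Real.rpow_le_rpow (le_min (le_max_right _ _) (Nat.cast_nonneg j)) ?_ hp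
  gcongr

theorem monotone_truncPow {p : ℝ} (hp : 0 ≤ p) (k : ℕ) : Monotone (truncPow p k) := fun s t hst => by
  refine Real.rpow_le_rpow (le_min (le_max_right _ _) (Nat.cast_nonneg k)) ?_ hp
  gcongr

/-- Up to height `j` the difference is zero; beyond it the lower truncation is constant. This makes
the truncated rates decrease in `k`. -/
theorem truncPow_sub_truncPow_mono {p : ℝ} (hp : 0 ≤ p) {j k : ℕ} (hjk : j ≤ k) :
    Monotone fun s => truncPow p k s - truncPow p j s := by
  intro s t hst
  have hjk' : (j : ℝ) ≤ k := by exact_mod_cast hjk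
  rcases le_total (max s 0) j with h | h
  · have : truncPow p k s = truncPow p j s := by
      rw [truncPow, truncPow, min_eq_left h, min_eq_left (h.trans hjk')]
    simp only [this, sub_self]
    exact sub_nonneg.2 (truncPow_mono_right hp hjk t)
  · have h2 : (j : ℝ) ≤ max t 0 := h.trans (by gcongr)
    have : truncPow p j s = truncPow p j t := by
      rw [truncPow, truncPow, min_eq_right h, min_eq_right h2]
    simp only [this]
    exact sub_le_sub_right (monotone_truncPow hp k hst) _

theorem integral_rpow_zero {p : ℝ} (hp : 0 ≤ p) (s : ℝ) :
    (p + 1) * ∫ r in (0 : ℝ)..s, r ^ p = s ^ (p + 1) := by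
  rw [integral_rpow (Or.inl (by linarith)), Real.zero_rpow (by linarith), sub_zero]
  field_simp

theorem primitive_truncPow_mono {p : ℝ} (hp : 0 ≤ p) {j k : ℕ} (hjk : j ≤ k) {s : ℝ} (hs : 0 ≤ s) :
    ∫ r in (0 : ℝ)..s, truncPow p j r ≤ ∫ r in (0 : ℝ)..s, truncPow p k r :=
  intervalIntegral.integral_mono_on hs ((continuous_truncPow hp j).intervalIntegrable _ _)
    ((continuous_truncPow hp k).intervalIntegrable _ _) fun r _ => truncPow_mono_right hp hjk r

theorem primitive_truncPow_le {p : ℝ} (hp : 0 ≤ p) (k : ℕ) {s : ℝ} (hs : 0 ≤ s) :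
    (p + 1) * ∫ r in (0 : ℝ)..s, truncPow p k r ≤ s ^ (p + 1) := by
  rw [← integral_rpow_zero hp]
  refine mul_le_mul_of_nonneg_left ?_ (by linarith)
  exact intervalIntegral.integral_mono_on hs ((continuous_truncPow hp k).intervalIntegrable _ _)
    ((Real.continuous_rpow_const hp).intervalIntegrable _ _) fun r hr => truncPow_le_rpow hp k hr.1

theorem primitive_truncPow_nonneg {p : ℝ} (k : ℕ) {s : ℝ} (hs : 0 ≤ s) :
    0 ≤ ∫ r in (0 : ℝ)..s, truncPow p k r :=
  intervalIntegral.integral_nonneg hs fun r _ => truncPow_nonneg p k r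

theorem tendsto_primitive_truncPow {p : ℝ} (hp : 0 ≤ p) {s : ℝ} (hs : 0 ≤ s) :
    Tendsto (fun k : ℕ => (p + 1) * ∫ r in (0 : ℝ)..s, truncPow p k r) atTop (𝓝 (s ^ (p + 1))) := by
  refine tendsto_const_nhds.congr' ?_
  filter_upwards [(tendsto_natCast_atTop_atTop (R := ℝ)).eventually_ge_atTop s] with k hk
  rw [← integral_rpow_zero hp]
  congr 1
  refine intervalIntegral.integral_congr fun r hr => ?_
  rw [uIcc_of_le hs] at hr
  exact (truncPow_eq_rpow p hr.1 (hr.2.trans hk)).symm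

variable {α : Type*} [MeasurableSpace α] {μ : Measure α} [IsFiniteMeasure μ]

/-- The rate of change of `∫ Θ(w)`, `Θ' = min(·⁺, k)^p`. -/
def truncRate (μ : Measure α) (w g : ℝ → α → ℝ) (p : ℝ) (k : ℕ) (τ : ℝ) : ℝ :=
  ∫ x, truncPow p k (w τ x) * g τ x ∂μ

/-- For each truncation the chain rule and the sign of the rate bound the integral at time `t` by
the initial one. Monotone convergence in `k` transfers bound and integrability to the full power. -/
theorem HasTimeDeriv.integrable_rpow {w g : ℝ → α → ℝ} {t₀ : ℝ} (hw : HasTimeDeriv μ t₀ w g)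
    {p : ℝ} (hp : 0 ≤ p) (hpos : ∀ t ≥ t₀, ∀ᵐ x ∂μ, 0 ≤ w t x) (hw0 : Integrable (w t₀) μ)
    (hw0p : Integrable (fun x => w t₀ x ^ (p + 1)) μ)
    (hneg : ∀ k, ∀ᵐ τ ∂(volume.restrict (Ioi t₀)), truncRate μ w g p k τ ≤ 0) {t : ℝ}
    (ht : t₀ ≤ t) :
    Integrable (fun x => w t x ^ (p + 1)) μ ∧
      ∫ x, w t x ^ (p + 1) ∂μ ≤ ∫ x, w t₀ x ^ (p + 1) ∂μ := by
  have hp1 : 0 < p + 1 := by linarith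
  have hΘ := fun k : ℕ => hw.integral_primitive hw0 (continuous_truncPow hp k)
    (norm_truncPow_le hp k) ht
  have hle : ∀ k : ℕ, ∫ x, (p + 1) * (∫ r in (0 : ℝ)..w t x, truncPow p k r) ∂μ
      ≤ ∫ x, w t₀ x ^ (p + 1) ∂μ := by
    intro k
    obtain ⟨h1, h2, h3⟩ := hΘ k
    have h4 : ∫ τ in t₀..t, ∫ x, truncPow p k (w τ x) * g τ x ∂μ ≤ 0 := by
      rw [intervalIntegral.integral_of_le ht]
      refine integral_nonpos_of_ae ?_
      exact ae_restrict_of_ae_restrict_of_subset Ioc_subset_Ioi_self (hneg k)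
    obtain ⟨-, h5, -⟩ := hw.integral_primitive hw0 (continuous_truncPow hp k)
      (norm_truncPow_le hp k) le_rfl
    calc _ = (p + 1) * ∫ x, (∫ r in (0 : ℝ)..w t x, truncPow p k r) ∂μ := integral_const_mul _ _
      _ ≤ (p + 1) * ∫ x, (∫ r in (0 : ℝ)..w t₀ x, truncPow p k r) ∂μ := by
        rw [h3]; gcongr; linarith
      _ = ∫ x, (p + 1) * (∫ r in (0 : ℝ)..w t₀ x, truncPow p k r) ∂μ :=
        (integral_const_mul _ _).symm
      _ ≤ _ := by
        refine integral_mono_ae (h5.const_mul _) hw0p ?_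
        filter_upwards [hpos t₀ le_rfl] with x hx using primitive_truncPow_le hp k hx
  have hmono : ∀ᵐ x ∂μ, Monotone fun k : ℕ =>
      ENNReal.ofReal ((p + 1) * ∫ r in (0 : ℝ)..w t x, truncPow p k r) := by
    filter_upwards [hpos t ht] with x hx j k hjk
    refine ENNReal.ofReal_le_ofReal (mul_le_mul_of_nonneg_left ?_ hp1.le)
    exact primitive_truncPow_mono hp hjk hx
  have hlim : ∀ᵐ x ∂μ, Tendsto (fun k : ℕ =>
      ENNReal.ofReal ((p + 1) * ∫ r in (0 : ℝ)..w t x, truncPow p k r)) atTop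
      (𝓝 (ENNReal.ofReal (w t x ^ (p + 1)))) := by
    filter_upwards [hpos t ht] with x hx
    exact (ENNReal.continuous_ofReal.tendsto _).comp (tendsto_primitive_truncPow hp hx)
  have hmct := lintegral_tendsto_of_tendsto_of_monotone
    (fun k => ((hΘ k).2.1.const_mul (p + 1)).1.aemeasurable.ennreal_ofReal) hmono hlim
  have hbound : ∫⁻ x, ENNReal.ofReal (w t x ^ (p + 1)) ∂μ
      ≤ ENNReal.ofReal (∫ x, w t₀ x ^ (p + 1) ∂μ) := by
    refine le_of_tendsto' hmct fun k => ?_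
    rw [← ofReal_integral_eq_lintegral_ofReal ((hΘ k).2.1.const_mul (p + 1))]
    · exact ENNReal.ofReal_le_ofReal (hle k)
    · filter_upwards [hpos t ht] with x hx
      exact mul_nonneg hp1.le (primitive_truncPow_nonneg k hx)
  have hmeas : AEStronglyMeasurable (fun x => w t x ^ (p + 1)) μ := by
    refine aestronglyMeasurable_of_tendsto_ae atTop
      (fun k => ((hΘ k).2.1.const_mul (p + 1)).1) ?_
    filter_upwards [hpos t ht] with x hx using tendsto_primitive_truncPow hp hx
  have hnn : 0 ≤ᵐ[μ] fun x => w t x ^ (p + 1) := by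
    filter_upwards [hpos t ht] with x hx using Real.rpow_nonneg hx _
  have hint : Integrable (fun x => w t x ^ (p + 1)) μ :=
    ⟨hmeas, (hasFiniteIntegral_iff_ofReal hnn).2 (hbound.trans_lt ENNReal.ofReal_lt_top)⟩
  refine ⟨hint, ?_⟩
  rw [← ofReal_integral_eq_lintegral_ofReal hint hnn] at hbound
  refine (ENNReal.ofReal_le_ofReal_iff (integral_nonneg_of_ae ?_)).1 hbound
  filter_upwards [hpos t₀ le_rfl] with x hx using Real.rpow_nonneg hx _

/-- The truncated rates are nonpositive and decrease in `k`. Monotone convergence shows that their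
limit is integrable in time with the increment of `∫ w^{p+1}` as its integral, although the
untruncated product `w^p g` need not be integrable in `x`. -/
theorem HasTimeDeriv.exists_rate {w g : ℝ → α → ℝ} {t₀ : ℝ} (hw : HasTimeDeriv μ t₀ w g)
    {p : ℝ} (hp : 0 ≤ p) (hpos : ∀ t ≥ t₀, ∀ᵐ x ∂μ, 0 ≤ w t x) (hw0 : Integrable (w t₀) μ)
    (hw0p : Integrable (fun x => w t₀ x ^ (p + 1)) μ)
    (hneg : ∀ k, ∀ᵐ τ ∂(volume.restrict (Ioi t₀)), truncRate μ w g p k τ ≤ 0)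
    (hanti : ∀ k, ∀ᵐ τ ∂(volume.restrict (Ioi t₀)),
      truncRate μ w g p (k + 1) τ ≤ truncRate μ w g p k τ) :
    ∃ a : ℝ → ℝ, (∀ T ≥ t₀, IntervalIntegrable a volume t₀ T ∧
        ∫ x, w T x ^ (p + 1) ∂μ = (∫ x, w t₀ x ^ (p + 1) ∂μ) + ∫ τ in t₀..T, a τ) ∧
      (∀ τ, a τ ≤ 0) ∧
      ∀ k, ∀ᵐ τ ∂(volume.restrict (Ioi t₀)), a τ ≤ (p + 1) * truncRate μ w g p k τ := by
  have hp1 : 0 < p + 1 := by linarith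
  set A : ℝ → ℝ≥0∞ := fun τ => ⨆ k, ENNReal.ofReal (-((p + 1) * truncRate μ w g p k τ)) with hA
  have key : ∀ T ≥ t₀, AEMeasurable A (volume.restrict (Ioc t₀ T)) ∧
      ∫⁻ τ in Ioc t₀ T, A τ
        = ENNReal.ofReal ((∫ x, w t₀ x ^ (p + 1) ∂μ) - ∫ x, w T x ^ (p + 1) ∂μ) := by
    intro T hT
    have hΘ := fun k : ℕ => hw.integral_primitive hw0 (continuous_truncPow hp k)
      (norm_truncPow_le hp k) hT
    have hΘ0 := fun k : ℕ => (hw.integral_primitive hw0 (continuous_truncPow hp k)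
      (norm_truncPow_le hp k) le_rfl).2.1
    have hAi : ∀ k, IntegrableOn (fun τ => -((p + 1) * truncRate μ w g p k τ)) (Ioc t₀ T) :=
      fun k => (((intervalIntegrable_iff_integrableOn_Ioc_of_le hT).1 (hΘ k).1).const_mul _).neg
    have hAm : ∀ k, AEMeasurable (fun τ => ENNReal.ofReal (-((p + 1) * truncRate μ w g p k τ)))
        (volume.restrict (Ioc t₀ T)) := fun k => (hAi k).1.aemeasurable.ennreal_ofReal
    have hmono : ∀ᵐ τ ∂(volume.restrict (Ioc t₀ T)), Monotone fun k =>
        ENNReal.ofReal (-((p + 1) * truncRate μ w g p k τ)) := by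
      filter_upwards [ae_restrict_of_ae_restrict_of_subset Ioc_subset_Ioi_self (ae_all_iff.2 hanti)]
        with τ hτ
      refine monotone_nat_of_le_succ fun k => ENNReal.ofReal_le_ofReal ?_
      have := mul_le_mul_of_nonneg_left (hτ k) hp1.le
      linarith
    have hmct := lintegral_tendsto_of_tendsto_of_monotone hAm hmono
      (hmono.mono fun τ h => tendsto_atTop_iSup h)
    have hconv : ∀ t ≥ t₀, Integrable (fun x => w t x ^ (p + 1)) μ →
        (∀ k : ℕ, Integrable (fun x => ∫ r in (0 : ℝ)..w t x, truncPow p k r) μ) →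
        Tendsto (fun k : ℕ => (p + 1) * ∫ x, (∫ r in (0 : ℝ)..w t x, truncPow p k r) ∂μ) atTop
          (𝓝 (∫ x, w t x ^ (p + 1) ∂μ)) := by
      intro t ht hti hi
      simp only [← integral_const_mul]
      refine tendsto_integral_of_dominated_convergence (fun x => w t x ^ (p + 1))
        (fun k => ((hi k).const_mul _).1) hti (fun k => ?_) ?_
      · filter_upwards [hpos t ht] with x hx
        rw [Real.norm_of_nonneg (mul_nonneg hp1.le (primitive_truncPow_nonneg k hx))]
        exact primitive_truncPow_le hp k hx
      · filter_upwards [hpos t ht] with x hx using tendsto_primitive_truncPow hp hx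
    have hconv0 := hconv t₀ le_rfl hw0p hΘ0
    have hconvT := hconv T hT (hw.integrable_rpow hp hpos hw0 hw0p hneg hT).1 fun k => (hΘ k).2.1
    refine ⟨AEMeasurable.iSup hAm, tendsto_nhds_unique hmct ?_⟩
    refine ((ENNReal.continuous_ofReal.tendsto _).comp (hconv0.sub hconvT)).congr fun k => ?_
    rw [← ofReal_integral_eq_lintegral_ofReal (hAi k)]
    · simp only [Function.comp_apply]
      congr 1
      rw [(hΘ k).2.2, integral_neg, integral_const_mul, ← intervalIntegral.integral_of_le hT]
      change _ = -((p + 1) * ∫ τ in t₀..T, ∫ x, truncPow p k (w τ x) * g τ x ∂μ)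
      ring
    · filter_upwards [ae_restrict_of_ae_restrict_of_subset Ioc_subset_Ioi_self (hneg k)] with τ hτ
      have := mul_nonpos_of_nonneg_of_nonpos hp1.le hτ
      simp only [Pi.zero_apply]; linarith
  have hfin : ∀ T ≥ t₀, ∀ᵐ τ ∂(volume.restrict (Ioc t₀ T)), A τ < ⊤ := fun T hT =>
    ae_lt_top' (key T hT).1 (by rw [(key T hT).2]; exact ENNReal.ofReal_ne_top)
  -- Where `A τ = ⊤` the value of `toReal` is `0`: this keeps the rate nonpositive at every `τ`, and
  -- such times form a null set.
  refine ⟨fun τ => -(A τ).toReal, fun T hT => ⟨?_, ?_⟩, fun τ => by simp, fun k => ?_⟩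
  · rw [intervalIntegrable_iff_integrableOn_Ioc_of_le hT]
    exact (integrable_toReal_of_lintegral_ne_top (key T hT).1
      (by rw [(key T hT).2]; exact ENNReal.ofReal_ne_top)).neg
  · rw [intervalIntegral.integral_of_le hT, integral_neg, integral_toReal (key T hT).1 (hfin T hT),
      (key T hT).2, ENNReal.toReal_ofReal]
    · ring
    · linarith [(hw.integrable_rpow hp hpos hw0 hw0p hneg hT).2]
  · have hall : ∀ᵐ τ ∂(volume.restrict (Ioi t₀)), A τ < ⊤ := by
      have hU : Ioi t₀ = ⋃ n : ℕ, Ioc t₀ (t₀ + n) := by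
        ext τ
        simp only [mem_Ioi, mem_iUnion, mem_Ioc]
        refine ⟨fun h => ?_, fun ⟨n, h⟩ => h.1⟩
        obtain ⟨n, hn⟩ := exists_nat_ge (τ - t₀)
        exact ⟨n, h, by linarith⟩
      rw [hU, ae_restrict_iUnion_iff]
      exact fun n => hfin _ (le_add_of_nonneg_right (Nat.cast_nonneg n))
    filter_upwards [hall] with τ hτ
    have h1 : ENNReal.ofReal (-((p + 1) * truncRate μ w g p k τ)) ≤ A τ :=
      le_iSup (fun k => ENNReal.ofReal (-((p + 1) * truncRate μ w g p k τ))) k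
    have h2 := (ENNReal.ofReal_le_iff_le_toReal hτ.ne).1 h1
    linarith

end PowerEvolution

/-! ### The differential inequality and its decay rate. -/

section Decay

variable {Y a : ℝ → ℝ} {t₀ : ℝ}

theorem absolutelyContinuousOnInterval_of_eq_integral
    (hYa : ∀ T ≥ t₀, IntervalIntegrable a volume t₀ T ∧ Y T = Y t₀ + ∫ τ in t₀..T, a τ)
    {T : ℝ} (hT : t₀ ≤ T) : AbsolutelyContinuousOnInterval Y t₀ T := by
  refine absolutelyContinuousOnInterval_of_dist_le
    ((hYa T hT).1.absolutelyContinuousOnInterval_intervalIntegral (c := t₀) left_mem_uIcc)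
    (K := 1) fun s hs t ht => ?_
  rw [uIcc_of_le hT] at hs ht
  rw [(hYa s hs.1).2, (hYa t ht.1).2, dist_add_left, one_mul]

theorem ae_hasDerivAt_of_eq_integral
    (hYa : ∀ T ≥ t₀, IntervalIntegrable a volume t₀ T ∧ Y T = Y t₀ + ∫ τ in t₀..T, a τ) :
    ∀ᵐ t ∂(volume.restrict (Ioi t₀)), HasDerivAt Y (a t) t := by
  have h1 : ∀ᵐ t, ∀ n : ℕ, t ∈ uIcc t₀ (t₀ + n) → ∀ c ∈ uIcc t₀ (t₀ + n),
      HasDerivAt (fun x => ∫ τ in c..x, a τ) (a t) t :=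
    ae_all_iff.2 fun n =>
      (hYa _ (le_add_of_nonneg_right (Nat.cast_nonneg n))).1.ae_hasDerivAt_integral
  filter_upwards [ae_restrict_of_ae h1, ae_restrict_mem measurableSet_Ioi] with t ht ht0
  obtain ⟨n, hn⟩ := exists_nat_ge (t - t₀)
  have hmem : t ∈ uIcc t₀ (t₀ + n) := by
    rw [uIcc_of_le (le_add_of_nonneg_right (Nat.cast_nonneg n))]
    exact ⟨le_of_lt ht0, by linarith⟩
  refine ((ht n hmem t₀ left_mem_uIcc).const_add (Y t₀)).congr_of_eventuallyEq ?_
  filter_upwards [lt_mem_nhds ht0] with s hs using (hYa s (le_of_lt hs)).2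

theorem antitone_of_eq_integral
    (hYa : ∀ T ≥ t₀, IntervalIntegrable a volume t₀ T ∧ Y T = Y t₀ + ∫ τ in t₀..T, a τ)
    (ha : ∀ τ, a τ ≤ 0) {s t : ℝ} (hs : t₀ ≤ s) (hst : s ≤ t) : Y t ≤ Y s := by
  obtain ⟨h1, h2⟩ := hYa s hs
  obtain ⟨h3, h4⟩ := hYa t (hs.trans hst)
  have h5 : (∫ τ in t₀..t, a τ) - ∫ τ in t₀..s, a τ = ∫ τ in s..t, a τ :=
    intervalIntegral.integral_interval_sub_left h3 h1
  have h6 : ∫ τ in s..t, a τ ≤ 0 := by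
    rw [intervalIntegral.integral_of_le hst]
    exact integral_nonpos ha
  linarith

variable {δ C : ℝ}

/-- With `α = (2 - δ)/δ` one has `2/δ = α + 1`, so the inequality says `(Y^{-α})' ≥ C α`, to be
integrated from `t₀` to `t`. -/
theorem decay_of_eq_integral (hδ1 : 1 ≤ δ) (hδ2 : δ < 2) (hC : 0 < C)
    (hY : ∀ t ≥ t₀, 0 ≤ Y t)
    (hYa : ∀ T ≥ t₀, IntervalIntegrable a volume t₀ T ∧ Y T = Y t₀ + ∫ τ in t₀..T, a τ)
    (ha : ∀ τ, a τ ≤ 0)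
    (haC : ∀ᵐ τ ∂(volume.restrict (Ioi t₀)), a τ + C * Y τ ^ (2 / δ) ≤ 0)
    (hY0 : 0 < Y t₀) {t : ℝ} (ht : t₀ ≤ t) :
    Y t ≤ (C * ((2 - δ) / δ) * (t - t₀) + Y t₀ ^ (-((2 - δ) / δ))) ^ (-(δ / (2 - δ))) := by
  set α := (2 - δ) / δ with hα
  have hδ0 : 0 < δ := by linarith
  have hα0 : 0 < α := div_pos (by linarith) hδ0
  have hαinv : δ / (2 - δ) = α⁻¹ := by rw [hα, inv_div]
  have hα1 : 2 / δ = α + 1 := by rw [hα]; field_simp; ring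
  have hB0 : 0 < C * α * (t - t₀) + Y t₀ ^ (-α) := by
    have h1 : 0 < Y t₀ ^ (-α) := Real.rpow_pos_of_pos hY0 _
    have h2 : 0 ≤ C * α * (t - t₀) := mul_nonneg (by positivity) (by linarith)
    linarith
  -- If `Y t = 0` there is nothing to prove; otherwise `Y`, being nonincreasing, is positive on
  -- `[t₀, t]` and its negative powers are genuine.
  rcases (hY t ht).eq_or_lt with h0 | h0
  · rw [← h0]; exact Real.rpow_nonneg hB0.le _
  have hpos : ∀ s ∈ Icc t₀ t, 0 < Y s := fun s hs =>
    h0.trans_le (antitone_of_eq_integral hYa ha hs.1 hs.2)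
  have hmono : MonotoneOn (fun s => Y s ^ (-α)) (uIcc t₀ t) := by
    rw [uIcc_of_le ht]
    intro s hs r hr hsr
    exact Real.rpow_le_rpow_of_nonpos (hpos r hr) (antitone_of_eq_integral hYa ha hs.1 hsr)
      (by linarith)
  -- For a monotone function the integral of the derivative is at most the increment, so absolute
  -- continuity of `Y^{-α}` is not needed.
  have hmem := hmono.intervalIntegral_deriv_mem_uIcc
  have hle : Y t₀ ^ (-α) ≤ Y t ^ (-α) := hmono left_mem_uIcc right_mem_uIcc ht
  rw [uIcc_of_le (by linarith)] at hmem
  have hlow : C * α * (t - t₀) ≤ ∫ s in t₀..t, deriv (fun s => Y s ^ (-α)) s := by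
    have h1 : ∫ _ in t₀..t, C * α = C * α * (t - t₀) := by
      rw [intervalIntegral.integral_const, smul_eq_mul, mul_comm]
    rw [← h1, intervalIntegral.integral_of_le ht, intervalIntegral.integral_of_le ht]
    refine integral_mono_ae (integrable_const _)
      ((intervalIntegrable_iff_integrableOn_Ioc_of_le ht).1 hmono.intervalIntegrable_deriv) ?_
    filter_upwards [ae_restrict_of_ae_restrict_of_subset Ioc_subset_Ioi_self
      (ae_hasDerivAt_of_eq_integral hYa),
      ae_restrict_of_ae_restrict_of_subset Ioc_subset_Ioi_self haC,
      ae_restrict_mem measurableSet_Ioc] with s h2 h3 hs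
    have hYs := hpos s ⟨hs.1.le, hs.2⟩
    rw [(h2.rpow_const (Or.inl hYs.ne')).deriv]
    have h4 : Y s ^ (-α - 1) * Y s ^ (2 / δ) = 1 := by
      rw [← Real.rpow_add hYs, hα1]
      simp
    have h5 : 0 < Y s ^ (-α - 1) := Real.rpow_pos_of_pos hYs _
    have h6 : C * Y s ^ (2 / δ) ≤ -a s := by linarith
    calc C * α = α * Y s ^ (-α - 1) * (C * Y s ^ (2 / δ)) := by linear_combination (-C * α) * h4
      _ ≤ α * Y s ^ (-α - 1) * (-a s) := by gcongr
      _ = _ := by ring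
  have hfinal : C * α * (t - t₀) + Y t₀ ^ (-α) ≤ Y t ^ (-α) := by linarith [hmem.2]
  rw [hαinv]
  calc Y t = (Y t ^ (-α)) ^ (-α⁻¹) := by
        rw [← Real.rpow_mul h0.le, neg_mul_neg, mul_inv_cancel₀ hα0.ne', Real.rpow_one]
    _ ≤ _ := Real.rpow_le_rpow_of_nonpos hB0 hfinal (by
        have := inv_pos.2 hα0; linarith)

theorem tendsto_zero_of_eq_integral (hδ1 : 1 ≤ δ) (hδ2 : δ < 2) (hC : 0 < C)
    (hY : ∀ t ≥ t₀, 0 ≤ Y t)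
    (hYa : ∀ T ≥ t₀, IntervalIntegrable a volume t₀ T ∧ Y T = Y t₀ + ∫ τ in t₀..T, a τ)
    (ha : ∀ τ, a τ ≤ 0)
    (haC : ∀ᵐ τ ∂(volume.restrict (Ioi t₀)), a τ + C * Y τ ^ (2 / δ) ≤ 0) :
    Tendsto Y atTop (𝓝 0) := by
  rcases (hY t₀ le_rfl).eq_or_lt with h0 | h0
  · refine tendsto_const_nhds.congr' ?_
    filter_upwards [eventually_ge_atTop t₀] with t ht
    exact le_antisymm (hY t ht) ((antitone_of_eq_integral hYa ha le_rfl ht).trans h0.ge)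
  · have hα0 : 0 < (2 - δ) / δ := div_pos (by linarith) (by linarith)
    have hβ0 : 0 < δ / (2 - δ) := div_pos (by linarith) (by linarith)
    have hB : Tendsto (fun t => C * ((2 - δ) / δ) * (t - t₀) + Y t₀ ^ (-((2 - δ) / δ)))
        atTop atTop :=
      tendsto_atTop_add_const_right _ _ (Tendsto.const_mul_atTop (mul_pos hC hα0)
        (tendsto_atTop_add_const_right _ _ tendsto_id))
    refine tendsto_of_tendsto_of_tendsto_of_le_of_le' tendsto_const_nhds
      ((tendsto_rpow_neg_atTop hβ0).comp hB) ?_ ?_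
    · filter_upwards [eventually_ge_atTop t₀] with t ht using hY t ht
    · filter_upwards [eventually_ge_atTop t₀] with t ht
      exact decay_of_eq_integral hδ1 hδ2 hC hY hYa ha haC h0 ht

end Decay

/-! ### Properties of `H`, `F` and the truncated weights. -/

section Nonlinearities

variable {h a : ℝ → ℝ}

theorem H_zero (h : ℝ → ℝ) : H h 0 = 0 := intervalIntegral.integral_same

theorem F_zero (hadm : Admissible h a) : F h a 0 = 0 := by rw [F, hadm.a_zero, mul_zero]

theorem Admissible.integrableOn_Icc (hadm : Admissible h a) (s : ℝ) : IntegrableOn h (Icc 0 s) :=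
  hadm.h_loc.integrableOn_compact_subset (fun _ hx => hx.1) isCompact_Icc

theorem Admissible.intervalIntegrable (hadm : Admissible h a) {s t : ℝ} (hs : 0 ≤ s) (ht : 0 ≤ t) :
    IntervalIntegrable h volume s t := by
  refine (hadm.integrableOn_Icc (max s t)).mono_set ?_ |>.intervalIntegrable
  exact fun x hx => ⟨(le_min hs ht).trans hx.1, hx.2⟩

theorem Admissible.continuousAt_h (hadm : Admissible h a) {s : ℝ} (hs : 0 < s) :
    ContinuousAt h s := hadm.h_cont.continuousAt (Ioi_mem_nhds hs)

theorem Admissible.hasDerivAt_H (hadm : Admissible h a) {s : ℝ} (hs : 0 < s) :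
    HasDerivAt (H h) (h s) s := by
  refine intervalIntegral.integral_hasDerivAt_right (hadm.intervalIntegrable le_rfl hs.le) ?_
    (hadm.continuousAt_h hs)
  exact hadm.h_cont.stronglyMeasurableAtFilter isOpen_Ioi s hs

theorem Admissible.continuousOn_H (hadm : Admissible h a) : ContinuousOn (H h) (Ici 0) := by
  intro s hs
  have h1 : ContinuousOn (H h) (uIcc 0 (s + 1)) :=
    intervalIntegral.continuousOn_primitive_interval (by
      rw [uIcc_of_le (by linarith [mem_Ici.1 hs])]; exact hadm.integrableOn_Icc _)
  rw [uIcc_of_le (by linarith [mem_Ici.1 hs])] at h1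
  refine (h1 s ⟨hs, by linarith⟩).mono_of_mem_nhdsWithin ?_
  rw [← Ici_inter_Iic]
  exact inter_mem_nhdsWithin _ (Iic_mem_nhds (by linarith))

theorem Admissible.strictMonoOn_H (hadm : Admissible h a) : StrictMonoOn (H h) (Ici 0) := by
  intro s hs t ht hst
  have h1 : 0 < ∫ r in s..t, h r := intervalIntegral.intervalIntegral_pos_of_pos_on
    (hadm.intervalIntegrable hs ht) (fun x hx => hadm.h_pos x (hs.trans_lt hx.1)) hst
  have h2 := intervalIntegral.integral_interval_sub_left
    (hadm.intervalIntegrable le_rfl ht) (hadm.intervalIntegrable le_rfl hs)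
  simp only [H]; linarith

theorem Admissible.monotoneOn_H (hadm : Admissible h a) : MonotoneOn (H h) (Ici 0) :=
  hadm.strictMonoOn_H.monotoneOn

theorem Admissible.H_nonneg (hadm : Admissible h a) {s : ℝ} (hs : 0 ≤ s) : 0 ≤ H h s := by
  rw [← H_zero h]; exact hadm.monotoneOn_H self_mem_Ici hs hs

theorem Admissible.H_pos (hadm : Admissible h a) {s : ℝ} (hs : 0 < s) : 0 < H h s := by
  rw [← H_zero h]; exact hadm.strictMonoOn_H self_mem_Ici hs.le hs

theorem Admissible.F_nonneg (hadm : Admissible h a) {s : ℝ} (hs : 0 ≤ s) : 0 ≤ F h a s := by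
  rw [← F_zero hadm]; exact hadm.F_mono self_mem_Ici hs hs

theorem Admissible.continuous_H_max (hadm : Admissible h a) : Continuous fun s => H h (max s 0) :=
  hadm.continuousOn_H.comp_continuous (by fun_prop) fun _ => mem_Ici.2 (le_max_right _ _)

theorem Admissible.monotone_H_max (hadm : Admissible h a) : Monotone fun s => H h (max s 0) :=
  fun s t hst => hadm.monotoneOn_H (le_max_right s 0) (le_max_right t 0) (by gcongr)

/-- The function `θ(H) F`, extended by zero to the negative half-line. -/
def weightF (h a θ : ℝ → ℝ) (s : ℝ) : ℝ := θ (H h (max s 0)) * F h a (max s 0)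

theorem Admissible.continuous_weightF (hadm : Admissible h a) {θ : ℝ → ℝ} (hθ : Continuous θ) :
    Continuous (weightF h a θ) :=
  (hθ.comp hadm.continuous_H_max).mul
    (hadm.F_lip.continuousOn.comp_continuous (by fun_prop) fun _ => mem_Ici.2 (le_max_right _ _))

theorem Admissible.monotone_weightF (hadm : Admissible h a) {θ : ℝ → ℝ} (hθ : Monotone θ)
    (hθ0 : ∀ s, 0 ≤ θ s) : Monotone (weightF h a θ) := by
  intro s t hst
  refine mul_le_mul (hθ (hadm.monotone_H_max hst)) ?_ (hadm.F_nonneg (le_max_right _ _)) (hθ0 _)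
  exact hadm.F_mono (le_max_right s 0) (le_max_right t 0) (by gcongr)

theorem Admissible.weightF_of_nonpos (hadm : Admissible h a) (θ : ℝ → ℝ) {s : ℝ} (hs : s ≤ 0) :
    weightF h a θ s = 0 := by
  rw [weightF, max_eq_right hs, F_zero hadm, mul_zero]

theorem SlopeGE.of_monotone {ψ : ℝ → ℝ} (hψ : Monotone ψ) (s : ℝ) {c : ℝ} (hc : c ≤ 0) :
    SlopeGE ψ s c :=
  ⟨1, one_pos, fun _ _ _ hr _ => (mul_nonpos_of_nonpos_of_nonneg hc (sub_nonneg.2 hr)).trans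
    (sub_nonneg.2 (hψ hr))⟩

/-- The lower bound `c₃ H^{q₁}` for the slopes of `H^{p₁} F`, cut off where `H ≥ k`. -/
def slopeBound (h : ℝ → ℝ) (q₁ c₃ : ℝ) (k : ℕ) (s : ℝ) : ℝ :=
  if H h (max s 0) < k then c₃ * H h (max s 0) ^ q₁ else 0

/-- Below the truncation height the weight is `H^{p₁} F`, a monotone function whose increments
dominate the integral of its almost everywhere derivative. Continuity of `H` keeps `c < c₃ H^{q₁}`
on a neighbourhood. Where `H ≥ k` the claimed bound is zero and monotonicity suffices. -/
theorem Admissible.slopeGE (hadm : Admissible h a) {p₁ q₁ c₃ : ℝ} (hp₁ : 0 < p₁) (hq₁ : 0 < q₁)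
    (hlower : DerivLower h a p₁ q₁ c₃) (k : ℕ) {s : ℝ} (hs : 0 < s) {c : ℝ}
    (hc : c < slopeBound h q₁ c₃ k s) : SlopeGE (weightF h a (truncPow p₁ k)) s c := by
  have hmono := hadm.monotone_weightF (monotone_truncPow hp₁.le k) (truncPow_nonneg p₁ k)
  unfold slopeBound at hc
  split_ifs at hc with hk
  swap
  · exact SlopeGE.of_monotone hmono s hc.le
  have hcont : Continuous fun r => c₃ * H h (max r 0) ^ q₁ :=
    (((Real.continuous_rpow_const hq₁.le).comp hadm.continuous_H_max)).const_mul c₃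
  have hev : ∀ᶠ r in 𝓝 s, H h (max r 0) < k ∧ c < c₃ * H h (max r 0) ^ q₁ ∧ 0 < r :=
    (hadm.continuous_H_max.continuousAt.eventually_lt continuousAt_const hk).and
      ((continuousAt_const.eventually_lt hcont.continuousAt hc).and (lt_mem_nhds hs))
  obtain ⟨η, hη, hball⟩ := Metric.eventually_nhds_iff.1 hev
  refine ⟨η, hη, fun r r' h1 h2 h3 => ?_⟩
  have hin : ∀ x ∈ Icc r r', H h x < k ∧ c < c₃ * H h x ^ q₁ ∧ 0 < x := by
    intro x hx
    have := hball (y := x) (by rw [Real.dist_eq, abs_lt]; constructor <;> linarith [hx.1, hx.2])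
    rwa [max_eq_left this.2.2.le] at this
  have heq : ∀ x ∈ Icc r r', weightF h a (truncPow p₁ k) x = H h x ^ p₁ * F h a x := by
    intro x hx
    obtain ⟨h4, -, h5⟩ := hin x hx
    rw [weightF, max_eq_left h5.le, truncPow_eq_rpow p₁ (hadm.H_nonneg h5.le) h4.le]
  have hP : MonotoneOn (fun x => H h x ^ p₁ * F h a x) (uIcc r r') := by
    rw [uIcc_of_le h2]
    intro x hx y hy hxy
    simp only [← heq x hx, ← heq y hy]
    exact hmono hxy
  have hle : ∫ x in r..r', deriv (fun x => H h x ^ p₁ * F h a x) x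
      ≤ H h r' ^ p₁ * F h a r' - H h r ^ p₁ * F h a r := by
    have h4 := hP.intervalIntegral_deriv_mem_uIcc
    rw [uIcc_of_le (sub_nonneg.2 (hP left_mem_uIcc right_mem_uIcc h2))] at h4
    exact h4.2
  rw [heq r ⟨le_rfl, h2⟩, heq r' ⟨h2, le_rfl⟩]
  refine le_trans ?_ hle
  have h5 : c * (r' - r) = ∫ _ in r..r', c := by rw [intervalIntegral.integral_const]; simp [mul_comm]
  rw [h5]
  refine intervalIntegral.integral_mono_ae_restrict h2 intervalIntegrable_const
    hP.intervalIntegrable_deriv ?_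
  have h6 : Icc r r' ⊆ Ioi 0 := fun x hx => (hin x hx).2.2
  filter_upwards [ae_restrict_of_ae_restrict_of_subset h6 hlower,
    ae_restrict_mem measurableSet_Icc] with x hx hxm
  exact (hin x hxm).2.1.le.trans hx

theorem Admissible.hasDerivAt_H_rpow (hadm : Admissible h a) (γ : ℝ) {s : ℝ} (hs : 0 < s) :
    HasDerivAt (fun r => H h r ^ (γ + 1)) ((γ + 1) * H h s ^ γ * h s) s := by
  have h1 := (hadm.hasDerivAt_H hs).rpow_const (p := γ + 1) (Or.inl (hadm.H_pos hs).ne')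
  rw [add_sub_cancel_right] at h1
  convert h1 using 1
  ring

theorem Admissible.deriv_H_rpow_le (hadm : Admissible h a) {γ₁ β₁ β₂ c₅ : ℝ}
    (hupper : DerivUpper h γ₁ β₁ β₂ c₅) {s : ℝ} (hs : 0 < s) :
    (γ₁ + 1) * H h s ^ γ₁ * h s ≤ c₅ * (H h s ^ β₁ + H h s ^ β₂) := by
  rw [← (hadm.hasDerivAt_H_rpow γ₁ hs).deriv]
  exact hupper s hs

theorem Admissible.tendsto_H_rpow (hadm : Admissible h a) {γ : ℝ} (hγ : 0 < γ) :
    Tendsto (fun r => H h r ^ γ) (𝓝[>] 0) (𝓝 0) := by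
  have h1 : Tendsto (H h) (𝓝[>] 0) (𝓝 0) := by
    have := (hadm.continuousOn_H 0 self_mem_Ici).mono Ioi_subset_Ici_self
    rwa [ContinuousWithinAt, H_zero] at this
  have h2 := h1.rpow_const (p := γ) (Or.inr hγ.le)
  rwa [Real.zero_rpow hγ.ne'] at h2

end Nonlinearities

/-! ### Estimates at almost every fixed time. -/

section Slices

variable {N : ℕ} {Ω : Opens (Eucl N)} {h a : ℝ → ℝ} {v G L : Eucl N → ℝ} {V : Eucl N → Eucl N}

/-- The information carried by a solution at almost every fixed time. -/
structure IsTimeSlice (Ω : Opens (Eucl N)) (h a : ℝ → ℝ) (v G L : Eucl N → ℝ)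
    (V : Eucl N → Eucl N) : Prop where
  nonneg : ∀ᵐ x ∂(volume.restrict (Ω : Set (Eucl N))), 0 ≤ v x
  boundary : ∀ ε > 0, MemW12Zero Ω (fun x => max (v x - ε) 0)
  isW12Loc : IsW12Loc Ω v V
  hasWeakDivergence : HasWeakDivergence Ω V L
  memLp_right : MemLp (fun x => F h a (v x) * L x) 2 (volume.restrict (Ω : Set (Eucl N)))
  memLp_left : MemLp G 2 (volume.restrict (Ω : Set (Eucl N)))
  le : ∀ᵐ x ∂(volume.restrict (Ω : Set (Eucl N))), G x ≤ F h a (v x) * L x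

theorem MemLp.prodMk_left_two {α β : Type*} [MeasurableSpace α] [MeasurableSpace β]
    {μ : Measure α} {ν : Measure β} [SFinite μ] [SFinite ν] {f : α × β → ℝ}
    (hf : MemLp f 2 (μ.prod ν)) : ∀ᵐ x ∂μ, MemLp (fun y => f (x, y)) 2 ν := by
  filter_upwards [hf.1.prodMk_left,
    ((memLp_two_iff_integrable_sq hf.1).1 hf).prod_right_ae] with x h1 h2
  exact (memLp_two_iff_integrable_sq h1).2 h2

theorem IsSolution.ae_isTimeSlice {t₀ : ℝ} {u₀ : Eucl N → ℝ} {u : ℝ → Eucl N → ℝ}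
    (hu : IsSolution Ω h a t₀ u₀ u) : ∃ Ht Lap : ℝ → Eucl N → ℝ,
    HasTimeDeriv (volume.restrict (Ω : Set (Eucl N))) t₀ (fun t x => H h (u t x)) Ht ∧
    ∀ᵐ τ ∂(volume.restrict (Ioi t₀)), ∃ V, IsTimeSlice Ω h a (u τ) (Ht τ) (Lap τ) V := by
  obtain ⟨h1, -, h3, Ht, Lap, h4, h5, h6, h7, h8⟩ := hu
  refine ⟨Ht, Lap, ⟨h4, h5⟩, ?_⟩
  filter_upwards [h3, h6, MemLp.prodMk_left_two h4, MemLp.prodMk_left_two h7,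
    Measure.ae_ae_of_ae_prod h8, ae_restrict_mem measurableSet_Ioi] with τ g1 ⟨V, g2, g3⟩ g4 g5 g6 g7
  refine ⟨V, h1 τ g7.le, g1, g2, g3, g5, g4, ?_⟩
  filter_upwards [g6] with x hx using sub_nonpos.1 hx

theorem IsTimeSlice.aestronglyMeasurable (hS : IsTimeSlice Ω h a v G L V) :
    AEStronglyMeasurable v (volume.restrict (Ω : Set (Eucl N))) :=
  hS.isW12Loc.1.1.aestronglyMeasurable

theorem IsTimeSlice.aestronglyMeasurable_H (hS : IsTimeSlice Ω h a v G L V)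
    (hadm : Admissible h a) :
    AEStronglyMeasurable (fun x => H h (v x)) (volume.restrict (Ω : Set (Eucl N))) := by
  refine (hadm.continuous_H_max.comp_aestronglyMeasurable hS.aestronglyMeasurable).congr ?_
  filter_upwards [hS.nonneg] with x hx
  rw [max_eq_left hx]

theorem IsTimeSlice.integrable_mul (hS : IsTimeSlice Ω h a v G L V) (hadm : Admissible h a)
    (hΩ : Bornology.IsBounded (Ω : Set (Eucl N))) {θ : ℝ → ℝ} (hθ : Continuous θ) {K : ℝ}
    (hK : ∀ s, ‖θ s‖ ≤ K) {f : Eucl N → ℝ}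
    (hf : MemLp f 2 (volume.restrict (Ω : Set (Eucl N)))) :
    IntegrableOn (fun x => θ (H h (v x)) * f x) (Ω : Set (Eucl N)) := by
  have : IsFiniteMeasure (volume.restrict (Ω : Set (Eucl N))) :=
    ⟨by simpa using hΩ.measure_lt_top⟩
  exact (hf.integrable one_le_two).bdd_mul
    (hθ.comp_aestronglyMeasurable (hS.aestronglyMeasurable_H hadm)) (ae_of_all _ fun x => hK _)

/-- `L` is only locally integrable, but `F(v) L` is in `L²` and the remaining factor `θ(H)` is
bounded, so the product is integrable on the bounded set. -/
theorem IsTimeSlice.integrable_weightF (hS : IsTimeSlice Ω h a v G L V) (hadm : Admissible h a)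
    (hΩ : Bornology.IsBounded (Ω : Set (Eucl N))) {θ : ℝ → ℝ} (hθ : Continuous θ) {K : ℝ}
    (hK : ∀ s, ‖θ s‖ ≤ K) (hθ0 : ∀ s, 0 ≤ θ s) :
    IntegrableOn (fun x => weightF h a θ (v x) * L x) (Ω : Set (Eucl N)) ∧
    ∫ x in (Ω : Set (Eucl N)), θ (H h (v x)) * G x
      ≤ ∫ x in (Ω : Set (Eucl N)), weightF h a θ (v x) * L x := by
  have h1 := hS.integrable_mul hadm hΩ hθ hK hS.memLp_right
  have h2 : (fun x => θ (H h (v x)) * (F h a (v x) * L x)) =ᵐ[volume.restrict (Ω : Set (Eucl N))]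
      fun x => weightF h a θ (v x) * L x := by
    filter_upwards [hS.nonneg] with x hx
    rw [weightF, max_eq_left hx, mul_assoc]
  refine ⟨h1.congr h2, ?_⟩
  rw [← integral_congr_ae h2]
  refine integral_mono_ae (hS.integrable_mul hadm hΩ hθ hK hS.memLp_left) h1 ?_
  filter_upwards [hS.le] with x hx
  exact mul_le_mul_of_nonneg_left hx (hθ0 _)

/-- Since `F` is nondecreasing, so is `θ(H) F`; the sign statement in `energy_le` needs no more than
the slope bound zero. -/
theorem IsTimeSlice.integral_nonpos (hS : IsTimeSlice Ω h a v G L V) (hadm : Admissible h a)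
    (hΩ : Bornology.IsBounded (Ω : Set (Eucl N))) {θ : ℝ → ℝ} (hθ : Continuous θ) {K : ℝ}
    (hK : ∀ s, ‖θ s‖ ≤ K) (hθ0 : ∀ s, 0 ≤ θ s) (hθm : Monotone θ) :
    ∫ x in (Ω : Set (Eucl N)), θ (H h (v x)) * G x ≤ 0 := by
  obtain ⟨h1, h2⟩ := hS.integrable_weightF hadm hΩ hθ hK hθ0
  have hm := hadm.monotone_weightF hθm hθ0
  exact h2.trans (energy_le hS.isW12Loc hS.hasWeakDivergence hS.boundary hm
    (hadm.continuous_weightF hθ) (fun s => hadm.weightF_of_nonpos θ) h1 (b := fun _ => 0)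
    fun s _ c hc => SlopeGE.of_monotone hm s hc.le).1

theorem IsTimeSlice.integral_truncPow_succ_le (hS : IsTimeSlice Ω h a v G L V)
    (hadm : Admissible h a) (hΩ : Bornology.IsBounded (Ω : Set (Eucl N))) {p : ℝ} (hp : 0 ≤ p)
    (k : ℕ) :
    ∫ x in (Ω : Set (Eucl N)), truncPow p (k + 1) (H h (v x)) * G x
      ≤ ∫ x in (Ω : Set (Eucl N)), truncPow p k (H h (v x)) * G x := by
  have hi := fun k => hS.integrable_mul hadm hΩ (continuous_truncPow hp k) (norm_truncPow_le hp k)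
    hS.memLp_left
  have h1 := hS.integral_nonpos hadm hΩ
    (θ := fun s => truncPow p (k + 1) s - truncPow p k s)
    ((continuous_truncPow hp _).sub (continuous_truncPow hp _))
    (fun s => (norm_sub_le _ _).trans
      (add_le_add (norm_truncPow_le hp _ s) (norm_truncPow_le hp _ s)))
    (fun s => sub_nonneg.2 (truncPow_mono_right hp k.le_succ s))
    (truncPow_sub_truncPow_mono hp k.le_succ)
  simp only [sub_mul] at h1
  rw [integral_sub (hi _) (hi _)] at h1
  linarith

/-- The density `H(v)^q |∇v|²` of the dissipation, on `{v > 0}`. -/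
def dissipation (h : ℝ → ℝ) (q : ℝ) (v : Eucl N → ℝ) (V : Eucl N → Eucl N) (x : Eucl N) : ℝ≥0∞ :=
  if 0 < v x then ENNReal.ofReal (H h (v x) ^ q * ‖V x‖ ^ 2) else 0

theorem measurable_slopeBound (hadm : Admissible h a) (q₁ c₃ : ℝ) (k : ℕ) :
    Measurable (slopeBound h q₁ c₃ k) := by
  have h1 : Measurable fun s => H h (max s 0) := hadm.continuous_H_max.measurable
  exact Measurable.ite (measurableSet_lt h1 measurable_const) ((h1.pow_const q₁).const_mul c₃)
    measurable_const

/-- Here `A` stands for the rate of change of `Y`, which lies below every truncated rate. Each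
truncation bounds the part of the dissipation where `H < k`; Fatou's lemma sends `k` to infinity. -/
theorem IsTimeSlice.lintegral_dissipation_le (hS : IsTimeSlice Ω h a v G L V)
    (hadm : Admissible h a) (hΩ : Bornology.IsBounded (Ω : Set (Eucl N))) {p₁ q₁ c₃ : ℝ}
    (hp₁ : 0 < p₁) (hq₁ : 0 < q₁) (hc₃ : 0 < c₃) (hlower : DerivLower h a p₁ q₁ c₃) {A : ℝ}
    (hA : ∀ k, A ≤ (p₁ + 1) * ∫ x in (Ω : Set (Eucl N)), truncPow p₁ k (H h (v x)) * G x) :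
    ENNReal.ofReal (c₃ * (p₁ + 1)) * ∫⁻ x in (Ω : Set (Eucl N)), dissipation h q₁ v V x
      ≤ ENNReal.ofReal (-A) := by
  have hp₁' : 0 < p₁ + 1 := by linarith
  have hVm := hS.isW12Loc.1.2.1.aestronglyMeasurable
  have hvm := hS.aestronglyMeasurable
  have hpos : NullMeasurableSet {x | 0 < v x} (volume.restrict (Ω : Set (Eucl N))) :=
    nullMeasurableSet_lt aemeasurable_const hvm.aemeasurable
  set f : ℕ → Eucl N → ℝ≥0∞ := fun k x =>
    if 0 < v x then ENNReal.ofReal (slopeBound h q₁ c₃ k (v x) * ‖V x‖ ^ 2) else 0 with hf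
  have hfm : ∀ k, AEMeasurable (f k) (volume.restrict (Ω : Set (Eucl N))) := by
    intro k
    have h1 : AEMeasurable (fun x => ENNReal.ofReal (slopeBound h q₁ c₃ k (v x) * ‖V x‖ ^ 2))
        (volume.restrict (Ω : Set (Eucl N))) :=
      (((measurable_slopeBound hadm q₁ c₃ k).comp_aemeasurable hvm.aemeasurable).mul
        (hVm.norm.aemeasurable.pow_const 2)).ennreal_ofReal
    exact (h1.indicator₀ hpos).congr (ae_of_all _ fun x => by simp [f, indicator_apply])
  have hfle : ∀ k, ENNReal.ofReal (p₁ + 1) * ∫⁻ x in (Ω : Set (Eucl N)), f k x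
      ≤ ENNReal.ofReal (-A) := by
    intro k
    obtain ⟨h1, h2⟩ := hS.integrable_weightF hadm hΩ (continuous_truncPow hp₁.le k)
      (norm_truncPow_le hp₁.le k) (truncPow_nonneg p₁ k)
    have h3 := (energy_le hS.isW12Loc hS.hasWeakDivergence hS.boundary
      (hadm.monotone_weightF (monotone_truncPow hp₁.le k) (truncPow_nonneg p₁ k))
      (hadm.continuous_weightF (continuous_truncPow hp₁.le k))
      (fun s => hadm.weightF_of_nonpos _) h1 (b := slopeBound h q₁ c₃ k)
      fun s hs c hc => hadm.slopeGE hp₁ hq₁ hlower k hs hc).2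
    refine (mul_le_mul_right h3 _).trans ?_
    rw [← ENNReal.ofReal_mul hp₁'.le]
    refine ENNReal.ofReal_le_ofReal ?_
    have := mul_le_mul_of_nonneg_left h2 hp₁'.le
    have := hA k
    linarith
  have hlim : ∀ x, Tendsto (fun k => f k x) atTop
      (𝓝 (ENNReal.ofReal c₃ * dissipation h q₁ v V x)) := by
    intro x
    refine tendsto_const_nhds.congr' ?_
    filter_upwards [(tendsto_natCast_atTop_atTop (R := ℝ)).eventually_gt_atTop (H h (v x))]
      with k hk
    simp only [f, dissipation]
    split_ifs with hx
    · rw [slopeBound, max_eq_left hx.le, if_pos hk, ← ENNReal.ofReal_mul hc₃.le, mul_assoc]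
    · simp
  have hfatou : ∫⁻ x in (Ω : Set (Eucl N)), ENNReal.ofReal c₃ * dissipation h q₁ v V x
      ≤ liminf (fun k => ∫⁻ x in (Ω : Set (Eucl N)), f k x) atTop := by
    refine le_trans (lintegral_mono fun x => ?_) (lintegral_liminf_le' hfm)
    exact (hlim x).liminf_eq.ge
  rw [lintegral_const_mul' _ _ ENNReal.ofReal_ne_top] at hfatou
  have hp₁0 : ENNReal.ofReal (p₁ + 1) ≠ 0 := by simpa using hp₁'
  rw [ENNReal.ofReal_mul hc₃.le, mul_comm (ENNReal.ofReal c₃), mul_assoc, mul_comm,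
    ← ENNReal.le_div_iff_mul_le (Or.inl hp₁0) (Or.inl ENNReal.ofReal_ne_top)]
  refine hfatou.trans (liminf_le_of_le (by isBoundedDefault) fun b hb => ?_)
  obtain ⟨k, hk⟩ := hb.exists
  refine hk.trans ?_
  rw [ENNReal.le_div_iff_mul_le (Or.inl hp₁0) (Or.inl ENNReal.ofReal_ne_top), mul_comm]
  exact hfle k

theorem eLpNorm_rpow_of_nonneg {α : Type*} [MeasurableSpace α] {μ : Measure α} {w : α → ℝ}
    (hw : ∀ᵐ x ∂μ, 0 ≤ w x) {s q : ℝ} (hq : 0 < q) :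
    eLpNorm (fun x => w x ^ s) (ENNReal.ofReal q) μ
      = (∫⁻ x, ENNReal.ofReal (w x ^ (s * q)) ∂μ) ^ (1 / q) := by
  rw [eLpNorm_eq_lintegral_rpow_enorm_toReal (by simpa using hq) ENNReal.ofReal_ne_top,
    ENNReal.toReal_ofReal hq.le]
  congr 1
  refine lintegral_congr_ae ?_
  filter_upwards [hw] with x hx
  have h1 : 0 ≤ w x ^ s := Real.rpow_nonneg hx s
  rw [Real.enorm_eq_ofReal h1, ENNReal.ofReal_rpow_of_nonneg h1 hq.le, Real.rpow_mul hx]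

/-- This is the origin of the factor `2δ₂/(2 - δ₂)` in `expZ`: the exponent conjugate to `2`
relative to `δ₂`. -/
theorem holderTriple_two {δ : ℝ} (h1 : 1 ≤ δ) (h2 : δ < 2) :
    ENNReal.HolderTriple (ENNReal.ofReal (2 * δ / (2 - δ))) 2 (ENNReal.ofReal δ) := by
  have h3 : 0 < 2 - δ := by linarith
  have h4 : 0 < δ := by linarith
  constructor
  rw [show (2 : ℝ≥0∞) = ENNReal.ofReal 2 by simp, ← ENNReal.ofReal_inv_of_pos (by positivity),
    ← ENNReal.ofReal_inv_of_pos two_pos, ← ENNReal.ofReal_inv_of_pos h4,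
    ← ENNReal.ofReal_add (by positivity) (by positivity)]
  congr 1
  field_simp
  ring

/-- The constant in the estimate of `∫ H(v)^{p₁+1}` by the dissipation. -/
def dissipationConst (C : ℝ≥0∞) (c₅ δ₂ B : ℝ) : ℝ≥0∞ :=
  (C * (ENNReal.ofReal c₅ * (2 * ENNReal.ofReal B ^ (1 / (2 * δ₂ / (2 - δ₂)))))) ^ 2

theorem dissipationConst_ne_top {C : ℝ≥0∞} (hC : C ≠ ⊤) (c₅ B : ℝ) {δ₂ : ℝ} (h1 : 1 ≤ δ₂)
    (h2 : δ₂ < 2) : dissipationConst C c₅ δ₂ B ≠ ⊤ := by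
  have h3 : 0 < 2 - δ₂ := by linarith
  refine ENNReal.pow_ne_top (ENNReal.mul_ne_top hC (ENNReal.mul_ne_top ENNReal.ofReal_ne_top
    (ENNReal.mul_ne_top (by simp) ?_)))
  exact ENNReal.rpow_ne_top_of_nonneg (by positivity) ENNReal.ofReal_ne_top

/-- Sobolev's inequality for `H(v)^{γ₁+1}`, followed by the splitting `H^β = H^{β - q₁/2} H^{q₁/2}`
and Hölder's inequality. The first factor gives the integrals with exponents `expZ`, bounded by `B`,
and the second the square root of the dissipation. -/
theorem IsTimeSlice.lintegral_rpow_le (hS : IsTimeSlice Ω h a v G L V) (hadm : Admissible h a)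
    (hΩ : Bornology.IsBounded (Ω : Set (Eucl N))) {p₁ q₁ γ₁ β₁ β₂ c₅ δ₁ δ₂ B : ℝ}
    (hγ₁ : 0 < γ₁) (hc₅ : 0 < c₅)
    (hupper : DerivUpper h γ₁ β₁ β₂ c₅) (hδ₁ : δ₁ = delta1 p₁ γ₁) (hδ₁_ge : 1 ≤ δ₁)
    (hδ₂_ge : 1 ≤ δ₂) (hδ₂_lt : δ₂ < 2) {C : ℝ≥0∞} (hC : C ≠ ⊤)
    (hsob : ∀ f : Eucl N → ℝ, ContDiff ℝ 1 f → HasCompactSupport f →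
      Function.support f ⊆ (Ω : Set (Eucl N)) →
      eLpNorm f (ENNReal.ofReal δ₁) volume ≤ C * eLpNorm (fderiv ℝ f) (ENNReal.ofReal δ₂) volume)
    (hB₁ : ∫⁻ x in (Ω : Set (Eucl N)), ENNReal.ofReal (H h (v x) ^ expZ β₁ q₁ δ₂)
      ≤ ENNReal.ofReal B)
    (hB₂ : ∫⁻ x in (Ω : Set (Eucl N)), ENNReal.ofReal (H h (v x) ^ expZ β₂ q₁ δ₂)
      ≤ ENNReal.ofReal B) :
    (∫⁻ x in (Ω : Set (Eucl N)), ENNReal.ofReal (H h (v x) ^ (p₁ + 1))) ^ (2 / δ₁)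
      ≤ dissipationConst C c₅ δ₂ B * ∫⁻ x in (Ω : Set (Eucl N)), dissipation h q₁ v V x := by
  set μ := volume.restrict (Ω : Set (Eucl N)) with hμ
  have hδ₁0 : 0 < δ₁ := by linarith
  set r := 2 * δ₂ / (2 - δ₂) with hr
  have h2δ : 0 < 2 - δ₂ := by linarith
  have hr1 : 1 ≤ r := by rw [hr, le_div_iff₀ h2δ]; linarith
  have hr0 : 0 < r := by linarith
  have hH0 : ∀ᵐ x ∂μ, 0 ≤ H h (v x) := by
    filter_upwards [hS.nonneg] with x hx using hadm.H_nonneg hx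
  have hHm := hS.aestronglyMeasurable_H hadm
  have hVm := hS.isW12Loc.1.2.1.aestronglyMeasurable
  have hvm := hS.aestronglyMeasurable
  have hpos : NullMeasurableSet {x | 0 < v x} μ :=
    nullMeasurableSet_lt aemeasurable_const hvm.aemeasurable
  have hS1 := eLpNorm_comp_le_of_memW12Zero (by simpa using hδ₂_ge)
    (ENNReal.ofReal_le_of_le_toReal (by simpa using hδ₂_lt.le)) hΩ hC hsob hS.isW12Loc hS.nonneg
    hS.boundary (w := fun s => H h s ^ (γ₁ + 1)) (w' := fun s => (γ₁ + 1) * H h s ^ γ₁ * h s)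
    (fun s hs => hadm.hasDerivAt_H_rpow γ₁ hs)
    ((((hadm.continuousOn_H.mono Ioi_subset_Ici_self).rpow_const
      fun s hs => Or.inl (hadm.H_pos hs).ne').const_mul _).mul hadm.h_cont)
    (fun s hs => mul_nonneg (mul_nonneg (by linarith)
      (Real.rpow_nonneg (hadm.H_nonneg (le_of_lt hs)) _)) (hadm.h_pos s hs).le)
    (by rw [H_zero, Real.zero_rpow (by linarith)]) (hadm.tendsto_H_rpow (by linarith))
  -- The definition of `δ₁` is made for this: the `L^{δ₁}` norm of `H^{γ₁+1}` is `(∫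
  -- H^{p₁+1})^{1/δ₁}`.
  have hexp : (γ₁ + 1) * δ₁ = p₁ + 1 := by
    rw [hδ₁, delta1]; field_simp
  rw [eLpNorm_rpow_of_nonneg hH0 hδ₁0, hexp] at hS1
  set φ : ℝ → Eucl N → ℝ := fun β x => H h (v x) ^ (β - q₁ / 2) with hφ
  set g : Eucl N → ℝ := fun x => if 0 < v x then H h (v x) ^ (q₁ / 2) * ‖V x‖ else 0 with hg
  have hφm : ∀ β, AEStronglyMeasurable (φ β) μ := fun β =>
    (hHm.aemeasurable.pow_const _).aestronglyMeasurable
  have hgm : AEStronglyMeasurable g μ := by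
    have h1 : AEMeasurable (fun x => H h (v x) ^ (q₁ / 2) * ‖V x‖) μ :=
      (hHm.aemeasurable.pow_const _).mul hVm.norm.aemeasurable
    exact ((h1.indicator₀ hpos).congr
      (ae_of_all _ fun x => by simp [g, indicator_apply])).aestronglyMeasurable
  have hφB : ∀ β, ∫⁻ x, ENNReal.ofReal (H h (v x) ^ expZ β q₁ δ₂) ∂μ ≤ ENNReal.ofReal B →
      eLpNorm (φ β) (ENNReal.ofReal r) μ ≤ ENNReal.ofReal B ^ (1 / r) := by
    intro β hβ
    rw [hφ, eLpNorm_rpow_of_nonneg hH0 hr0]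
    exact ENNReal.rpow_le_rpow hβ (by positivity)
  have hgD : eLpNorm g 2 μ ^ 2 = ∫⁻ x, dissipation h q₁ v V x ∂μ := by
    rw [eLpNorm_eq_lintegral_rpow_enorm_toReal two_ne_zero (by simp), ← ENNReal.rpow_natCast,
      ← ENNReal.rpow_mul]
    simp only [ENNReal.toReal_ofNat, Nat.cast_ofNat, one_div, ne_eq, OfNat.ofNat_ne_zero,
      not_false_eq_true, inv_mul_cancel₀, ENNReal.rpow_one]
    refine lintegral_congr_ae ?_
    filter_upwards [hH0] with x hx
    simp only [g, dissipation]
    split_ifs with hv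
    · have h1 : 0 ≤ H h (v x) ^ (q₁ / 2) * ‖V x‖ := by positivity
      rw [Real.enorm_eq_ofReal h1, ENNReal.ofReal_rpow_of_nonneg h1 zero_le_two]
      congr 1
      rw [Real.mul_rpow (by positivity) (norm_nonneg _), ← Real.rpow_mul hx,
        div_mul_cancel₀ _ two_ne_zero, Real.rpow_two]
    · simp
  have hpt : eLpNorm (fun x => if 0 < v x then ((γ₁ + 1) * H h (v x) ^ γ₁ * h (v x)) • V x else 0)
      (ENNReal.ofReal δ₂) μ ≤ eLpNorm (c₅ • ((φ β₁ + φ β₂) • g)) (ENNReal.ofReal δ₂) μ := by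
    refine eLpNorm_mono_ae (ae_of_all _ fun x => ?_)
    change _ ≤ ‖c₅ * ((φ β₁ x + φ β₂ x) * g x)‖
    simp only [φ, g]
    split_ifs with hv
    · have hHp := hadm.H_pos hv
      have hw0 : 0 ≤ (γ₁ + 1) * H h (v x) ^ γ₁ * h (v x) :=
        mul_nonneg (by positivity) (hadm.h_pos _ hv).le
      rw [norm_smul, Real.norm_of_nonneg hw0, Real.norm_of_nonneg (by positivity)]
      have h1 : ∀ β, H h (v x) ^ (β - q₁ / 2) * H h (v x) ^ (q₁ / 2) = H h (v x) ^ β := fun β => by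
        rw [← Real.rpow_add hHp, sub_add_cancel]
      calc _ ≤ c₅ * (H h (v x) ^ β₁ + H h (v x) ^ β₂) * ‖V x‖ := by
            exact mul_le_mul_of_nonneg_right (hadm.deriv_H_rpow_le hupper hv) (norm_nonneg _)
        _ = _ := by rw [← h1 β₁, ← h1 β₂]; ring
    · simp
  have := holderTriple_two hδ₂_ge hδ₂_lt
  have hhold : eLpNorm (c₅ • ((φ β₁ + φ β₂) • g)) (ENNReal.ofReal δ₂) μ
      ≤ ENNReal.ofReal c₅ * (2 * ENNReal.ofReal B ^ (1 / r)) * eLpNorm g 2 μ := by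
    rw [eLpNorm_const_smul, Real.enorm_eq_ofReal hc₅.le, mul_assoc]
    refine mul_le_mul_right ((eLpNorm_smul_le_mul_eLpNorm (p := ENNReal.ofReal r) (q := 2) hgm
      ((hφm β₁).add (hφm β₂))).trans (mul_le_mul_left ?_ _)) _
    refine (eLpNorm_add_le (hφm β₁) (hφm β₂) (by simpa using hr1)).trans ?_
    rw [two_mul]
    exact add_le_add (hφB β₁ hB₁) (hφB β₂ hB₂)
  have hfin := hS1.trans (mul_le_mul_right (hpt.trans hhold) C)
  have hsq := pow_le_pow_left₀ zero_le hfin 2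
  rw [← ENNReal.rpow_natCast, ← ENNReal.rpow_mul, ← mul_assoc, mul_pow, hgD] at hsq
  have hexp2 : 1 / δ₁ * ((2 : ℕ) : ℝ) = 2 / δ₁ := by push_cast; ring
  rwa [hexp2] at hsq

end Slices

/-! ### Power integrability and the combination of the two estimates. -/

section MainEstimate

variable {α : Type*} [MeasurableSpace α] {μ : Measure α} [IsFiniteMeasure μ]

theorem integrable_rpow_of_memLp {w w₀ : α → ℝ} {p : ℝ} (hp : 0 ≤ p) (hww₀ : w =ᵐ[μ] w₀)
    (hw₀ : MemLp w₀ (ENNReal.ofReal (p + 1)) μ) (hw : ∀ᵐ x ∂μ, 0 ≤ w x) :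
    Integrable w μ ∧ Integrable (fun x => w x ^ (p + 1)) μ := by
  have h1 : MemLp w (ENNReal.ofReal (p + 1)) μ := hw₀.ae_eq hww₀.symm
  have h2 : 0 < p + 1 := by linarith
  refine ⟨h1.integrable (by simpa using hp), ?_⟩
  refine (h1.integrable_norm_rpow (by simpa using h2) ENNReal.ofReal_ne_top).congr ?_
  filter_upwards [hw] with x hx
  rw [ENNReal.toReal_ofReal h2.le, Real.norm_of_nonneg hx]

theorem integrable_rpow_of_le {w : α → ℝ} (hw : ∀ᵐ x ∂μ, 0 ≤ w x) {r q : ℝ} (hr : 0 < r)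
    (hrq : r ≤ q) (hint : Integrable (fun x => w x ^ q) μ) :
    Integrable (fun x => w x ^ r) μ ∧ ∫ x, w x ^ r ∂μ ≤ μ.real univ + ∫ x, w x ^ q ∂μ := by
  have hq : 0 < q := hr.trans_le hrq
  have hle : ∀ᵐ x ∂μ, w x ^ r ≤ 1 + w x ^ q := by
    filter_upwards [hw] with x hx
    rcases le_total (w x) 1 with h1 | h1
    · exact (Real.rpow_le_one hx h1 hr.le).trans (le_add_of_nonneg_right (Real.rpow_nonneg hx q))
    · exact (Real.rpow_le_rpow_of_exponent_le h1 hrq).trans (le_add_of_nonneg_left zero_le_one)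
  have hdom : Integrable (fun x => 1 + w x ^ q) μ := (integrable_const 1).add hint
  have hi : Integrable (fun x => w x ^ r) μ := by
    refine hdom.mono' ?_ ?_
    -- Only `w^q` is known to be measurable; `w^r` is recovered as its power `r / q`.
    · refine ((hint.1.aemeasurable.pow_const (r / q)).congr ?_).aestronglyMeasurable
      filter_upwards [hw] with x hx
      rw [← Real.rpow_mul hx, mul_div_cancel₀ _ hq.ne']
    · filter_upwards [hw, hle] with x hx hx'
      rwa [Real.norm_of_nonneg (Real.rpow_nonneg hx r)]
  refine ⟨hi, (integral_mono_ae hi hdom hle).trans_eq ?_⟩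
  rw [integral_add (integrable_const 1) hint]
  simp

theorem expZ_pos {β q₁ δ₂ : ℝ} (hβ : q₁ / 2 < β) (h1 : 1 ≤ δ₂) (h2 : δ₂ < 2) :
    0 < expZ β q₁ δ₂ := by
  have h3 : 0 < 2 - δ₂ := by linarith
  have h4 : 0 < δ₂ := by linarith
  exact mul_pos (by linarith) (by positivity)

theorem expZ_le_expZ {β₁ β₂ q₁ δ₂ : ℝ} (hβ : β₂ ≤ β₁) (h1 : 1 ≤ δ₂) (h2 : δ₂ < 2) :
    expZ β₂ q₁ δ₂ ≤ expZ β₁ q₁ δ₂ := by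
  have h3 : 0 < 2 - δ₂ := by linarith
  have h4 : 0 < δ₂ := by linarith
  exact mul_le_mul_of_nonneg_right (by linarith) (by positivity)

/-- Eliminates the dissipation `D`, which may a priori be infinite, between `c D ≤ -A` and `y^e ≤ K
D`. The denominator `K + 1` avoids dividing by zero when `K = 0`. -/
theorem add_mul_rpow_nonpos {K D : ℝ≥0∞} (hK : K ≠ ⊤) {c A y e : ℝ} (hc : 0 < c) (hA : A ≤ 0)
    (hy : 0 ≤ y) (he : 0 ≤ e) (h1 : ENNReal.ofReal c * D ≤ ENNReal.ofReal (-A))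
    (h2 : ENNReal.ofReal y ^ e ≤ K * D) : A + c / (K.toReal + 1) * y ^ e ≤ 0 := by
  have hK0 : 0 ≤ K.toReal := ENNReal.toReal_nonneg
  have h3 : ENNReal.ofReal (c * y ^ e) ≤ ENNReal.ofReal (K.toReal * -A) := by
    rw [ENNReal.ofReal_mul hc.le, ENNReal.ofReal_mul hK0, ENNReal.ofReal_toReal hK,
      ← ENNReal.ofReal_rpow_of_nonneg hy he]
    calc _ ≤ ENNReal.ofReal c * (K * D) := mul_le_mul_right h2 _
      _ = K * (ENNReal.ofReal c * D) := by ring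
      _ ≤ _ := mul_le_mul_right h1 _
  have h4 := (ENNReal.ofReal_le_ofReal_iff (mul_nonneg hK0 (by linarith))).1 h3
  have h5 : c / (K.toReal + 1) * y ^ e ≤ -A := by
    rw [div_mul_eq_mul_div, div_le_iff₀ (by linarith)]
    nlinarith
  linarith

end MainEstimate

end DegenerateEinstein

end

/-! ### The main theorem. -/

open DegenerateEinstein in
theorem mainTheorem9
    (N : ℕ) (hN : 1 ≤ N)
    (Ω : TopologicalSpace.Opens (EuclideanSpace ℝ (Fin N)))
    (hΩ : Bornology.IsBounded (Ω : Set (EuclideanSpace ℝ (Fin N))))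
    (h a : ℝ → ℝ) (hadm : DegenerateEinstein.Admissible h a)
    (p₁ q₁ c₃ : ℝ) (hp₁ : 0 < p₁) (hq₁ : 0 < q₁) (hc₃ : 0 < c₃)
    (hlower : DegenerateEinstein.DerivLower h a p₁ q₁ c₃)
    (γ₁ β₁ β₂ c₅ : ℝ) (hγ₁ : 0 < γ₁) (hc₅ : 0 < c₅)
    (hβ₁₂ : β₂ < β₁) (hβ₂ : q₁ / 2 < β₂)
    (hupper : DegenerateEinstein.DerivUpper h γ₁ β₁ β₂ c₅)
    (δ₁ δ₂ p₂ p₃ : ℝ)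
    (hδ₁ : δ₁ = DegenerateEinstein.delta1 p₁ γ₁) (hδ₁_ge : 1 ≤ δ₁) (hδ₁_lt : δ₁ < 2)
    (hδ₂ : δ₂ = DegenerateEinstein.delta2 N δ₁)
    (hp₂ : p₂ = DegenerateEinstein.expZ β₁ q₁ δ₂)
    (hp₃ : p₃ = DegenerateEinstein.expZ β₂ q₁ δ₂)
    (p' : ℝ) (hp' : 0 ≤ p') (hp'p₂ : p₂ ≤ p' + 1)
    (hnonneg : DegenerateEinstein.DerivNonneg h a p')
    (t₀ : ℝ) (u₀ : EuclideanSpace ℝ (Fin N) → ℝ)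
    (u : ℝ → EuclideanSpace ℝ (Fin N) → ℝ)
    (hu : DegenerateEinstein.IsSolution Ω h a t₀ u₀ u)
    (hu₀p₁ : MemLp (fun x => DegenerateEinstein.H h (u₀ x)) (ENNReal.ofReal (p₁ + 1))
      (volume.restrict (Ω : Set (EuclideanSpace ℝ (Fin N)))))
    (hu₀p' : MemLp (fun x => DegenerateEinstein.H h (u₀ x)) (ENNReal.ofReal (p' + 1))
      (volume.restrict (Ω : Set (EuclideanSpace ℝ (Fin N)))))
    (Y Z₁ Z₂ : ℝ → ℝ)
    (hY : Y = DegenerateEinstein.intH Ω h u (p₁ + 1))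
    (hZ₁ : Z₁ = DegenerateEinstein.intH Ω h u p₂)
    (hZ₂ : Z₂ = DegenerateEinstein.intH Ω h u p₃) :
    (∃ B : ℝ, ∀ t > t₀,
      IntegrableOn (fun x => DegenerateEinstein.H h (u t x) ^ p₂)
        (Ω : Set (EuclideanSpace ℝ (Fin N))) ∧ Z₁ t ≤ B ∧
      IntegrableOn (fun x => DegenerateEinstein.H h (u t x) ^ p₃)
        (Ω : Set (EuclideanSpace ℝ (Fin N))) ∧ Z₂ t ≤ B) ∧
    (∀ t ≥ t₀, IntegrableOn (fun x => DegenerateEinstein.H h (u t x) ^ (p₁ + 1))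
      (Ω : Set (EuclideanSpace ℝ (Fin N)))) ∧
    (∀ T ≥ t₀, AbsolutelyContinuousOnInterval Y t₀ T) ∧
    (∃ C₁ > 0,
      (∀ᵐ t ∂(volume.restrict (Ioi t₀)),
        DifferentiableAt ℝ Y t ∧ deriv Y t + C₁ * Y t ^ (2 / δ₁) ≤ 0) ∧
      (Y t₀ = 0 → ∀ t ≥ t₀, Y t = 0) ∧
      (0 < Y t₀ → ∀ t ≥ t₀,
        Y t ≤ (C₁ * ((2 - δ₁) / δ₁) * (t - t₀) + Y t₀ ^ (-((2 - δ₁) / δ₁))) ^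
          (-(δ₁ / (2 - δ₁))))) ∧
    Tendsto Y atTop (𝓝 0) := by
  have hδ₂mem := delta2_mem (N := N) hδ₁_ge hδ₁_lt
  rw [← hδ₂] at hδ₂mem
  obtain ⟨hδ₂_ge, hδ₂_lt⟩ := hδ₂mem
  obtain ⟨C, hC, hsob⟩ := exists_sobolev_const hN hΩ hδ₁_ge hδ₁_lt
  rw [← hδ₂] at hsob
  set μ := volume.restrict (Ω : Set (EuclideanSpace ℝ (Fin N))) with hμ
  have : IsFiniteMeasure μ := ⟨by simpa [μ] using hΩ.measure_lt_top⟩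
  obtain ⟨Ht, Lap, hT, hslice⟩ := hu.ae_isTimeSlice
  have hpos : ∀ t ≥ t₀, ∀ᵐ x ∂μ, 0 ≤ H h (u t x) := fun t ht => by
    filter_upwards [hu.1 t ht] with x hx using hadm.H_nonneg hx
  have hinit : (fun x => H h (u t₀ x)) =ᵐ[μ] fun x => H h (u₀ x) := by
    filter_upwards [hu.2.1] with x hx
    rw [hx]
  have hneg : ∀ {p : ℝ}, 0 ≤ p → ∀ k, ∀ᵐ τ ∂(volume.restrict (Ioi t₀)),
      truncRate μ (fun t x => H h (u t x)) Ht p k τ ≤ 0 := fun {p} hp k => by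
    filter_upwards [hslice] with τ ⟨V, hS⟩
    exact hS.integral_nonpos hadm hΩ (continuous_truncPow hp k) (norm_truncPow_le hp k)
      (truncPow_nonneg p k) (monotone_truncPow hp k)
  obtain ⟨hi, hi₁⟩ := integrable_rpow_of_memLp hp₁.le hinit hu₀p₁ (hpos t₀ le_rfl)
  obtain ⟨-, hi'⟩ := integrable_rpow_of_memLp hp' hinit hu₀p' (hpos t₀ le_rfl)
  -- From `s^r ≤ 1 + s^{p'+1}` for `0 < r ≤ p' + 1` and the monotonicity of `∫ H^{p'+1}`: one bound
  -- serves `Z₁` and `Z₂` at all times.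
  set B := μ.real univ + ∫ x, H h (u t₀ x) ^ (p' + 1) ∂μ with hB
  have hp₂0 : 0 < p₂ := hp₂ ▸ expZ_pos (hβ₂.trans hβ₁₂) hδ₂_ge hδ₂_lt
  have hp₃0 : 0 < p₃ := hp₃ ▸ expZ_pos hβ₂ hδ₂_ge hδ₂_lt
  have hp₃p' : p₃ ≤ p' + 1 := by
    refine le_trans ?_ hp'p₂
    rw [hp₂, hp₃]
    exact expZ_le_expZ hβ₁₂.le hδ₂_ge hδ₂_lt
  have hZ : ∀ {r : ℝ}, 0 < r → r ≤ p' + 1 → ∀ t ≥ t₀,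
      Integrable (fun x => H h (u t x) ^ r) μ ∧ ∫ x, H h (u t x) ^ r ∂μ ≤ B := by
    intro r hr hr' t ht
    obtain ⟨h1, h2⟩ := hT.integrable_rpow hp' hpos hi hi' (hneg hp') ht
    obtain ⟨h3, h4⟩ := integrable_rpow_of_le (hpos t ht) hr hr' h1
    exact ⟨h3, h4.trans (add_le_add_right h2 _)⟩
  have hZl : ∀ {r : ℝ}, 0 < r → r ≤ p' + 1 → ∀ t ≥ t₀,
      ∫⁻ x, ENNReal.ofReal (H h (u t x) ^ r) ∂μ ≤ ENNReal.ofReal B := by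
    intro r hr hr' t ht
    obtain ⟨h1, h2⟩ := hZ hr hr' t ht
    rw [← ofReal_integral_eq_lintegral_ofReal h1]
    · exact ENNReal.ofReal_le_ofReal h2
    · filter_upwards [hpos t ht] with x hx using Real.rpow_nonneg hx r
  have hYint : ∀ t ≥ t₀, Integrable (fun x => H h (u t x) ^ (p₁ + 1)) μ := fun t ht =>
    (hT.integrable_rpow hp₁.le hpos hi hi₁ (hneg hp₁.le) ht).1
  have hYnn : ∀ t ≥ t₀, 0 ≤ᵐ[μ] fun x => H h (u t x) ^ (p₁ + 1) := fun t ht => by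
    filter_upwards [hpos t ht] with x hx using Real.rpow_nonneg hx _
  have hY0 : ∀ t ≥ t₀, 0 ≤ Y t := fun t ht => hY ▸ integral_nonneg_of_ae (hYnn t ht)
  -- `A` is a rate for `Y`, equal to `Y'` almost everywhere; the regularity of `Y`, the decay and
  -- the limit are all read off from it.
  obtain ⟨A, hYA, hA0, hA⟩ := hT.exists_rate hp₁.le hpos hi hi₁ (hneg hp₁.le) fun k => by
    filter_upwards [hslice] with τ ⟨V, hS⟩
    exact hS.integral_truncPow_succ_le hadm hΩ hp₁.le k
  replace hYA : ∀ T ≥ t₀, IntervalIntegrable A volume t₀ T ∧ Y T = Y t₀ + ∫ τ in t₀..T, A τ := by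
    rw [hY]; exact hYA
  set K := dissipationConst C c₅ δ₂ B with hK
  have hKtop : K ≠ ⊤ := dissipationConst_ne_top hC c₅ B hδ₂_ge hδ₂_lt
  have hC₁ : 0 < c₃ * (p₁ + 1) / (K.toReal + 1) := by
    have : 0 ≤ K.toReal := ENNReal.toReal_nonneg
    positivity
  have hAC : ∀ᵐ τ ∂(volume.restrict (Ioi t₀)),
      A τ + c₃ * (p₁ + 1) / (K.toReal + 1) * Y τ ^ (2 / δ₁) ≤ 0 := by
    filter_upwards [hslice, ae_all_iff.2 hA, ae_restrict_mem measurableSet_Ioi]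
      with τ ⟨V, hS⟩ hAτ hτ
    have hτ' : t₀ ≤ τ := le_of_lt hτ
    have h1 := hS.lintegral_dissipation_le hadm hΩ hp₁ hq₁ hc₃ hlower hAτ
    have h2 := hS.lintegral_rpow_le hadm hΩ hγ₁ hc₅ hupper hδ₁ hδ₁_ge hδ₂_ge hδ₂_lt hC hsob
      (hp₂ ▸ hZl hp₂0 hp'p₂ τ hτ') (hp₃ ▸ hZl hp₃0 hp₃p' τ hτ')
    rw [← ofReal_integral_eq_lintegral_ofReal (hYint τ hτ') (hYnn τ hτ')] at h2
    refine add_mul_rpow_nonpos hKtop (by positivity) (hA0 τ) (hY0 τ hτ') (by positivity) h1 ?_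
    rw [hY]; exact h2
  refine ⟨⟨B, fun t ht => ?_⟩, hYint,
    fun T hT' => absolutelyContinuousOnInterval_of_eq_integral hYA hT',
    ⟨_, hC₁, ?_, fun h0 t ht => ?_, fun h0 t ht => ?_⟩,
    tendsto_zero_of_eq_integral hδ₁_ge hδ₁_lt hC₁ hY0 hYA hA0 hAC⟩
  · obtain ⟨h1, h2⟩ := hZ hp₂0 hp'p₂ t (le_of_lt ht)
    obtain ⟨h3, h4⟩ := hZ hp₃0 hp₃p' t (le_of_lt ht)
    rw [hZ₁, hZ₂]
    exact ⟨h1, h2, h3, h4⟩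
  · filter_upwards [ae_hasDerivAt_of_eq_integral hYA, hAC] with t h1 h2
    exact ⟨h1.differentiableAt, by rw [h1.deriv]; exact h2⟩
  · exact le_antisymm ((antitone_of_eq_integral hYA hA0 le_rfl ht).trans_eq h0) (hY0 t ht)
  · exact decay_of_eq_integral hδ₁_ge hδ₁_lt hC₁ hY0 hYA hA0 hAC h0 ht
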